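/- Let $V=\mathbb R^d$ and $W=\mathbb R^n$, and let $X:V\to W$ be a centered stationary (jointly measurable) Gaussian random field whose covariance function $\Omega(v)=\big(\mathbb E[X_i(v)X_j(0)]\big)_{i,j}$ is continuous and non-degenerate, i.e. $\Omega(0)$ is positive definite. Let $\eta$ be the law of $X(0)$, $\langle\cdot,\cdot\rangle$ the scalar product that it induces ($\langle \ell,m\rangle=\int \ell m\,d\eta$ on $W^*$, and by duality on $W$ and on multilinear forms), and for $p\ge 0$ let $H^p_x=(-1)^p e^{\|x\|^2/2}D^p_x\big[e^{-\|\cdot\|^2/2}\big]$ be the Hermite $p$-form. For $f\in L^2(\eta)$ real-valued put $f_p=\int_W f(x)H^p_x\,d\eta(x)$, a symmetric $p$-linear form on $W$, and $\pi_p(f)(x)=\frac1{p!}\langle f_p,H^p_x\rangle$. Let $\phi\in L^1\cap L^2(V)$ be real-valued with $\|\phi\|_2=1$ and such that, for $\gamma=|\hat\phi|^2$, the function $\gamma^+(x)=\sup_{\|y\|\ge\|x\|}\gamma(y)$ is integrable. For $\lambda>0$ put $$Z^{(p)}_\lambda(\phi)=\lambda^{-d/2}\int_V\phi(v/\lambda)\,\pi_p(f)(X(v))\,dv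 .$$ There is a spectral measure $\mu$ of $X$: a matrix $(\mu_{ij})$ of complex measures with $\mu(B)$ Hermitian positive semi-definite for every Borel set $B$, and $\Omega_{ij}(v)=\int e^{2i\pi\langle\xi,v\rangle}\,d\mu_{ij}(\xi)$. For $q\ge1$ let $\mu^{*q}$ be its $q$-fold convolution, the measure with values in the positive Hermitian forms on the symmetric $q$-linear forms on $\mathbb C^n$ obtained by restriction from $\mu^{*q}(\ell_1\otimes\dots\otimes\ell_q,m_1\otimes\dots\otimes m_q)=\mu(\ell_1,m_1)*\dots*\mu(\ell_q,m_q)$. For a representation $d\mu^{*q}=\Sigma_q\,d\nu$ with $\nu$ a finite non-negative measure, the image $\mathrm{Im}(\mu^{*q})$ is the smallest closed set $A$ of tensors such that $\mathrm{Im}(\Sigma_q(x))\subset A$ for $\nu$-almost every $x$ (it does not depend on the representation). The isotropic cone of $f_{2q}$ is $C(f_{2q})=\{z : f_{2q}(z\otimes\bar z)=0\}$. Then, for every $q\ge 1$, the integrals defining $Z^{(2q)}_\lambda(\phi)$ converge absolutely almost surely, $Z^{(2q)}_\lambda(\phi)$ is square-integrable, and: 1. If $\int_V\phi\neq0$ and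 $\mathrm{Im}(\mu^{*q})\not\subset C(f_{2q})$, then $\displaystyle\liminf_{\lambda\to+\infty}\mathrm{Var}\big(Z^{(2q)}_\lambda(\phi)\big)>0$ (possibly $+\infty$). 2. If $\mathrm{Im}(\mu^{*q})\subset C(f_{2q})$, and either $\Omega\in L^{2q}(V)$, or $\mu^{*q}$ has a $C^1$ density with respect to the surface measure of some smooth compact hypersurface, then $\displaystyle\lim_{\lambda\to+\infty}\mathrm{Var}\big(Z^{(2q)}_\lambda(\phi)\big)=0$. -/

import Mathlib

open MeasureTheory ProbabilityTheory Filter Topology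
open scoped ENNReal ComplexOrder

noncomputable section

namespace GaussianChaos

/-- The Euclidean space `ℝ^n`. -/
abbrev E (n : ℕ) : Type := EuclideanSpace ℝ (Fin n)

/-! ### Stationary Gaussian fields -/

/-- The matrix-valued covariance function `v ↦ (𝔼[X_i(v) X_j(0)])_{i,j}` of a centered stationary
field `X` on `ℝ^d` with values in `ℝ^n`. -/
def covFun {d n : ℕ} {Ω : Type*} [MeasurableSpace Ω] (P : Measure Ω) (X : E d → Ω → E n)
    (v : E d) : Matrix (Fin n) (Fin n) ℝ :=
  Matrix.of fun i j => ∫ ω, X v ω i * X 0 ω j ∂P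

/-- `X` is a (jointly measurable) centered stationary Gaussian field on `ℝ^d` with values in `ℝ^n`,
with continuous and non-degenerate covariance function. -/
structure IsStationaryGaussianField {d n : ℕ} {Ω : Type*} [MeasurableSpace Ω] (P : Measure Ω)
    (X : E d → Ω → E n) : Prop where
  measurable : Measurable (Function.uncurry X)
  gaussian : IsGaussianProcess X P
  centered : ∀ v, ∫ ω, X v ω ∂P = 0
  stationary : ∀ h, P.map (fun ω v => X (v + h) ω) = P.map (fun ω v => X v ω)
  continuous_cov : Continuous (covFun P X)
  nondegenerate : (covFun P X 0).PosDef

/-! ### Hermite forms and chaotic projections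

Here `η` is a non-degenerate centered Gaussian measure on `ℝ^n`. -/

/-- The covariance matrix of `η`: the Gram matrix of the dual basis for the scalar product
`⟨ℓ, m⟩ = ∫ ℓ m dη` on the dual space. -/
def gram {n : ℕ} (η : Measure (E n)) : Matrix (Fin n) (Fin n) ℝ :=
  Matrix.of fun i j => ∫ x, x i * x j ∂η

/-- The square of the norm induced by `η` on `ℝ^n`. -/
def normSq {n : ℕ} (η : Measure (E n)) (x : E n) : ℝ :=
  ∑ i, ∑ j, x i * (gram η)⁻¹ i j * x j

/-- The symmetric `p`-linear Hermite form
`H^p_x = (-1)^p exp(‖x‖²/2) D^p_x [exp(-‖·‖²/2)]` on `ℝ^n`. -/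
def hermiteForm {n : ℕ} (η : Measure (E n)) (p : ℕ) (x : E n) :
    ContinuousMultilinearMap ℝ (fun _ : Fin p => E n) ℝ :=
  ((-1) ^ p * Real.exp (normSq η x / 2)) •
    iteratedFDeriv ℝ p (fun y : E n => Real.exp (-(normSq η y / 2))) x

/-- The coordinates `T(e_{I 1}, …, e_{I p})` of a `p`-linear form `T` on `ℝ^n`. -/
def coord {n p : ℕ} (T : ContinuousMultilinearMap ℝ (fun _ : Fin p => E n) ℝ)
    (I : Fin p → Fin n) : ℝ :=
  T fun k => EuclideanSpace.single (I k) (1 : ℝ)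

/-- The coordinates of the chaotic coefficient `f_p = ∫ f(x) H^p_x dη(x)`. -/
def chaosCoeff {n : ℕ} (η : Measure (E n)) (f : E n → ℝ) (p : ℕ) (I : Fin p → Fin n) : ℝ :=
  ∫ x, f x * coord (hermiteForm η p x) I ∂η

/-- The chaotic projection `π_p(f)(x) = (1 / p!) ⟨f_p, H^p_x⟩`, with the scalar product on `p`-linear
forms determined by `⟨ℓ_1 ⊗ … ⊗ ℓ_p, m_1 ⊗ … ⊗ m_p⟩ = ∏_k ⟨ℓ_k, m_k⟩`. -/
def chaosProj {n : ℕ} (η : Measure (E n)) (f : E n → ℝ) (p : ℕ) (x : E n) : ℝ :=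
  (1 / (p.factorial : ℝ)) * ∑ I : Fin p → Fin n, ∑ J : Fin p → Fin n,
    chaosCoeff η f p I * coord (hermiteForm η p x) J * ∏ k, gram η (I k) (J k)

/-- The `p`-th chaos
`Z_λ^{(p)}(φ) = λ^{-d/2} ∫ φ(v/λ) π_p(f)(X(v)) dv`, where `η` is the law of `X(0)`. -/
def chaosZ {d n : ℕ} {Ω : Type*} [MeasurableSpace Ω] (P : Measure Ω) (X : E d → Ω → E n)
    (f : E n → ℝ) (φ : E d → ℝ) (p : ℕ) (lam : ℝ) (ω : Ω) : ℝ :=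
  lam ^ (-(d : ℝ) / 2) * ∫ v, φ (lam⁻¹ • v) * chaosProj (P.map (X 0)) f p (X v ω)

/-! ### Test functions -/

/-- `γ = |φ̂|²`. -/
def gam {d : ℕ} (φ : E d → ℝ) (ξ : E d) : ℝ :=
  ‖FourierTransform.fourier (fun v => (φ v : ℂ)) ξ‖ ^ 2

/-- The least radially decreasing majorant of `γ`. -/
def gamPlus {d : ℕ} (φ : E d → ℝ) (x : E d) : ℝ :=
  ⨆ y : {y : E d // ‖x‖ ≤ ‖y‖}, gam φ y

/-- Test functions: `φ ∈ L¹ ∩ L²` with `‖φ‖₂ = 1` and `γ⁺ ∈ L¹`. -/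
structure IsTestFunction {d : ℕ} (φ : E d → ℝ) : Prop where
  memLp_one : MemLp φ 1 volume
  memLp_two : MemLp φ 2 volume
  norm_two : eLpNorm φ 2 volume = 1
  integrable_gamPlus : Integrable (gamPlus φ) volume

/-! ### Hermitian measures -/

/-- A measure on `ℝ^d` with values in the space of sesquilinear forms on `ℂ^κ`, as a matrix of
complex measures. -/
abbrev MatrixMeasure (d : ℕ) (κ : Type) : Type := κ → κ → ComplexMeasure (E d)

/-- `M` takes values in the space of positive semi-definite Hermitian forms. -/
def IsPositive {d : ℕ} {κ : Type} (M : MatrixMeasure d κ) : Prop :=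
  ∀ B : Set (E d), MeasurableSet B → (Matrix.of fun i j => M i j B).PosSemidef

/-- `μ` is the spectral measure of the covariance function `K`: the positive Hermitian measure with
`K(v) = ∫ exp(2iπ⟨ξ, v⟩) dμ(ξ)`. -/
structure IsSpectralMeasure {d n : ℕ} (K : E d → Matrix (Fin n) (Fin n) ℝ)
    (μ : MatrixMeasure d (Fin n)) : Prop where
  positive : IsPositive μ
  fourier : ∀ v i j, ((K v i j : ℝ) : ℂ) =
    ∫ᵛ ξ, Complex.exp (2 * Real.pi * Complex.I * (inner ℝ ξ v : ℝ))
      ∂[ContinuousLinearMap.mul ℝ ℂ; μ i j]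

/-- The convolution of two complex measures: the push-forward of their product by addition. -/
def conv {d : ℕ} (a b : ComplexMeasure (E d)) : ComplexMeasure (E d) :=
  (a.prod b (ContinuousLinearMap.mul ℝ ℂ)).map fun x => x.1 + x.2

/-- The convolution `c_1 * ⋯ * c_q` of `q` complex measures. -/
def multiConv {d : ℕ} : (q : ℕ) → (Fin q → ComplexMeasure (E d)) → ComplexMeasure (E d)
  | 0, _ => VectorMeasure.dirac 0 1
  | q + 1, c => conv (c 0) (multiConv q fun k => c k.succ)

/-- The `q`-fold convolution `μ^{*q}`, as a measure with values in the Hermitian forms on the space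
of symmetric `q`-linear forms on `ℂ^n`. On `q`-linear forms, it is characterized by
`μ^{*q}(ℓ_1 ⊗ … ⊗ ℓ_q, m_1 ⊗ … ⊗ m_q) = μ(ℓ_1, m_1) * ⋯ * μ(ℓ_q, m_q)`; the restriction to symmetric
forms is represented by its symmetrization, a matrix indexed by multi-indices
whose range lies in the space of symmetric tensors. -/
def convPow {d n : ℕ} (μ : MatrixMeasure d (Fin n)) (q : ℕ) : MatrixMeasure d (Fin q → Fin n) :=
  fun I J => ((q.factorial : ℂ)⁻¹) •
    ∑ σ : Equiv.Perm (Fin q), multiConv q fun k => μ (I (σ k)) (J k)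

/-- `dM = S dν`, with `S` integrable. -/
def HasDensity {d : ℕ} {κ : Type} (M : MatrixMeasure d κ) (ν : Measure (E d))
    (S : E d → Matrix κ κ ℂ) : Prop :=
  ∀ i j, Integrable (fun x => S x i j) ν ∧ M i j = ν.withDensityᵥ fun x => S x i j

/-- A representation `dM = S dν` of a positive Hermitian measure: `ν` is a finite measure, and `S`
takes values in the space of positive semi-definite Hermitian forms. -/
structure IsRepresentation {d : ℕ} {κ : Type} (M : MatrixMeasure d κ) (ν : Measure (E d))
    (S : E d → Matrix κ κ ℂ) : Prop where
  finite : IsFiniteMeasure ν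
  density : HasDensity M ν S
  posSemidef : ∀ᵐ x ∂ν, (S x).PosSemidef

/-- The image of `M`: the smallest closed set `A` such that, for a representation `dM = S dν`, the
image of `S x` is contained in `A` for `ν`-almost every `x`. Representations exist and the condition
on `A` does not depend on the choice of one of them, so we ask for it for all of them. -/
def image {d : ℕ} {κ : Type} [Fintype κ] (M : MatrixMeasure d κ) : Set (κ → ℂ) :=
  ⋂₀ {A | IsClosed A ∧ ∀ ν S, IsRepresentation M ν S →
    ∀ᵐ x ∂ν, Set.range (fun w : κ → ℂ => (S x).mulVec w) ⊆ A}

/-- The isotropic cone of `f_{2q}`, seen as the Hermitian form `z ↦ f_{2q}(z ⊗ z̄)` on tensors. -/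
def isotropicCone {n : ℕ} (η : Measure (E n)) (f : E n → ℝ) (q : ℕ) :
    Set ((Fin q → Fin n) → ℂ) :=
  {z | ∑ I, ∑ J, (chaosCoeff η f (2 * q) (Fin.append I J ∘ Fin.cast (two_mul q)) : ℂ) *
    z I * star (z J) = 0}

/-! ### Hypersurfaces -/

/-- `S` is a smooth compact hypersurface of `ℝ^d`. -/
def IsSmoothCompactHypersurface {d : ℕ} (S : Set (E d)) : Prop :=
  IsCompact S ∧ ∀ x ∈ S, ∃ g : E d → ℝ, ContDiffAt ℝ ((⊤ : ℕ∞) : WithTop ℕ∞) g x ∧ fderiv ℝ g x ≠ 0 ∧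
    ∀ᶠ y in 𝓝 x, (y ∈ S ↔ g y = 0)

/-- The surface measure of a hypersurface `S` of `ℝ^d` (up to a positive normalizing constant that
depends only on `d`): the `(d-1)`-dimensional Hausdorff measure on `S`. -/
def surfaceMeasure {d : ℕ} (S : Set (E d)) : Measure (E d) :=
  (Measure.hausdorffMeasure ((d : ℝ) - 1)).restrict S

/-- `g` is of class `C¹` on `S`: it is locally the restriction of a `C¹` function on the ambient
space. -/
def IsC1On {d : ℕ} (S : Set (E d)) (g : E d → ℂ) : Prop :=
  ∀ x ∈ S, ∃ h : E d → ℂ, ContDiffAt ℝ 1 h x ∧ ∀ᶠ y in 𝓝[S] x, h y = g y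

/-- `M` has a `C¹` density with respect to the surface measure of a smooth compact hypersurface. -/
def HasC1SurfaceDensity {d : ℕ} {κ : Type} (M : MatrixMeasure d κ) : Prop :=
  ∃ (S : Set (E d)) (D : E d → Matrix κ κ ℂ), IsSmoothCompactHypersurface S ∧
    (∀ i j, IsC1On S fun x => D x i j) ∧ HasDensity M (surfaceMeasure S) D

end GaussianChaos

end

open MeasureTheory ProbabilityTheory Filter Topology
open scoped ENNReal ComplexOrder

noncomputable section

namespace GaussianChaos

/-! ### Complex measures as densities with respect to finite positive measures -/

section VectorMeasure

variable {α β : Type*} [MeasurableSpace α] [MeasurableSpace β]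

/-! The variance of the chaos is a double integral against the spectral measure, with a kernel that
concentrates on the diagonal as λ grows. The integrand is a nonnegative form in the two spectral
densities, and it vanishes on the diagonal exactly when their ranges are isotropic.

Spectral formula. Symmetric tensors are combinations of powers of real vectors, so second moments of
Wick powers reduce to E[H_p(a) H_p(b)] = p! c^p for a Gaussian pair of covariance c
(`IsGaussianPair.integral_herm_mul_herm`). Hence π_{2q}(f)(X) has covariance (1/(2q)!) ⟨f_{2q},
Ω(v)^{⊗2q} f_{2q}⟩. Cut the 2q indices into two halves. With F the matrix of f_{2q} on q-tensors and
A(v) the symmetrized q-th power of Ω(v), the bracket is tr(F A F A*) (`tensorCov_chaosCoeff`). As A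
is the Fourier transform of μ^{*q} = Σ dν, the variance is (1/(2q)!) ∬ λ^d γ(λ(y-x)) tr(F Σ(x) F
Σ(y)) dν(x) dν(y) (`IsStationaryGaussianField.evariance_chaosZ_eq`).

Linear algebra. For A = C*C and B = D*D the trace tr(F A F B) is the squared Hilbert–Schmidt norm of
C F D*, so it is nonnegative. For A = B it vanishes iff the range of A lies in the isotropic cone
(`pairing_self_eq_zero_iff`). If A and B are both isotropic, polarization bounds it by a constant
times ‖A - B‖² (`norm_pairing_le_of_isotropic`).

Non-isotropic image. Some bounded set K of positive ν-measure has tr(F Σ(x) F Σ(y)) ≥ c on K × K. A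
finite measure on a bounded set gives the δ-neighborhood of the diagonal mass at least of order δ^d
(`measure_prod_dist_lt`). With δ of order 1/λ this compensates λ^d, and γ is bounded below near 0
because γ(0) = (∫φ)².

Isotropic image. It remains to show that ∬ λ^d γ(λ(y-x)) ‖Σ(x) - Σ(y)‖² dν dν tends to 0. If Ω is in
L^{2q}, Plancherel gives μ^{*q} a density in L², and translations are continuous in L². For a C¹
density on a hypersurface, Σ is Lipschitz and balls of radius r have mass O(r^{d-1}). Dyadic shells
of radius r_k then contribute r_k (λ r_k)^d γ⁺(λ r_k), which is summable and tends to 0 because γ⁺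
is radially decreasing and integrable.

The spectral measure and the positivity of μ^{*q} both come from Bochner's theorem applied to the
Wick powers of X, of order 1 and of order q. -/

lemma re_apply (c : ComplexMeasure α) (B : Set α) : ComplexMeasure.re c B = (c B).re := rfl

lemma im_apply (c : ComplexMeasure α) (B : Set α) : ComplexMeasure.im c B = (c B).im := rfl

/-- A complex measure which vanishes on the null sets of a finite measure has a density. -/
lemma exists_withDensity_eq (c : ComplexMeasure α) (κ : Measure α) [IsFiniteMeasure κ]
    (h : ∀ B, MeasurableSet B → κ B = 0 → c B = 0) :
    ∃ s : α → ℂ, Measurable s ∧ Integrable s κ ∧ c = κ.withDensityᵥ s := by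
  have hre : κ.withDensityᵥ ((ComplexMeasure.re c).rnDeriv κ) = ComplexMeasure.re c := by
    apply SignedMeasure.withDensityᵥ_rnDeriv_eq
    refine VectorMeasure.AbsolutelyContinuous.mk fun B hB h0 => ?_
    rw [Measure.toENNRealVectorMeasure_apply_measurable hB] at h0
    rw [re_apply, h B hB h0, Complex.zero_re]
  have him : κ.withDensityᵥ ((ComplexMeasure.im c).rnDeriv κ) = ComplexMeasure.im c := by
    apply SignedMeasure.withDensityᵥ_rnDeriv_eq
    refine VectorMeasure.AbsolutelyContinuous.mk fun B hB h0 => ?_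
    rw [Measure.toENNRealVectorMeasure_apply_measurable hB] at h0
    rw [im_apply, h B hB h0, Complex.zero_im]
  have i1 := SignedMeasure.integrable_rnDeriv (ComplexMeasure.re c) κ
  have i2 := SignedMeasure.integrable_rnDeriv (ComplexMeasure.im c) κ
  have i3 : Integrable (fun x => (((ComplexMeasure.re c).rnDeriv κ x : ℝ) : ℂ)
      + ((ComplexMeasure.im c).rnDeriv κ x : ℝ) * Complex.I) κ :=
    i1.ofReal.add (i2.ofReal.mul_const _)
  refine ⟨fun x => (((ComplexMeasure.re c).rnDeriv κ x : ℝ) : ℂ)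
      + ((ComplexMeasure.im c).rnDeriv κ x : ℝ) * Complex.I, ?_, i3, ?_⟩
  · have := SignedMeasure.measurable_rnDeriv (ComplexMeasure.re c) κ
    have := SignedMeasure.measurable_rnDeriv (ComplexMeasure.im c) κ
    fun_prop
  · ext B hB
    have i1c : Integrable (fun x => (((ComplexMeasure.re c).rnDeriv κ x : ℝ) : ℂ)) κ := i1.ofReal
    have i2c : Integrable (fun x => (((ComplexMeasure.im c).rnDeriv κ x : ℝ) : ℂ) * Complex.I) κ :=
      i2.ofReal.mul_const _
    rw [withDensityᵥ_apply i3 hB, integral_add (μ := κ.restrict B) i1c.integrableOn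
      i2c.integrableOn, integral_mul_const]
    have e1 : ∫ x in B, (((ComplexMeasure.re c).rnDeriv κ x : ℝ) : ℂ) ∂κ = ((c B).re : ℂ) := by
      rw [integral_complex_ofReal, ← withDensityᵥ_apply i1 hB, hre]
      rw [re_apply]
    have e2 : ∫ x in B, (((ComplexMeasure.im c).rnDeriv κ x : ℝ) : ℂ) ∂κ = ((c B).im : ℂ) := by
      rw [integral_complex_ofReal, ← withDensityᵥ_apply i2 hB, him]
      rw [im_apply]
    rw [e1, e2, Complex.re_add_im]

/-- A finite family of complex measures has densities with respect to a common finite measure. -/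
lemma exists_common_density {ι : Type*} [Fintype ι] (c : ι → ComplexMeasure α) :
    ∃ (κ : Measure α) (s : ι → α → ℂ), IsFiniteMeasure κ ∧
      ∀ i, Measurable (s i) ∧ Integrable (s i) κ ∧ c i = κ.withDensityᵥ (s i) := by
  let κ : Measure α := ∑ i, ((ComplexMeasure.re (c i)).totalVariation +
    (ComplexMeasure.im (c i)).totalVariation)
  have hκ : IsFiniteMeasure κ := inferInstance
  have h : ∀ i, ∃ s : α → ℂ, Measurable s ∧ Integrable s κ ∧ c i = κ.withDensityᵥ s := by
    intro i
    apply exists_withDensity_eq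
    intro B hB h0
    simp only [κ, Measure.coe_finsetSum, Finset.sum_apply, Measure.coe_add, Pi.add_apply,
      Finset.sum_eq_zero_iff, Finset.mem_univ, true_implies, add_eq_zero] at h0
    have h1 := SignedMeasure.null_of_totalVariation_zero _ (h0 i).1
    have h2 := SignedMeasure.null_of_totalVariation_zero _ (h0 i).2
    rw [re_apply] at h1
    rw [im_apply] at h2
    exact Complex.ext h1 h2
  choose s hs using h
  exact ⟨κ, s, hκ, hs⟩

/-- The variation of s dκ is |s| dκ. Its finiteness makes bounded measurable functions integrable
against a complex measure. -/
lemma isFiniteMeasure_variation (c : ComplexMeasure α) : IsFiniteMeasure c.variation := by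
  obtain ⟨κ, s, hκ, h⟩ := exists_common_density (fun _ : Unit => c)
  rw [(h ()).2.2, Measure.variation_withDensityᵥ (h ()).2.1]
  exact ⟨by simpa [HasFiniteIntegral] using! (h ()).2.1.2⟩

/-- The integral of a bounded function against a complex measure with a density. -/
lemma integral_withDensity (κ : Measure α) {s : α → ℂ} (hs : Integrable s κ) {g : α → ℂ}
    (hg : StronglyMeasurable g) {C : ℝ} (hC : ∀ x, ‖g x‖ ≤ C) :
    ∫ᵛ x, g x ∂[ContinuousLinearMap.mul ℝ ℂ; κ.withDensityᵥ s] = ∫ x, g x * s x ∂κ := by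
  have hfin : IsFiniteMeasure (κ.withDensityᵥ s).variation := isFiniteMeasure_variation _
  -- Both sides are linear, so they agree on simple functions; bounded approximations of g and
  -- dominated convergence on each side do the rest.
  have hsimple : ∀ f : SimpleFunc α ℂ,
      ∫ᵛ x, f x ∂[ContinuousLinearMap.mul ℝ ℂ; κ.withDensityᵥ s] = ∫ x, f x * s x ∂κ := by
    intro f
    have hint : ∀ f : SimpleFunc α ℂ, Integrable (fun x => f x * s x) κ := fun f => by
      obtain ⟨C, hC⟩ := f.exists_forall_norm_le
      exact hs.bdd_mul f.aestronglyMeasurable (ae_of_all _ hC)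
    have hint' : ∀ f : SimpleFunc α ℂ, (κ.withDensityᵥ s).Integrable f := fun f => by
      obtain ⟨C, hC⟩ := f.exists_forall_norm_le
      exact Integrable.of_bound f.aestronglyMeasurable C (ae_of_all _ hC)
    induction f using SimpleFunc.induction with
    | @const c B hB =>
      simp only [SimpleFunc.const_zero, SimpleFunc.coe_piecewise, SimpleFunc.coe_const,
        SimpleFunc.coe_zero, Set.piecewise_eq_indicator]
      have : ∀ x, B.indicator (Function.const α c) x * s x = B.indicator (fun x => c * s x) x := by
        intro x; by_cases hx : x ∈ B <;> simp [hx]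
      simp_rw [this]
      rw [integral_indicator hB, integral_const_mul, ← withDensityᵥ_apply hs hB]
      have := VectorMeasure.integral_indicator (μ := κ.withDensityᵥ s)
        (B := ContinuousLinearMap.mul ℝ ℂ) (f := fun _ => c) hB
      erw [this]
      rw [VectorMeasure.integral_const]
      simp [hB, VectorMeasure.restrict_apply]
    | @add f g hd hf hg =>
      simp only [SimpleFunc.coe_add, Pi.add_apply, add_mul]
      rw [VectorMeasure.integral_fun_add (hint' f) (hint' g), hf, hg, integral_add (hint f) (hint g)]
  have h1 : Tendsto (fun n => ∫ᵛ x, hg.approxBounded C n x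
      ∂[ContinuousLinearMap.mul ℝ ℂ; κ.withDensityᵥ s]) atTop
      (𝓝 (∫ᵛ x, g x ∂[ContinuousLinearMap.mul ℝ ℂ; κ.withDensityᵥ s])) :=
    VectorMeasure.tendsto_integral_of_dominated_convergence (fun _ => C) (fun n => (hg.approxBounded C n).aestronglyMeasurable)
    (integrable_const _) (fun n => ae_of_all _ fun x => hg.norm_approxBounded_le
      ((norm_nonneg _).trans (hC x)) n x)
    (ae_of_all _ fun x => hg.tendsto_approxBounded_of_norm_le (hC x))
  have h2 : Tendsto (fun n => ∫ x, hg.approxBounded C n x * s x ∂κ) atTop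
      (𝓝 (∫ x, g x * s x ∂κ)) := by
    refine tendsto_integral_of_dominated_convergence (fun x => C * ‖s x‖)
      (fun n => (hg.approxBounded C n).aestronglyMeasurable.mul hs.aestronglyMeasurable)
      (hs.norm.const_mul C) (fun n => ae_of_all _ fun x => ?_) (ae_of_all _ fun x => ?_)
    · rw [norm_mul]
      gcongr
      exact hg.norm_approxBounded_le ((norm_nonneg _).trans (hC x)) n x
    · exact (hg.tendsto_approxBounded_of_norm_le (hC x)).mul_const _
  simp only [hsimple] at h1
  exact tendsto_nhds_unique h1 h2

end VectorMeasure

/-! ### Fourier transforms of complex measures: multiplicativity and injectivity -/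

section FourierTransform

variable {d : ℕ}

/-- The character `exp(2iπ⟨ξ, v⟩)`. -/
def expo (ξ v : E d) : ℂ := Complex.exp (2 * Real.pi * Complex.I * (inner ℝ ξ v : ℝ))

lemma expo_eq (ξ v : E d) : expo ξ v = Complex.exp (((2 * Real.pi * inner ℝ ξ v : ℝ) : ℂ) * Complex.I) := by
  unfold expo; congr 1; push_cast; ring

lemma norm_expo (ξ v : E d) : ‖expo ξ v‖ = 1 := by
  rw [expo_eq, Complex.norm_exp_ofReal_mul_I]

lemma continuous_expo : Continuous fun p : E d × E d => expo p.1 p.2 := by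
  unfold expo; fun_prop

@[fun_prop]
lemma continuous_expo_comp {X : Type*} [TopologicalSpace X] {f g : X → E d} (hf : Continuous f)
    (hg : Continuous g) : Continuous fun x => expo (f x) (g x) :=
  continuous_expo.comp (hf.prodMk hg)

lemma expo_add_left (ξ ξ' v : E d) : expo (ξ + ξ') v = expo ξ v * expo ξ' v := by
  unfold expo; rw [← Complex.exp_add, inner_add_left]; congr 1; push_cast; ring

lemma expo_comm (ξ v : E d) : expo ξ v = expo v ξ := by
  unfold expo; rw [real_inner_comm]

lemma expo_add_right (ξ v v' : E d) : expo ξ (v + v') = expo ξ v * expo ξ v' := by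
  rw [expo_comm, expo_add_left, expo_comm v, expo_comm v']

lemma expo_neg_right (ξ v : E d) : expo ξ (-v) = star (expo ξ v) := by
  rw [expo_eq, expo_eq, Complex.star_def, ← Complex.exp_conj, inner_neg_right]; congr 1
  rw [map_mul, Complex.conj_ofReal, Complex.conj_I]; push_cast; ring

lemma expo_neg_left (ξ v : E d) : expo (-ξ) v = star (expo ξ v) := by
  rw [expo_comm, expo_neg_right, expo_comm]

lemma expo_sub_left (ξ ξ' v : E d) : expo (ξ - ξ') v = expo ξ v * star (expo ξ' v) := by
  rw [sub_eq_add_neg, expo_add_left, expo_neg_left]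

lemma expo_sub_right (ξ v v' : E d) : expo ξ (v - v') = expo ξ v * star (expo ξ v') := by
  rw [sub_eq_add_neg, expo_add_right, expo_neg_right]

@[simp]
lemma expo_zero_left (v : E d) : expo 0 v = 1 := by simp [expo]

@[simp]
lemma expo_zero_right (v : E d) : expo v 0 = 1 := by simp [expo]

/-- The Fourier transform of a complex measure. -/
def ft (c : ComplexMeasure (E d)) (v : E d) : ℂ :=
  ∫ᵛ ξ, expo ξ v ∂[ContinuousLinearMap.mul ℝ ℂ; c]

lemma ft_withDensity (κ : Measure (E d)) {s : E d → ℂ} (hs : Integrable s κ) (v : E d) :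
    ft (κ.withDensityᵥ s) v = ∫ ξ, expo ξ v * s ξ ∂κ :=
  integral_withDensity κ hs (by fun_prop : Continuous fun ξ : E d => expo ξ v).stronglyMeasurable
    (fun ξ => (norm_expo ξ v).le)

lemma integrable_expo_mul {κ : Measure (E d)} {s : E d → ℂ} (hs : Integrable s κ) (v : E d) :
    Integrable (fun ξ => expo ξ v * s ξ) κ :=
  hs.bdd_mul (c := 1) (by fun_prop : Continuous fun ξ : E d => expo ξ v).aestronglyMeasurable
    (ae_of_all _ fun ξ => (norm_expo ξ v).le)

lemma ft_add (a b : ComplexMeasure (E d)) (v : E d) : ft (a + b) v = ft a v + ft b v := by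
  obtain ⟨κ, s, hκ, h⟩ := exists_common_density ![a, b]
  have ha := h 0
  have hb := h 1
  simp only [Matrix.cons_val_zero, Matrix.cons_val_one] at ha hb
  rw [ha.2.2, hb.2.2, ← withDensityᵥ_add ha.2.1 hb.2.1, ft_withDensity κ ha.2.1,
    ft_withDensity κ hb.2.1, ft_withDensity κ (ha.2.1.add hb.2.1),
    ← integral_add (integrable_expo_mul ha.2.1 v) (integrable_expo_mul hb.2.1 v)]
  simp [mul_add]

lemma ft_smul (r : ℂ) (a : ComplexMeasure (E d)) (v : E d) : ft (r • a) v = r * ft a v := by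
  obtain ⟨κ, s, hκ, h⟩ := exists_common_density (fun _ : Unit => a)
  have ha := h ()
  rw [ha.2.2, ← withDensityᵥ_smul _ r, ft_withDensity κ ha.2.1,
    ft_withDensity κ (ha.2.1.smul r), ← integral_const_mul]
  simp [mul_left_comm]

lemma ft_zero (v : E d) : ft (0 : ComplexMeasure (E d)) v = 0 :=
  VectorMeasure.integral_zero_vectorMeasure

lemma ft_sum {ι : Type*} (t : Finset ι) (a : ι → ComplexMeasure (E d)) (v : E d) :
    ft (∑ i ∈ t, a i) v = ∑ i ∈ t, ft (a i) v := by
  classical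
  induction t using Finset.induction_on with
  | empty => simp [ft_zero]
  | insert i t hi ih => rw [Finset.sum_insert hi, Finset.sum_insert hi, ft_add, ih]

lemma prod_withDensity (κ κ' : Measure (E d)) [IsFiniteMeasure κ] [IsFiniteMeasure κ']
    {s s' : E d → ℂ} (hs : Integrable s κ) (hs' : Integrable s' κ') :
    (κ.withDensityᵥ s).prod (κ'.withDensityᵥ s') (ContinuousLinearMap.mul ℝ ℂ) =
      (κ.prod κ').withDensityᵥ fun z => s z.1 * s' z.2 := by
  apply VectorMeasure.prod_eq_of_forall_apply_prod
  intro A B hA hB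
  rw [withDensityᵥ_apply (hs.mul_prod hs') (hA.prod hB), setIntegral_prod_mul,
    withDensityᵥ_apply hs hA, withDensityᵥ_apply hs' hB]
  rfl

/-- Characters turn the push-forward by addition into a product, and Fubini applies once both
measures have densities. -/
lemma ft_conv (a b : ComplexMeasure (E d)) (v : E d) : ft (conv a b) v = ft a v * ft b v := by
  obtain ⟨κ, s, hκ, h⟩ := exists_common_density ![a, b]
  have ha := h 0
  have hb := h 1
  simp only [Matrix.cons_val_zero, Matrix.cons_val_one] at ha hb
  have hint := ha.2.1.mul_prod hb.2.1
  have hadd : Measurable fun x : E d × E d => x.1 + x.2 := by fun_prop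
  rw [conv, ha.2.2, hb.2.2, prod_withDensity κ κ ha.2.1 hb.2.1]
  have hfin : IsFiniteMeasure ((κ.prod κ).withDensityᵥ fun z => s 0 z.1 * s 1 z.2).variation :=
    isFiniteMeasure_variation _
  unfold ft
  rw [VectorMeasure.integral_map hadd
    (by fun_prop : Continuous fun ξ : E d => expo ξ v).aestronglyMeasurable
    (Integrable.of_bound (C := 1) (by fun_prop : Continuous fun z : E d × E d =>
      expo (z.1 + z.2) v).aestronglyMeasurable (ae_of_all _ fun z => (norm_expo _ v).le)),
    integral_withDensity _ hint (by fun_prop : Continuous fun z : E d × E d =>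
      expo (z.1 + z.2) v).stronglyMeasurable (C := 1) (fun z => (norm_expo _ v).le)]
  change _ = ft _ v * ft _ v
  rw [ft_withDensity κ ha.2.1, ft_withDensity κ hb.2.1, ← integral_prod_mul]
  congr with z
  rw [expo_add_left]; ring

lemma ft_dirac_zero (v : E d) : ft (VectorMeasure.dirac 0 1) v = 1 := by
  unfold ft
  rw [VectorMeasure.integral_dirac]
  simp

lemma ft_multiConv (q : ℕ) (c : Fin q → ComplexMeasure (E d)) (v : E d) :
    ft (multiConv q c) v = ∏ k, ft (c k) v := by
  induction q with
  | zero => simp [multiConv, ft_dirac_zero]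
  | succ q ih => rw [multiConv, ft_conv, ih, Fin.prod_univ_succ]

/-- The positive and negative parts of s dκ are finite positive measures with the same
characteristic function, hence are equal. -/
lemma ae_eq_zero_of_integral_expo_real {κ : Measure (E d)} {s : E d → ℝ}
    (hs : Integrable s κ) (h : ∀ v, ∫ ξ, expo ξ v * s ξ ∂κ = 0) : s =ᵐ[κ] 0 := by
  set μ₁ := κ.withDensity fun x => ENNReal.ofReal (s x)
  set μ₂ := κ.withDensity fun x => ENNReal.ofReal (-s x)
  have f₁ : IsFiniteMeasure μ₁ := isFiniteMeasure_withDensity_ofReal hs.2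
  have f₂ : IsFiniteMeasure μ₂ := isFiniteMeasure_withDensity_ofReal hs.neg.2
  have hch : ∀ (s : E d → ℝ), Integrable s κ → ∀ t, charFun (κ.withDensity fun x => ENNReal.ofReal (s x)) t =
      ∫ ξ, expo ξ ((2 * Real.pi)⁻¹ • t) * ((max (s ξ) 0 : ℝ) : ℂ) ∂κ := by
    intro s hs t
    rw [charFun_apply, integral_withDensity_eq_integral_toReal_smul₀
      hs.aestronglyMeasurable.aemeasurable.ennreal_ofReal (by simp)]
    congr with ξ
    rw [ENNReal.toReal_ofReal', expo_eq, inner_smul_right, Complex.real_smul, mul_comm]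
    congr 3
    field_simp
  have heq : μ₁ = μ₂ := by
    apply Measure.ext_of_charFun
    ext t
    rw [hch s hs, hch (fun x => -s x) hs.neg, ← sub_eq_zero, ← integral_sub]
    · rw [← h ((2 * Real.pi)⁻¹ • t)]
      congr with ξ
      rw [← mul_sub, ← Complex.ofReal_sub]
      congr 2
      rcases le_total (s ξ) 0 with h | h <;> simp [h]
    · exact integrable_expo_mul (hs.pos_part.ofReal) _
    · exact integrable_expo_mul (hs.neg.pos_part.ofReal) _
  refine hs.ae_eq_zero_of_forall_setIntegral_eq_zero fun B hB _ => ?_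
  have h1 : ∫⁻ x in B, ENNReal.ofReal (s x) ∂κ = ∫⁻ x in B, ENNReal.ofReal (-s x) ∂κ := by
    rw [← withDensity_apply _ hB, ← withDensity_apply _ hB]
    exact congrArg (fun m : Measure (E d) => m B) heq
  rw [integral_eq_lintegral_pos_part_sub_lintegral_neg_part hs.integrableOn, h1, sub_self]

/-- The Fourier transform is injective. -/
lemma ae_eq_zero_of_integral_expo {κ : Measure (E d)} {s : E d → ℂ}
    (hs : Integrable s κ) (h : ∀ v, ∫ ξ, expo ξ v * s ξ ∂κ = 0) : s =ᵐ[κ] 0 := by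
  -- Conjugation and v ↦ -v transfer the hypothesis to the conjugate of s, so the real and imaginary
  -- parts can be treated separately.
  have h' : ∀ v, ∫ ξ, expo ξ v * star (s ξ) ∂κ = 0 := by
    intro v
    have := congrArg (starRingEnd ℂ) (h (-v))
    rw [← integral_conj, map_zero] at this
    rw [← this]
    congr with ξ
    rw [expo_neg_right]; simp
  have hs' : Integrable (fun ξ => star (s ξ)) κ :=
    (integrable_norm_iff (Complex.continuous_conj.comp_aestronglyMeasurable
      hs.aestronglyMeasurable)).1 (by simpa using hs.norm)
  have hre : (fun ξ => (s ξ).re) =ᵐ[κ] 0 := by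
    refine ae_eq_zero_of_integral_expo_real hs.re fun v => ?_
    have e : ∀ ξ, expo ξ v * ((s ξ).re : ℂ) =
        (1 / 2 : ℂ) * (expo ξ v * s ξ + expo ξ v * star (s ξ)) := fun ξ => by
      rw [← mul_add, Complex.star_def, Complex.add_conj]; push_cast; ring
    simp_rw [e]
    rw [integral_const_mul, integral_add (integrable_expo_mul hs v) (integrable_expo_mul hs' v),
      h, h']
    simp
  have him : (fun ξ => (s ξ).im) =ᵐ[κ] 0 := by
    refine ae_eq_zero_of_integral_expo_real hs.im fun v => ?_
    have e : ∀ ξ, expo ξ v * ((s ξ).im : ℂ) =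
        (1 / (2 * Complex.I) : ℂ) * (expo ξ v * s ξ - expo ξ v * star (s ξ)) := fun ξ => by
      rw [← mul_sub, Complex.star_def, Complex.sub_conj]; push_cast
      field_simp
    simp_rw [e]
    rw [integral_const_mul, integral_sub (integrable_expo_mul hs v) (integrable_expo_mul hs' v),
      h, h']
    simp
  filter_upwards [hre, him] with ξ h1 h2
  exact Complex.ext h1 h2

lemma ft_injective {a b : ComplexMeasure (E d)} (h : ∀ v, ft a v = ft b v) : a = b := by
  obtain ⟨κ, s, hκ, hc⟩ := exists_common_density ![a, b]
  have ha := hc 0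
  have hb := hc 1
  simp only [Matrix.cons_val_zero, Matrix.cons_val_one] at ha hb
  have := ae_eq_zero_of_integral_expo (ha.2.1.sub hb.2.1) (fun v => by
    have := h v
    rw [ha.2.2, hb.2.2, ft_withDensity κ ha.2.1, ft_withDensity κ hb.2.1, ← sub_eq_zero,
      ← integral_sub (integrable_expo_mul ha.2.1 v) (integrable_expo_mul hb.2.1 v)] at this
    simpa [mul_sub] using this)
  rw [ha.2.2, hb.2.2]
  refine WithDensityᵥEq.congr_ae ?_
  filter_upwards [this] with x hx
  exact sub_eq_zero.1 hx

end FourierTransform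

/-! ### One-variable Hermite polynomials and their orthogonality -/

section Hermite

variable {Ω : Type*} [MeasurableSpace Ω] {P : Measure Ω}

/-- The Hermite polynomial of a Gaussian variable of variance `α`, through its generating
function. -/
def herm (p : ℕ) (α a : ℝ) : ℝ :=
  iteratedDeriv p (fun z => Real.exp (z * a - z ^ 2 * α / 2)) 0

/-- Leibniz rule for exp(za) exp(-z²α/2). This exhibits a polynomial in a, so expectations against
it are combinations of moments. -/
lemma herm_eq_sum (p : ℕ) (α a : ℝ) :
    herm p α a = ∑ i ∈ Finset.range (p + 1),
      p.choose i * iteratedDeriv (p - i) (fun z : ℝ => Real.exp (-(z ^ 2 * α / 2))) 0 * a ^ i := by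
  have h : (fun z => Real.exp (z * a - z ^ 2 * α / 2)) =
      fun z => Real.exp (a * z) * Real.exp (-(z ^ 2 * α / 2)) := by
    ext z; rw [← Real.exp_add]; congr 1; ring
  rw [herm, h, iteratedDeriv_fun_mul (by fun_prop) (by fun_prop)]
  refine Finset.sum_congr rfl fun i _ => ?_
  rw [iteratedDeriv_exp_const_mul]
  simp; ring

lemma continuous_herm (p : ℕ) (α : ℝ) : Continuous (herm p α) := by
  have : herm p α = fun a => _ := funext fun a => herm_eq_sum p α a
  rw [this]
  fun_prop

/-- Under the weighted measure Y dP the integral is the moment generating function of b, which is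
analytic in the interior of its domain, here all of ℝ. -/
lemma integral_mul_pow_mul_exp_of_nonneg {Y b : Ω → ℝ} (hY0 : 0 ≤ Y)
    (hYm : AEMeasurable Y P)
    (hY : ∀ w, Integrable (fun ω => Y ω * Real.exp (w * b ω)) P) :
    ContDiff ℝ ⊤ (fun w => ∫ ω, Y ω * Real.exp (w * b ω) ∂P) ∧ ∀ j w,
      Integrable (fun ω => Y ω * (b ω ^ j * Real.exp (w * b ω))) P ∧
      iteratedDeriv j (fun w => ∫ ω, Y ω * Real.exp (w * b ω) ∂P) w =
        ∫ ω, Y ω * (b ω ^ j * Real.exp (w * b ω)) ∂P := by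
  set κ := P.withDensity fun ω => ENNReal.ofReal (Y ω)
  have hI : ∀ g : Ω → ℝ, ∫ ω, g ω ∂κ = ∫ ω, Y ω * g ω ∂P := fun g => by
    rw [integral_withDensity_eq_integral_toReal_smul₀ hYm.ennreal_ofReal (by simp)]
    congr with ω
    rw [ENNReal.toReal_ofReal (hY0 ω), smul_eq_mul]
  have hInt : ∀ g : Ω → ℝ, Integrable g κ ↔ Integrable (fun ω => Y ω * g ω) P := fun g => by
    rw [integrable_withDensity_iff_integrable_smul₀' hYm.ennreal_ofReal (by simp)]
    refine integrable_congr (ae_of_all _ fun ω => ?_)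
    simp only [ENNReal.toReal_ofReal (hY0 ω), smul_eq_mul]
  have hset : integrableExpSet b κ = Set.univ := by
    ext w
    simp only [integrableExpSet, Set.mem_ofPred_eq, Set.mem_univ, iff_true]
    exact (hInt _).2 (hY w)
  have hmem : ∀ w, w ∈ interior (integrableExpSet b κ) := by simp [hset]
  have hG : (fun w => ∫ ω, Y ω * Real.exp (w * b ω) ∂P) = mgf b κ := by
    ext w; rw [mgf, hI]
  refine ⟨?_, fun j w => ⟨?_, ?_⟩⟩
  · rw [hG]
    have := analyticOnNhd_mgf (X := b) (μ := κ)
    rw [hset, interior_univ] at this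
    exact this.contDiff
  · exact (hInt _).1 (integrable_pow_mul_exp_of_mem_interior_integrableExpSet (hmem w) j)
  · rw [hG, iteratedDeriv_mgf (hmem w), hI]

lemma integral_mul_pow_mul_exp {Y b : Ω → ℝ}
    (hY : ∀ w, Integrable (fun ω => Y ω * Real.exp (w * b ω)) P) :
    ContDiff ℝ ⊤ (fun w => ∫ ω, Y ω * Real.exp (w * b ω) ∂P) ∧ ∀ j w,
      Integrable (fun ω => Y ω * (b ω ^ j * Real.exp (w * b ω))) P ∧
      iteratedDeriv j (fun w => ∫ ω, Y ω * Real.exp (w * b ω) ∂P) w =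
        ∫ ω, Y ω * (b ω ^ j * Real.exp (w * b ω)) ∂P := by
  have hYi : Integrable Y P := by simpa using hY 0
  have hmul : ∀ y e : ℝ, 0 < e → max y 0 * e = max (y * e) 0 := fun y e he => by
    rw [max_mul_of_nonneg _ _ he.le, zero_mul]
  have h1 : ∀ w, Integrable (fun ω => max (Y ω) 0 * Real.exp (w * b ω)) P := fun w => by
    simp_rw [fun ω => hmul (Y ω) _ (Real.exp_pos (w * b ω))]
    exact (hY w).pos_part
  have h2 : ∀ w, Integrable (fun ω => max (-Y ω) 0 * Real.exp (w * b ω)) P := fun w => by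
    simp_rw [fun ω => hmul (-Y ω) _ (Real.exp_pos (w * b ω)), neg_mul]
    exact (hY w).neg_part
  obtain ⟨c1, i1⟩ := integral_mul_pow_mul_exp_of_nonneg
    (Y := fun ω => max (Y ω) 0) (fun ω => le_max_right _ _)
    (hYi.pos_part.aestronglyMeasurable.aemeasurable) h1
  obtain ⟨c2, i2⟩ := integral_mul_pow_mul_exp_of_nonneg
    (Y := fun ω => max (-Y ω) 0) (fun ω => le_max_right _ _)
    (hYi.neg_part.aestronglyMeasurable.aemeasurable) h2
  have hsub : ∀ y e : ℝ, y * e = max y 0 * e - max (-y) 0 * e := fun y e => by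
    rw [← sub_mul]; congr 1
    rcases le_total y 0 with h | h <;> simp [h]
  have hG : (fun w => ∫ ω, Y ω * Real.exp (w * b ω) ∂P) = fun w =>
      (∫ ω, max (Y ω) 0 * Real.exp (w * b ω) ∂P) - ∫ ω, max (-Y ω) 0 * Real.exp (w * b ω) ∂P := by
    ext w
    rw [← integral_sub (h1 w) (h2 w)]
    congr with ω
    exact hsub _ _
  refine ⟨?_, fun j w => ⟨?_, ?_⟩⟩
  · rw [hG]; exact c1.sub c2
  · refine ((i1 j w).1.sub (i2 j w).1).congr (ae_of_all _ fun ω => ?_)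
    exact (hsub _ _).symm
  · rw [hG, iteratedDeriv_fun_sub (c1.contDiffAt.of_le le_top) (c2.contDiffAt.of_le le_top),
      (i1 j w).2, (i2 j w).2, ← integral_sub (i1 j w).1 (i2 j w).1]
    congr with ω
    exact (hsub _ _).symm

/-- Exchange of the derivative at 0 in the generating function with the expectation: both sides are
the same Leibniz sum. -/
lemma integral_mul_herm {Y b : Ω → ℝ}
    (hY : ∀ w, Integrable (fun ω => Y ω * Real.exp (w * b ω)) P) (q : ℕ) (β : ℝ) :
    Integrable (fun ω => Y ω * herm q β (b ω)) P ∧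
    ∫ ω, Y ω * herm q β (b ω) ∂P = iteratedDeriv q (fun w =>
      (∫ ω, Y ω * Real.exp (w * b ω) ∂P) * Real.exp (-(w ^ 2 * β / 2))) 0 := by
  obtain ⟨hc, hi⟩ := integral_mul_pow_mul_exp hY
  have e : ∀ ω, Y ω * herm q β (b ω) = ∑ i ∈ Finset.range (q + 1),
      q.choose i * iteratedDeriv (q - i) (fun z : ℝ => Real.exp (-(z ^ 2 * β / 2))) 0 *
        (Y ω * (b ω ^ i * Real.exp (0 * b ω))) := fun ω => by
    rw [herm_eq_sum, Finset.mul_sum]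
    refine Finset.sum_congr rfl fun i _ => ?_
    rw [zero_mul, Real.exp_zero]; ring
  simp_rw [e]
  refine ⟨integrable_finsetSum _ fun i _ => (hi i 0).1.const_mul _, ?_⟩
  rw [integral_finsetSum _ fun i _ => (hi i 0).1.const_mul _,
    iteratedDeriv_fun_mul (hc.contDiffAt.of_le le_top) (by fun_prop)]
  refine Finset.sum_congr rfl fun i _ => ?_
  rw [integral_const_mul, (hi i 0).2]
  ring

/-- A pair of jointly Gaussian centered variables, through its Laplace transform. -/
structure IsGaussianPair (P : Measure Ω) (a b : Ω → ℝ) (α β c : ℝ) : Prop where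
  integrable : ∀ z w : ℝ, Integrable (fun ω => Real.exp (z * a ω) * Real.exp (w * b ω)) P
  integral : ∀ z w : ℝ, ∫ ω, Real.exp (z * a ω) * Real.exp (w * b ω) ∂P =
    Real.exp ((z ^ 2 * α + 2 * z * w * c + w ^ 2 * β) / 2)

/-- The factor exp(-z²α/2) cancels the quadratic term in z of the Laplace transform. What is left is
exp(wcz) times a constant, and its p-th derivative at z = 0 is read off. -/
lemma IsGaussianPair.integral_herm_mul_exp {a b : Ω → ℝ} {α β c : ℝ}
    (h : IsGaussianPair P a b α β c) (p : ℕ) (w : ℝ) :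
    Integrable (fun ω => herm p α (a ω) * Real.exp (w * b ω)) P ∧
    ∫ ω, herm p α (a ω) * Real.exp (w * b ω) ∂P = (w * c) ^ p * Real.exp (w ^ 2 * β / 2) := by
  have hY : ∀ z, Integrable (fun ω => Real.exp (w * b ω) * Real.exp (z * a ω)) P := fun z => by
    simpa [mul_comm] using h.integrable z w
  obtain ⟨h1, h2⟩ := integral_mul_herm hY p α
  simp_rw [mul_comm (herm _ _ _)]
  refine ⟨h1, ?_⟩
  rw [h2]
  have e : (fun z => (∫ ω, Real.exp (w * b ω) * Real.exp (z * a ω) ∂P) *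
      Real.exp (-(z ^ 2 * α / 2))) = fun z => Real.exp ((w * c) * z) * Real.exp (w ^ 2 * β / 2) := by
    ext z
    simp_rw [mul_comm (Real.exp (w * b _))]
    rw [h.integral, ← Real.exp_add, ← Real.exp_add]; congr 1; ring
  rw [e, iteratedDeriv_mul_const_field, iteratedDeriv_exp_const_mul]
  simp

/-- The same cancellation in the second variable leaves w^p c^p, whose p-th derivative at 0 is p!
c^p. -/
lemma IsGaussianPair.integral_herm_mul_herm {a b : Ω → ℝ} {α β c : ℝ}
    (h : IsGaussianPair P a b α β c) (p : ℕ) :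
    Integrable (fun ω => herm p α (a ω) * herm p β (b ω)) P ∧
    ∫ ω, herm p α (a ω) * herm p β (b ω) ∂P = p.factorial * c ^ p := by
  obtain ⟨h1, h2⟩ := integral_mul_herm (fun w => (h.integral_herm_mul_exp p w).1) p β
  refine ⟨h1, ?_⟩
  rw [h2]
  have e : (fun w => (∫ ω, herm p α (a ω) * Real.exp (w * b ω) ∂P) *
      Real.exp (-(w ^ 2 * β / 2))) = fun w => w ^ p * c ^ p := by
    ext w
    rw [(h.integral_herm_mul_exp p w).2, mul_assoc, ← Real.exp_add, mul_pow]; simp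
  rw [e, iteratedDeriv_mul_const_field, iteratedDeriv_fun_pow_zero]
  simp

lemma IsGaussianPair.integral_herm {a b : Ω → ℝ} {α β c : ℝ}
    (h : IsGaussianPair P a b α β c) {p : ℕ} (hp : p ≠ 0) :
    Integrable (fun ω => herm p α (a ω)) P ∧ ∫ ω, herm p α (a ω) ∂P = 0 := by
  have := h.integral_herm_mul_exp p 0
  simpa [hp] using this

end Hermite

/-! ### Polarization of symmetric tensors -/

section SymmetricTensor

/-- Ryser's formula for the permanent. -/
lemma sum_neg_one_pow_mul_prod_sum {p : ℕ} (A : Fin p → Fin p → ℂ) :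
    ∑ S : Finset (Fin p), (-1) ^ (Finset.univ \ S).card * ∏ j, ∑ k ∈ S, A k j =
      ∑ σ : Equiv.Perm (Fin p), ∏ j, A (σ j) j := by
  have h1 : ∀ S : Finset (Fin p), ∏ j, ∑ k ∈ S, A k j =
      ∑ τ : Fin p → Fin p, (if ∀ j, τ j ∈ S then 1 else 0) * ∏ j, A (τ j) j := by
    intro S
    rw [Finset.prod_univ_sum]
    simp_rw [ite_mul, one_mul, zero_mul]
    rw [← Finset.sum_filter]
    congr 1
    ext τ; simp
  simp_rw [h1, Finset.mul_sum]
  rw [Finset.sum_comm]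
  -- Inclusion–exclusion: the signed sum over the S that contain the range of τ is a product over k
  -- of 1 or 1 - 1, and is nonzero only if every k is attained.
  have h2 : ∀ τ : Fin p → Fin p, ∑ S : Finset (Fin p), ((-1 : ℂ)) ^ (Finset.univ \ S).card *
      (if ∀ j, τ j ∈ S then 1 else 0) = if Function.Surjective τ then 1 else 0 := by
    intro τ
    have e := Finset.prod_add (fun _ : Fin p => (1 : ℂ))
      (fun k => if k ∈ Set.range τ then 0 else -1) Finset.univ
    have e2 : ∏ k : Fin p, ((1 : ℂ) + if k ∈ Set.range τ then 0 else -1) =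
        if Function.Surjective τ then 1 else 0 := by
      split_ifs with h
      · exact Finset.prod_eq_one fun k _ => by simp [h k]
      · obtain ⟨k, hk⟩ := not_forall.1 h
        exact Finset.prod_eq_zero (Finset.mem_univ k) (by simp at hk; simp [hk])
    rw [← e2, e, Finset.powerset_univ]
    refine Finset.sum_congr rfl fun S _ => ?_
    rw [Finset.prod_const_one, one_mul]
    split_ifs with h
    · rw [mul_one, ← Finset.prod_const]
      refine Finset.prod_congr rfl fun k hk => ?_
      rw [if_neg]
      rintro ⟨j, rfl⟩
      exact (Finset.mem_sdiff.1 hk).2 (h j)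
    · obtain ⟨j, hj⟩ := not_forall.1 h
      rw [mul_zero]
      symm
      exact Finset.prod_eq_zero (i := τ j) (by simp [hj]) (by simp)
  simp_rw [← mul_assoc, ← Finset.sum_mul, h2, ite_mul, one_mul, zero_mul]
  rw [← Finset.sum_filter]
  symm
  refine Finset.sum_bij (fun σ _ => ⇑σ) (fun σ _ => by simp [σ.surjective])
    (fun σ _ σ' _ h => Equiv.coe_fn_injective h) (fun τ hτ => ?_) (fun _ _ => rfl)
  have hτ' : Function.Surjective τ := by simpa using hτ
  exact ⟨Equiv.ofBijective τ ⟨Finite.injective_iff_surjective.2 hτ', hτ'⟩, Finset.mem_univ _, rfl⟩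

/-- Symmetric tensors are linear combinations of powers of real vectors. -/
lemma exists_eq_sum_pow {p n : ℕ} (g : (Fin p → Fin n) → ℂ)
    (hg : ∀ (σ : Equiv.Perm (Fin p)) I, g (I ∘ σ) = g I) :
    ∃ (ι : Type) (_ : Fintype ι) (c : ι → ℂ) (s : ι → Fin n → ℝ),
      ∀ I, g I = ∑ m, c m * ∏ k, (s m (I k) : ℂ) := by
  -- Ryser's formula for each basis tensor: the vectors are the sums of e_{I k} over k in a subset.
  -- Real vectors are needed, since they are to define real Gaussian variables.
  refine ⟨(Fin p → Fin n) × Finset (Fin p), inferInstance,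
    fun m => (p.factorial : ℂ)⁻¹ * g m.1 * (-1) ^ (Finset.univ \ m.2).card,
    fun m i => ∑ k ∈ m.2, if m.1 k = i then 1 else 0, fun J => ?_⟩
  rw [Fintype.sum_prod_type]
  have h : ∀ I : Fin p → Fin n, ∑ S : Finset (Fin p), ((p.factorial : ℂ)⁻¹ * g I *
      (-1) ^ (Finset.univ \ S).card) * ∏ j, ((∑ k ∈ S, if I k = J j then (1 : ℝ) else 0 : ℝ) : ℂ) =
      ∑ σ : Equiv.Perm (Fin p), (p.factorial : ℂ)⁻¹ * (if I ∘ σ = J then g I else 0) := by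
    intro I
    have := sum_neg_one_pow_mul_prod_sum (fun k j => if I k = J j then (1 : ℂ) else 0)
    simp_rw [mul_assoc, ← Finset.mul_sum]
    simp_rw [Complex.ofReal_sum, apply_ite (Complex.ofReal), Complex.ofReal_one, Complex.ofReal_zero]
    rw [this, Finset.mul_sum]
    congr 1
    refine Finset.sum_congr rfl fun σ _ => ?_
    split_ifs with h
    · rw [Finset.prod_eq_one, mul_one]
      intro j _
      exact if_pos (congrFun h j)
    · obtain ⟨j, hj⟩ := Function.ne_iff.1 h
      rw [Finset.prod_eq_zero (Finset.mem_univ j), mul_zero]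
      exact if_neg hj
  simp_rw [h]
  rw [Finset.sum_comm]
  have h3 : ∀ σ : Equiv.Perm (Fin p), ∑ I : Fin p → Fin n,
      (p.factorial : ℂ)⁻¹ * (if I ∘ σ = J then g I else 0) = (p.factorial : ℂ)⁻¹ * g J := by
    intro σ
    rw [Finset.sum_eq_single (J ∘ ⇑σ.symm)]
    · rw [if_pos (by ext; simp), hg]
    · intro I _ hI
      rw [if_neg, mul_zero]
      rintro rfl
      exact hI (by ext; simp)
    · simp
  simp_rw [h3]
  rw [Finset.sum_const, Finset.card_univ, Fintype.card_perm, Fintype.card_fin, nsmul_eq_mul,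
    ← mul_assoc, mul_inv_cancel₀ (by exact_mod_cast p.factorial_ne_zero), one_mul]

end SymmetricTensor

/-! ### From Hermite forms to one-variable Hermite polynomials -/

section HermiteForm

variable {n : ℕ} {η : Measure (E n)}

lemma gram_comm (i j : Fin n) : gram η i j = gram η j i := by
  simp [gram, mul_comm]

/-- The vector whose scalar product with `x` is `⟨s, x⟩`. -/
def gramVec (η : Measure (E n)) (s : Fin n → ℝ) : E n := WithLp.toLp 2 ((gram η).mulVec s)

lemma contDiff_normSq : ContDiff ℝ ⊤ (normSq η) := by
  unfold normSq; fun_prop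

lemma normSq_add_smul (h : IsUnit (gram η).det) (s : Fin n → ℝ) (x : E n) (z : ℝ) :
    normSq η (x + z • gramVec η s) =
      normSq η x + 2 * z * (∑ i, s i * x i) + z ^ 2 * ∑ i, ∑ j, s i * gram η i j * s j := by
  have hT : (gram η).transpose = gram η := by ext i j; exact gram_comm j i
  have hTi : ((gram η)⁻¹).transpose = (gram η)⁻¹ := by rw [Matrix.transpose_nonsing_inv, hT]
  have hN : ∀ y : E n, normSq η y = dotProduct y.ofLp ((gram η)⁻¹.mulVec y.ofLp) := fun y => by
    simp [normSq, dotProduct, Matrix.mulVec, Finset.mul_sum, mul_assoc]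
  have hS : ∑ i, ∑ j, s i * gram η i j * s j = dotProduct s ((gram η).mulVec s) := by
    simp [dotProduct, Matrix.mulVec, Finset.mul_sum, mul_assoc]
  have hX : ∑ i, s i * x i = dotProduct s x.ofLp := rfl
  rw [hN, hN, hS, hX]
  have e : (x + z • gramVec η s).ofLp = x.ofLp + z • (gram η).mulVec s := rfl
  have e1 : (gram η)⁻¹.mulVec ((gram η).mulVec s) = s := by
    rw [Matrix.mulVec_mulVec, Matrix.nonsing_inv_mul _ h, Matrix.one_mulVec]
  have e2 : dotProduct ((gram η).mulVec s) ((gram η)⁻¹.mulVec x.ofLp) = dotProduct s x.ofLp := by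
    rw [Matrix.dotProduct_mulVec, ← Matrix.mulVec_transpose, hTi, e1]
  rw [e, Matrix.mulVec_add, Matrix.mulVec_smul, e1]
  simp only [add_dotProduct, dotProduct_add, smul_dotProduct, dotProduct_smul, smul_eq_mul, e2]
  rw [dotProduct_comm x.ofLp s, dotProduct_comm ((gram η).mulVec s) s]
  ring

/-- Along the line x + z G s, with G the Gram matrix, the Gaussian is a constant times exp(-za -
z²α/2). This is the generating function of `herm` at -z, and the sign (-1)^p undoes the reflection.
-/
lemma hermiteForm_gramVec (h : IsUnit (gram η).det) (p : ℕ) (s : Fin n → ℝ) (x : E n) :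
    hermiteForm η p x (fun _ => gramVec η s) =
      herm p (∑ i, ∑ j, s i * gram η i j * s j) (∑ i, s i * x i) := by
  set u := gramVec η s
  set α := ∑ i, ∑ j, s i * gram η i j * s j
  set a := ∑ i, s i * x i
  set g : E n → ℝ := fun y => Real.exp (-(normSq η y / 2))
  have hg : ContDiff ℝ ⊤ g := by
    have := contDiff_normSq (η := η)
    fun_prop
  have hl : iteratedFDeriv ℝ p g x (fun _ => u) = iteratedDeriv p (fun z : ℝ => g (x + z • u)) 0 := by
    have h1 := (ContinuousLinearMap.toSpanSingleton ℝ u).iteratedFDeriv_comp_right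
      (f := fun y => g (x + y)) (n := ⊤) (hg.comp (by fun_prop)) 0 (i := p) le_top
    have h2 := congrArg (fun T => T fun _ => (1 : ℝ)) h1
    simp only [iteratedFDeriv_comp_add_left, map_zero, add_zero,
      ContinuousMultilinearMap.compContinuousLinearMap_apply,
      ContinuousLinearMap.toSpanSingleton_apply, one_smul] at h2
    rw [← h2, iteratedDeriv_eq_iteratedFDeriv]
    rfl
  have hgz : (fun z : ℝ => g (x + z • u)) = fun z => Real.exp (-(normSq η x / 2)) *
      (fun z => Real.exp (z * a - z ^ 2 * α / 2)) (-z) := by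
    ext z
    simp only [g, u]
    rw [normSq_add_smul h, ← Real.exp_add]
    congr 1
    ring
  rw [hermiteForm, _root_.smul_apply, hl, hgz, iteratedDeriv_const_mul_field,
    iteratedDeriv_comp_neg p (fun z => Real.exp (z * a - z ^ 2 * α / 2)), neg_zero, smul_eq_mul, smul_eq_mul, herm]
  have e1 : Real.exp (normSq η x / 2) * Real.exp (-(normSq η x / 2)) = 1 := by
    rw [← Real.exp_add]; simp
  have e2 : ((-1 : ℝ)) ^ p * (-1) ^ p = 1 := by rw [← mul_pow]; simp
  linear_combination (iteratedDeriv p (fun z => Real.exp (z * a - z ^ 2 * α / 2)) 0) *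
    ((-1 : ℝ) ^ p * (-1) ^ p * e1 + e2)

lemma coord_hermiteForm_comp_perm (p : ℕ) (x : E n) (σ : Equiv.Perm (Fin p)) (I : Fin p → Fin n) :
    coord (hermiteForm η p x) (I ∘ σ) = coord (hermiteForm η p x) I := by
  have hg : ContDiff ℝ ⊤ (fun y : E n => Real.exp (-(normSq η y / 2))) := by
    have := contDiff_normSq (η := η)
    fun_prop
  unfold coord hermiteForm
  simp only [_root_.smul_apply]
  congr 1
  exact (hg.contDiffAt (x := x)).iteratedFDeriv_comp_perm
    (fun k => EuclideanSpace.single (I k) (1 : ℝ)) σ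

lemma chaosCoeff_comp_perm (f : E n → ℝ) (p : ℕ) (σ : Equiv.Perm (Fin p)) (I : Fin p → Fin n) :
    chaosCoeff η f p (I ∘ σ) = chaosCoeff η f p I := by
  simp [chaosCoeff, coord_hermiteForm_comp_perm]

/-- The pairing of a complex tensor with the Wick powers of `x`. -/
def wickSum (η : Measure (E n)) (p : ℕ) (g : (Fin p → Fin n) → ℂ) (x : E n) : ℂ :=
  ∑ I, ∑ J, g I * (coord (hermiteForm η p x) J : ℂ) * ∏ k, (gram η (I k) (J k) : ℂ)

lemma chaosProj_eq_wickSum (f : E n → ℝ) (p : ℕ) (x : E n) :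
    (chaosProj η f p x : ℂ) =
      (p.factorial : ℂ)⁻¹ * wickSum η p (fun I => (chaosCoeff η f p I : ℂ)) x := by
  simp [chaosProj, wickSum]

/-- Contracting a power of s with the Gram matrices evaluates the Hermite form on the diagonal at
`gramVec η s`, so only one-variable Hermite polynomials remain. -/
lemma wickSum_of_eq_sum_pow (h : IsUnit (gram η).det) (p : ℕ) {ι : Type} [Fintype ι]
    (c : ι → ℂ) (s : ι → Fin n → ℝ) (g : (Fin p → Fin n) → ℂ)
    (hg : ∀ I, g I = ∑ m, c m * ∏ k, (s m (I k) : ℂ)) (x : E n) :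
    wickSum η p g x = ∑ m, c m *
      (herm p (∑ i, ∑ j, s m i * gram η i j * s m j) (∑ i, s m i * x i) : ℂ) := by
  have hv : ∀ m, gramVec η (s m) = ∑ j, (∑ i, gram η i j * s m i) • EuclideanSpace.single j (1 : ℝ) := by
    intro m
    ext j
    simp [gramVec, Matrix.mulVec, dotProduct, gram_comm j, Pi.single_apply]
  have hH : ∀ m, hermiteForm η p x (fun _ => gramVec η (s m)) =
      ∑ J : Fin p → Fin n, (∏ k, ∑ i, gram η i (J k) * s m i) * coord (hermiteForm η p x) J := by
    intro m
    rw [hv m]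
    rw [ContinuousMultilinearMap.map_sum]
    refine Finset.sum_congr rfl fun J _ => ?_
    rw [ContinuousMultilinearMap.map_smul_univ, smul_eq_mul]
    rfl
  simp_rw [← hermiteForm_gramVec h, hH]
  unfold wickSum
  rw [Finset.sum_comm]
  push_cast
  simp_rw [Finset.mul_sum]
  rw [Finset.sum_comm (s := Finset.univ (α := ι))]
  refine Finset.sum_congr rfl fun J _ => ?_
  simp_rw [hg, Finset.sum_mul]
  rw [Finset.sum_comm]
  refine Finset.sum_congr rfl fun m _ => ?_
  rw [Finset.prod_univ_sum, Fintype.piFinset_univ, Finset.sum_mul, Finset.mul_sum]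
  refine Finset.sum_congr rfl fun I _ => ?_
  rw [Finset.prod_mul_distrib]
  ring

end HermiteForm

/-! ### Second moments of the Wick powers of the field -/

section Field

variable {d n : ℕ} {Ω : Type*} [MeasurableSpace Ω] {P : Measure Ω} [IsProbabilityMeasure P]
  {X : E d → Ω → E n}

omit [IsProbabilityMeasure P] in
lemma sum_comm_four {ι κ : Type*} [Fintype ι] [Fintype κ] (F : ι → ι → κ → κ → ℂ) :
    ∑ m, ∑ m', ∑ I, ∑ J, F m m' I J = ∑ I, ∑ J, ∑ m, ∑ m', F m m' I J := by
  simp_rw [fun m => Finset.sum_comm (s := Finset.univ (α := ι)) (t := Finset.univ (α := κ))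
    (f := fun m' I => ∑ J, F m m' I J)]
  rw [Finset.sum_comm]
  refine Finset.sum_congr rfl fun I _ => ?_
  simp_rw [fun m => Finset.sum_comm (s := Finset.univ (α := ι)) (t := Finset.univ (α := κ))
    (f := fun m' J => F m m' I J)]
  rw [Finset.sum_comm]

namespace IsStationaryGaussianField

omit [IsProbabilityMeasure P] in
lemma measurable_apply (hX : IsStationaryGaussianField P X) (v : E d) : Measurable (X v) :=
  hX.measurable.comp measurable_prodMk_left

omit [IsProbabilityMeasure P] in
lemma memLp (hX : IsStationaryGaussianField P X) (v : E d) : MemLp (X v) 2 P := by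
  have h := (hX.gaussian.hasGaussianLaw {v}).map_fun
    (ContinuousLinearMap.proj (R := ℝ) (φ := fun _ : ({v} : Finset (E d)) => E n)
      ⟨v, Finset.mem_singleton_self v⟩)
  exact h.memLp_two

omit [IsProbabilityMeasure P] in
lemma memLp_coord (hX : IsStationaryGaussianField P X) (v : E d) (i : Fin n) :
    MemLp (fun ω => X v ω i) 2 P :=
  (EuclideanSpace.proj (𝕜 := ℝ) i).comp_memLp' (hX.memLp v)

lemma integral_coord (hX : IsStationaryGaussianField P X) (v : E d) (i : Fin n) :
    ∫ ω, X v ω i ∂P = 0 := by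
  have h := (EuclideanSpace.proj (𝕜 := ℝ) i).integral_comp_comm
    ((hX.memLp v).integrable (by norm_num))
  rw [hX.centered v, map_zero] at h
  exact h

omit [IsProbabilityMeasure P] in
-- Stationarity concerns the law of the whole path. It is tested here on the functional that reads
-- the path at u - v and at 0, with a shift by v.
lemma integral_mul (hX : IsStationaryGaussianField P X) (u v : E d) (i j : Fin n) :
    ∫ ω, X u ω i * X v ω j ∂P = covFun P X (u - v) i j := by
  have hm : ∀ h : E d, Measurable fun ω => fun w => X (w + h) ω := fun h =>
    measurable_pi_lambda _ fun w => hX.measurable_apply _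
  have hm0 : Measurable fun ω => fun w => X w ω :=
    measurable_pi_lambda _ fun w => hX.measurable_apply _
  have hF : Measurable fun x : E d → E n => x (u - v) i * x 0 j := by fun_prop
  have h1 : ∫ x, x (u - v) i * x 0 j ∂(P.map fun ω w => X (w + v) ω) =
      ∫ ω, X u ω i * X v ω j ∂P := by
    rw [integral_map (hm v).aemeasurable hF.aestronglyMeasurable]
    simp
  rw [← h1, hX.stationary v, integral_map hm0.aemeasurable hF.aestronglyMeasurable]
  rfl

omit [IsProbabilityMeasure P] in
lemma gram_eq (hX : IsStationaryGaussianField P X) : gram (P.map (X 0)) = covFun P X 0 := by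
  ext i j
  have hF : Measurable fun x : E n => x i * x j := by fun_prop
  simp only [gram, Matrix.of_apply, covFun]
  rw [integral_map (hX.measurable_apply 0).aemeasurable hF.aestronglyMeasurable]

omit [IsProbabilityMeasure P] in
lemma isUnit_det_gram (hX : IsStationaryGaussianField P X) :
    IsUnit (gram (P.map (X 0))).det := by
  rw [hX.gram_eq]
  exact (Matrix.isUnit_iff_isUnit_det _).1 hX.nondegenerate.isUnit

/-- Every linear combination of the two variables is a centered real Gaussian, so its Laplace
transform at 1 is the exponential of half its variance, a quadratic form in (z, w). -/
lemma isGaussianPair (hX : IsStationaryGaussianField P X) (s t : Fin n → ℝ) (u v : E d) :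
    IsGaussianPair P (fun ω => ∑ i, s i * X u ω i) (fun ω => ∑ i, t i * X v ω i)
      (∑ i, ∑ j, s i * gram (P.map (X 0)) i j * s j)
      (∑ i, ∑ j, t i * gram (P.map (X 0)) i j * t j)
      (∑ i, ∑ j, s i * covFun P X (u - v) i j * t j) := by
  classical
  have hlin : ∀ z w : ℝ, HasGaussianLaw (fun ω => z * (∑ i, s i * X u ω i) +
      w * ∑ i, t i * X v ω i) P := by
    intro z w
    let pr : (a : ({u, v} : Finset (E d))) → ((({u, v} : Finset (E d)) → E n) →L[ℝ] E n) := fun a =>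
      ContinuousLinearMap.proj (R := ℝ) (φ := fun _ : ({u, v} : Finset (E d)) => E n) a
    have h := (hX.gaussian.hasGaussianLaw {u, v}).map_fun
      (z • ∑ i, s i • ((EuclideanSpace.proj (𝕜 := ℝ) i).comp (pr ⟨u, by simp⟩)) +
       w • ∑ i, t i • ((EuclideanSpace.proj (𝕜 := ℝ) i).comp (pr ⟨v, by simp⟩)))
    have e : (fun ω => z * (∑ i, s i * X u ω i) + w * ∑ i, t i * X v ω i) = fun ω =>
        (z • ∑ i, s i • ((EuclideanSpace.proj (𝕜 := ℝ) i).comp (pr ⟨u, by simp⟩)) +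
        w • ∑ i, t i • ((EuclideanSpace.proj (𝕜 := ℝ) i).comp (pr ⟨v, by simp⟩)))
        (Finset.restrict {u, v} fun x => X x ω) := by
      ext ω
      simp [pr]
    rw [e]
    exact h
  have hmem : ∀ (s : Fin n → ℝ) u, MemLp (fun ω => ∑ i, s i * X u ω i) 2 P := fun s u =>
    memLp_finsetSum _ fun i _ => (hX.memLp_coord u i).const_mul _
  have hmean : ∀ (s : Fin n → ℝ) u, ∫ ω, ∑ i, s i * X u ω i ∂P = 0 := fun s u => by
    rw [integral_finsetSum _ fun i _ => ((hX.memLp_coord u i).const_mul _).integrable (by norm_num)]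
    simp [integral_const_mul, hX.integral_coord]
  have hcov : ∀ (s t : Fin n → ℝ) u v, ∫ ω, (∑ i, s i * X u ω i) * (∑ i, t i * X v ω i) ∂P =
      ∑ i, ∑ j, s i * covFun P X (u - v) i j * t j := by
    intro s t u v
    have hint : ∀ i j, Integrable (fun ω => s i * X u ω i * (t j * X v ω j)) P := fun i j =>
      ((hX.memLp_coord u i).const_mul _).integrable_mul ((hX.memLp_coord v j).const_mul _)
    simp_rw [Finset.sum_mul_sum]
    rw [integral_finsetSum _ fun i _ => integrable_finsetSum _ fun j _ => hint i j]
    refine Finset.sum_congr rfl fun i _ => ?_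
    rw [integral_finsetSum _ fun j _ => hint i j]
    refine Finset.sum_congr rfl fun j _ => ?_
    rw [← hX.integral_mul, mul_right_comm, ← integral_const_mul]
    congr with ω; ring
  have hexp : ∀ z w : ℝ, Integrable (fun ω => Real.exp (z * (∑ i, s i * X u ω i) +
      w * ∑ i, t i * X v ω i)) P ∧ ∫ ω, Real.exp (z * (∑ i, s i * X u ω i) +
      w * ∑ i, t i * X v ω i) ∂P = Real.exp ((z ^ 2 * (∑ i, ∑ j, s i * covFun P X 0 i j * s j) +
        2 * z * w * (∑ i, ∑ j, s i * covFun P X (u - v) i j * t j) +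
        w ^ 2 * (∑ i, ∑ j, t i * covFun P X 0 i j * t j)) / 2) := by
    intro z w
    have hg := (hlin z w).map_eq_gaussianReal
    have hA := hmem s u
    have hB := hmem t v
    have hm : ∫ ω, (z * (∑ i, s i * X u ω i) + w * ∑ i, t i * X v ω i) ∂P = 0 := by
      rw [integral_add ((hA.integrable (by norm_num)).const_mul _)
        ((hB.integrable (by norm_num)).const_mul _), integral_const_mul, integral_const_mul,
        hmean, hmean]
      simp
    have hvar : Var[fun ω => z * (∑ i, s i * X u ω i) + w * ∑ i, t i * X v ω i; P] =
        z ^ 2 * (∑ i, ∑ j, s i * covFun P X 0 i j * s j) +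
        2 * z * w * (∑ i, ∑ j, s i * covFun P X (u - v) i j * t j) +
        w ^ 2 * (∑ i, ∑ j, t i * covFun P X 0 i j * t j) := by
      rw [variance_of_integral_eq_zero (hlin z w).aemeasurable hm]
      have e : ∀ ω, (z * (∑ i, s i * X u ω i) + w * ∑ i, t i * X v ω i) ^ 2 =
          z ^ 2 * ((∑ i, s i * X u ω i) * (∑ i, s i * X u ω i)) +
          2 * z * w * ((∑ i, s i * X u ω i) * (∑ i, t i * X v ω i)) +
          w ^ 2 * ((∑ i, t i * X v ω i) * (∑ i, t i * X v ω i)) := fun ω => by ring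
      simp_rw [e]
      have i1 : Integrable (fun ω => z ^ 2 * ((∑ i, s i * X u ω i) * (∑ i, s i * X u ω i))) P :=
        (hA.integrable_mul hA).const_mul _
      have i2 : Integrable (fun ω => 2 * z * w *
          ((∑ i, s i * X u ω i) * (∑ i, t i * X v ω i))) P := (hA.integrable_mul hB).const_mul _
      have i3 : Integrable (fun ω => w ^ 2 * ((∑ i, t i * X v ω i) * (∑ i, t i * X v ω i))) P :=
        (hB.integrable_mul hB).const_mul _
      have i12 : Integrable (fun ω => z ^ 2 * ((∑ i, s i * X u ω i) * (∑ i, s i * X u ω i)) +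
          2 * z * w * ((∑ i, s i * X u ω i) * (∑ i, t i * X v ω i))) P := i1.add i2
      rw [integral_add i12 i3, integral_add i1 i2,
        integral_const_mul, integral_const_mul, integral_const_mul, hcov, hcov, hcov]
      simp
    rw [← hvar]
    have h1 := mgf_gaussianReal hg 1
    have hv0 := variance_nonneg (fun ω => z * (∑ i, s i * X u ω i) + w * ∑ i, t i * X v ω i) P
    constructor
    · have := (integrable_map_measure (by fun_prop) (hlin z w).aemeasurable).1
        (hg ▸ integrable_exp_mul_gaussianReal (μ := P[fun ω => z * (∑ i, s i * X u ω i) + w * ∑ i, t i * X v ω i]) (v := Var[fun ω => z * (∑ i, s i * X u ω i) + w * ∑ i, t i * X v ω i; P].toNNReal) 1)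
      simpa [Function.comp_def] using this
    · simp only [mgf, one_mul] at h1
      rw [h1, hm, Real.coe_toNNReal _ hv0]
      simp
  rw [hX.gram_eq]
  refine ⟨fun z w => ?_, fun z w => ?_⟩
  · simpa [Real.exp_add] using (hexp z w).1
  · simpa [Real.exp_add] using (hexp z w).2

/-- The covariance of two tensors of Wick powers of the field. -/
def _root_.GaussianChaos.tensorCov {p : ℕ} (K : E d → Matrix (Fin n) (Fin n) ℝ)
    (g : (Fin p → Fin n) → ℂ) (v : E d) : ℂ :=
  ∑ I, ∑ J, g I * star (g J) * ∏ k, (K v (I k) (J k) : ℂ)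

/-- A tensor version of E[H_p(a) H_p(b)] = p! c^p: decompose g into powers of real vectors, apply
the one-variable formula to each pair, and reassemble by bilinearity. -/
lemma wickSum_spec (hX : IsStationaryGaussianField P X) {p : ℕ} (g : (Fin p → Fin n) → ℂ)
    (hg : ∀ (σ : Equiv.Perm (Fin p)) I, g (I ∘ σ) = g I) :
    Continuous (wickSum (P.map (X 0)) p g) ∧
    (∀ v, MemLp (fun ω => wickSum (P.map (X 0)) p g (X v ω)) 2 P) ∧
    (∀ u v, ∫ ω, wickSum (P.map (X 0)) p g (X u ω) *
      star (wickSum (P.map (X 0)) p g (X v ω)) ∂P =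
        p.factorial * tensorCov (covFun P X) g (u - v)) ∧
    (p ≠ 0 → ∀ v, ∫ ω, wickSum (P.map (X 0)) p g (X v ω) ∂P = 0) := by
  obtain ⟨ι, _, c, s, hcs⟩ := exists_eq_sum_pow g hg
  have hw := wickSum_of_eq_sum_pow hX.isUnit_det_gram p c s g hcs
  set η := P.map (X 0)
  set α : ι → ℝ := fun m => ∑ i, ∑ j, s m i * gram η i j * s m j
  have hpair : ∀ m m' u v, _ := fun m m' u v =>
    (hX.isGaussianPair (s m) (s m') u v).integral_herm_mul_herm p
  have hmeas : ∀ m v, Measurable fun ω => herm p (α m) (∑ i, s m i * X v ω i) := fun m v =>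
    (continuous_herm p (α m)).measurable.comp
      (by have := hX.measurable_apply v; fun_prop)
  have hmem : ∀ m v, MemLp (fun ω => (herm p (α m) (∑ i, s m i * X v ω i) : ℂ)) 2 P := by
    intro m v
    refine MemLp.ofReal ((memLp_two_iff_integrable_sq (hmeas m v).aestronglyMeasurable).2 ?_)
    simpa [sq] using (hpair m m v v).1
  have hcont : Continuous (wickSum η p g) := by
    have : wickSum η p g = fun x => _ := funext hw
    rw [this]
    refine continuous_finsetSum _ fun m _ => continuous_const.mul
      (Complex.continuous_ofReal.comp ((continuous_herm p _).comp (by fun_prop)))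
  refine ⟨hcont, fun v => ?_, fun u v => ?_, fun hp v => ?_⟩
  · simp_rw [hw]
    exact memLp_finsetSum _ fun m _ => (hmem m v).const_mul _
  · have e : ∀ ω, wickSum η p g (X u ω) * star (wickSum η p g (X v ω)) =
        ∑ m, ∑ m', c m * star (c m') * ((herm p (α m) (∑ i, s m i * X u ω i) *
          herm p (α m') (∑ i, s m' i * X v ω i) : ℝ) : ℂ) := fun ω => by
      rw [hw, hw, star_sum, Finset.sum_mul_sum]
      refine Finset.sum_congr rfl fun m _ => Finset.sum_congr rfl fun m' _ => ?_
      simp only [star_mul', Complex.star_def, Complex.conj_ofReal, Complex.ofReal_mul]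
      ring
    simp_rw [e]
    have hi : ∀ m m', Integrable (fun ω => c m * star (c m') *
        ((herm p (α m) (∑ i, s m i * X u ω i) * herm p (α m') (∑ i, s m' i * X v ω i) : ℝ) : ℂ)) P :=
      fun m m' => ((hpair m m' u v).1.ofReal).const_mul _
    rw [integral_finsetSum _ fun m _ => integrable_finsetSum _ fun m' _ => hi m m']
    simp_rw [fun m => integral_finsetSum Finset.univ fun m' _ => hi m m', integral_const_mul,
      integral_complex_ofReal]
    have h2 : ∀ m m', ∫ ω, herm p (α m) (∑ i, s m i * X u ω i) *
        herm p (α m') (∑ i, s m' i * X v ω i) ∂P =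
        p.factorial * (∑ i, ∑ j, s m i * covFun P X (u - v) i j * s m' j) ^ p :=
      fun m m' => (hpair m m' u v).2
    simp_rw [h2]
    -- The p-th power of the bilinear covariance expands over pairs of multi-indices, which recovers
    -- the tensor coordinates.
    have h3 : ∀ m m', (((∑ i, ∑ j, s m i * covFun P X (u - v) i j * s m' j) ^ p : ℝ) : ℂ) =
        ∑ I : Fin p → Fin n, ∑ J : Fin p → Fin n, (∏ k, (s m (I k) : ℂ)) *
          (∏ k, (s m' (J k) : ℂ)) * ∏ k, (covFun P X (u - v) (I k) (J k) : ℂ) := by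
      intro m m'
      have : (∑ i, ∑ j, s m i * covFun P X (u - v) i j * s m' j) ^ p =
        ∏ _k : Fin p, (∑ i, ∑ j, s m i * covFun P X (u - v) i j * s m' j) := by simp
      rw [this, Finset.prod_univ_sum, Fintype.piFinset_univ]
      push_cast
      refine Finset.sum_congr rfl fun I _ => ?_
      rw [Finset.prod_univ_sum, Fintype.piFinset_univ]
      refine Finset.sum_congr rfl fun J _ => ?_
      rw [Finset.prod_mul_distrib, Finset.prod_mul_distrib]
      ring
    unfold tensorCov
    simp_rw [Complex.ofReal_mul, h3, Complex.ofReal_natCast, Finset.mul_sum]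
    rw [sum_comm_four]
    refine Finset.sum_congr rfl fun I _ => Finset.sum_congr rfl fun J _ => ?_
    rw [hcs, hcs, star_sum, Finset.sum_mul_sum, Finset.sum_mul, Finset.mul_sum]
    refine Finset.sum_congr rfl fun m _ => ?_
    rw [Finset.sum_mul, Finset.mul_sum]
    refine Finset.sum_congr rfl fun m' _ => ?_
    simp only [star_mul', star_prod, Complex.star_def, Complex.conj_ofReal]
    ring
  · simp_rw [hw]
    have hi := fun m => (hX.isGaussianPair (s m) (s m) v v).integral_herm hp
    rw [integral_finsetSum _ fun m _ => ((hi m).1.ofReal).const_mul _]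
    simp_rw [integral_const_mul]
    refine Finset.sum_eq_zero fun m _ => ?_
    rw [integral_complex_ofReal, (hi m).2]
    simp

end IsStationaryGaussianField

end Field

/-! ### Integrals of stationary second-order processes -/

section SecondOrder

variable {d : ℕ} {Ω : Type*} [MeasurableSpace Ω] {P : Measure Ω} [IsProbabilityMeasure P]

/-- A jointly measurable complex-valued process on `ℝ^d` with `𝔼[Y(u) conj Y(v)] = r(u - v)`. -/
structure IsSecondOrder (P : Measure Ω) (Y : E d → Ω → ℂ) (r : E d → ℂ) : Prop where
  measurable : Measurable (Function.uncurry Y)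
  memLp : ∀ v, MemLp (Y v) 2 P
  cov : ∀ u v, ∫ ω, Y u ω * star (Y v ω) ∂P = r (u - v)

namespace IsSecondOrder

variable {Y : E d → Ω → ℂ} {r : E d → ℂ}

omit [IsProbabilityMeasure P] in
lemma integral_norm_sq (hY : IsSecondOrder P Y r) (v : E d) :
    ∫ ω, ‖Y v ω‖ ^ 2 ∂P = (r 0).re := by
  have h := hY.cov v v
  have e : ∀ ω, Y v ω * star (Y v ω) = ((‖Y v ω‖ ^ 2 : ℝ) : ℂ) := fun ω => by
    rw [Complex.star_def, Complex.mul_conj, Complex.normSq_eq_norm_sq]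
  simp_rw [e] at h
  rw [integral_complex_ofReal, sub_self] at h
  rw [← h, Complex.ofReal_re]

omit [IsProbabilityMeasure P] in
lemma lintegral_enorm_sq (hY : IsSecondOrder P Y r) (v : E d) :
    ∫⁻ ω, ‖Y v ω‖ₑ ^ 2 ∂P = ENNReal.ofReal (r 0).re := by
  have hi : Integrable (fun ω => ‖Y v ω‖ ^ 2) P := (hY.memLp v).integrable_norm_pow (by norm_num)
  rw [← hY.integral_norm_sq v, ofReal_integral_eq_lintegral_ofReal hi
    (ae_of_all _ fun ω => by positivity)]
  congr with ω
  rw [ENNReal.ofReal_pow (norm_nonneg _), ofReal_norm]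

lemma lintegral_enorm_le (hY : IsSecondOrder P Y r) (v : E d) :
    ∫⁻ ω, ‖Y v ω‖ₑ ∂P ≤ 1 + ENNReal.ofReal (r 0).re := by
  calc ∫⁻ ω, ‖Y v ω‖ₑ ∂P ≤ ∫⁻ ω, (1 + ‖Y v ω‖ₑ ^ 2) ∂P := by
        refine lintegral_mono fun ω => ?_
        rcases le_total ‖Y v ω‖ₑ 1 with h | h
        · exact h.trans le_self_add
        · exact (le_self_pow₀ h two_ne_zero).trans le_add_self
    _ = 1 + ENNReal.ofReal (r 0).re := by
        rw [lintegral_add_left measurable_const, hY.lintegral_enorm_sq]; simp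

lemma integrable_mul (hY : IsSecondOrder P Y r) {ψ : E d → ℂ} (hψ : Integrable ψ) :
    Integrable (fun z : E d × Ω => ψ z.1 * Y z.1 z.2) (volume.prod P) := by
  refine ⟨hψ.aestronglyMeasurable.comp_fst.mul hY.measurable.aestronglyMeasurable, ?_⟩
  rw [HasFiniteIntegral, lintegral_prod _ (by
    exact (hψ.aestronglyMeasurable.comp_fst.mul hY.measurable.aestronglyMeasurable).enorm)]
  simp_rw [enorm_mul]
  calc ∫⁻ v, ∫⁻ ω, ‖ψ v‖ₑ * ‖Y v ω‖ₑ ∂P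
      ≤ ∫⁻ v, ‖ψ v‖ₑ * (1 + ENNReal.ofReal (r 0).re) := by
        refine lintegral_mono fun v => ?_
        rw [lintegral_const_mul' _ _ enorm_ne_top]
        gcongr
        exact hY.lintegral_enorm_le v
    _ = (∫⁻ v, ‖ψ v‖ₑ) * (1 + ENNReal.ofReal (r 0).re) :=
        lintegral_mul_const' _ _ (by simp)
    _ < ∞ := ENNReal.mul_lt_top hψ.2 (by simp)

lemma integrable_mul_mul (hY : IsSecondOrder P Y r) {ψ : E d → ℂ} (hψ : Integrable ψ) :
    Integrable (fun z : (E d × E d) × Ω => (ψ z.1.1 * Y z.1.1 z.2) *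
      star (ψ z.1.2 * Y z.1.2 z.2)) ((volume.prod volume).prod P) := by
  have hm1 : Measurable fun z : (E d × E d) × Ω => Y z.1.1 z.2 :=
    hY.measurable.comp (measurable_fst.fst.prodMk measurable_snd)
  have hm2 : Measurable fun z : (E d × E d) × Ω => Y z.1.2 z.2 :=
    hY.measurable.comp (measurable_fst.snd.prodMk measurable_snd)
  have hmeas : AEStronglyMeasurable (fun z : (E d × E d) × Ω => (ψ z.1.1 * Y z.1.1 z.2) *
      star (ψ z.1.2 * Y z.1.2 z.2)) ((volume.prod volume).prod P) :=
    ((hψ.aestronglyMeasurable.comp_fst (ν := (volume : Measure (E d)))).comp_fst.mul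
      hm1.aestronglyMeasurable).mul (continuous_star.comp_aestronglyMeasurable
      ((hψ.aestronglyMeasurable.comp_snd (μ := (volume : Measure (E d)))).comp_fst.mul
      hm2.aestronglyMeasurable))
  refine ⟨hmeas, ?_⟩
  rw [HasFiniteIntegral, lintegral_prod _ hmeas.enorm]
  have hb : ∀ z : E d × E d, ∫⁻ ω, ‖(ψ z.1 * Y z.1 ω) * star (ψ z.2 * Y z.2 ω)‖ₑ ∂P ≤
      ‖ψ z.1 * ψ z.2‖ₑ * (ENNReal.ofReal (r 0).re + ENNReal.ofReal (r 0).re) := by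
    intro z
    have hr : ∀ w : ℂ, ‖star w‖ₑ = ‖w‖ₑ := fun w => by
      rw [← ofReal_norm, ← ofReal_norm, norm_star]
    have e : ∀ ω, ‖(ψ z.1 * Y z.1 ω) * star (ψ z.2 * Y z.2 ω)‖ₑ ≤
        ‖ψ z.1 * ψ z.2‖ₑ * (‖Y z.1 ω‖ₑ ^ 2 + ‖Y z.2 ω‖ₑ ^ 2) := fun ω => by
      rw [enorm_mul, hr, enorm_mul, enorm_mul, enorm_mul, mul_mul_mul_comm]
      gcongr
      rcases le_total ‖Y z.1 ω‖ₑ ‖Y z.2 ω‖ₑ with h | h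
      · calc ‖Y z.1 ω‖ₑ * ‖Y z.2 ω‖ₑ ≤ ‖Y z.2 ω‖ₑ ^ 2 := by rw [sq]; gcongr
          _ ≤ _ := le_add_self
      · calc ‖Y z.1 ω‖ₑ * ‖Y z.2 ω‖ₑ ≤ ‖Y z.1 ω‖ₑ ^ 2 := by rw [sq]; gcongr
          _ ≤ _ := le_self_add
    refine (lintegral_mono e).trans ?_
    rw [lintegral_const_mul' _ _ enorm_ne_top, lintegral_add_left' (by
      exact (hY.memLp _).1.enorm.pow_const 2), hY.lintegral_enorm_sq, hY.lintegral_enorm_sq]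
  refine (lintegral_mono hb).trans_lt ?_
  rw [lintegral_mul_const' _ _ (by simp)]
  exact ENNReal.mul_lt_top (hψ.mul_prod hψ).2 (by simp)

/-- The squared modulus of the integral is a double integral over pairs of points. Fubini is
licensed by the constant second moment r(0) and the integrability of ψ. -/
lemma integral_spec (hY : IsSecondOrder P Y r) {ψ : E d → ℂ} (hψ : Integrable ψ) :
    (∀ᵐ ω ∂P, Integrable fun v => ψ v * Y v ω) ∧ MemLp (fun ω => ∫ v, ψ v * Y v ω) 2 P ∧
    ∫ ω, (∫ v, ψ v * Y v ω) * star (∫ v, ψ v * Y v ω) ∂P =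
      ∫ z : E d × E d, ψ z.1 * star (ψ z.2) * r (z.1 - z.2) := by
  have h1 := hY.integrable_mul hψ
  have h2 := hY.integrable_mul_mul hψ
  have e : ∀ ω, (∫ v, ψ v * Y v ω) * star (∫ v, ψ v * Y v ω) =
      ∫ z : E d × E d, (ψ z.1 * Y z.1 ω) * star (ψ z.2 * Y z.2 ω) := fun ω => by
    have := integral_prod_mul (μ := (volume : Measure (E d))) (ν := (volume : Measure (E d)))
      (fun v => ψ v * Y v ω) (fun v => star (ψ v * Y v ω))
    rw [Measure.volume_eq_prod, this]
    congr 1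
    exact integral_conj.symm
  have hmeas : AEStronglyMeasurable (fun ω => ∫ v, ψ v * Y v ω) P :=
    h1.integral_prod_right.aestronglyMeasurable
  refine ⟨h1.prod_left_ae, ?_, ?_⟩
  · rw [memLp_two_iff_integrable_sq_norm hmeas]
    have h3 := h2.integral_prod_right
    refine h3.norm.congr (ae_of_all _ fun ω => ?_)
    simp only
    rw [← Measure.volume_eq_prod, ← e ω, norm_mul, norm_star, sq]
  · simp_rw [e]
    rw [← Measure.volume_eq_prod] at h2
    rw [integral_integral_swap (f := fun (ω : Ω) (z : E d × E d) =>
      (ψ z.1 * Y z.1 ω) * star (ψ z.2 * Y z.2 ω)) h2.swap]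
    congr with z
    rw [← hY.cov, ← integral_const_mul]
    congr with ω
    simp only [star_mul']
    ring

/-- Integrated positive definiteness of the covariance, in the form that Bochner's theorem uses. -/
lemma zero_le_integral (hY : IsSecondOrder P Y r) {ψ : E d → ℂ} (hψ : Integrable ψ) :
    0 ≤ ∫ z : E d × E d, ψ z.1 * star (ψ z.2) * r (z.1 - z.2) := by
  rw [← (hY.integral_spec hψ).2.2]
  refine integral_nonneg fun ω => ?_
  exact mul_star_self_nonneg _

lemma integral_integral_eq_zero (hY : IsSecondOrder P Y r) (h0 : ∀ v, ∫ ω, Y v ω ∂P = 0)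
    {ψ : E d → ℂ} (hψ : Integrable ψ) : ∫ ω, (∫ v, ψ v * Y v ω) ∂P = 0 := by
  rw [integral_integral_swap (f := fun (ω : Ω) v => ψ v * Y v ω) (hY.integrable_mul hψ).swap]
  simp [integral_const_mul, h0]

end IsSecondOrder

end SecondOrder

/-! ### Bochner's theorem by Gaussian regularization -/

section Bochner

variable {d : ℕ}

lemma integrable_exp_neg_mul_sq_norm {b : ℝ} (hb : 0 < b) :
    Integrable fun y : E d => Real.exp (-b * ‖y‖ ^ 2) := by
  have h := (GaussianFourier.integrable_cexp_neg_mul_sq_norm_add (V := E d) (b := b) (by simpa) 0 0).norm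
  refine h.congr (ae_of_all _ fun y => ?_)
  simp only [zero_mul, add_zero, Complex.norm_exp]
  congr 1
  rw [← Complex.ofReal_neg, ← Complex.ofReal_pow, ← Complex.ofReal_mul, Complex.ofReal_re]

/-- The function `exp(-π‖y‖²)`. -/
def gauss (y : E d) : ℝ := Real.exp (-Real.pi * ‖y‖ ^ 2)

lemma integrable_gauss : Integrable (gauss : E d → ℝ) :=
  integrable_exp_neg_mul_sq_norm Real.pi_pos

lemma continuous_gauss : Continuous (gauss : E d → ℝ) := by unfold gauss; fun_prop

lemma integral_gauss_mul_expo (y : E d) : ∫ ξ, (gauss ξ : ℂ) * expo ξ y = gauss y := by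
  have h := GaussianFourier.integral_cexp_neg_mul_sq_norm_add (V := E d) (b := Real.pi)
    (by simpa using Real.pi_pos) (2 * Real.pi * Complex.I) y
  rw [div_self (by exact_mod_cast Real.pi_ne_zero), Complex.one_cpow, one_mul] at h
  unfold gauss expo
  push_cast
  simp_rw [← Complex.exp_add]
  convert h using 2
  · ext ξ; rw [real_inner_comm]
  · have : (Real.pi : ℂ) ≠ 0 := by exact_mod_cast Real.pi_ne_zero
    field_simp
    ring_nf
    simp

lemma integral_gauss_pos : 0 < ∫ y : E d, gauss y := by
  have := GaussianFourier.integral_rexp_neg_mul_sq_norm (V := E d) Real.pi_pos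
  unfold gauss
  rw [this]
  exact Real.rpow_pos_of_pos (div_pos Real.pi_pos Real.pi_pos) _

variable {r : E d → ℂ}

/-- The Fourier transform of `r(w) exp(-ε‖w‖²)`. -/
def smoothFourier (r : E d → ℂ) (ε : ℝ) (ξ : E d) : ℂ :=
  ∫ w, r w * Real.exp (-ε * ‖w‖ ^ 2) * star (expo ξ w)

lemma integrable_mul_exp {C : ℝ} (hc : Continuous r) (hb : ∀ v, ‖r v‖ ≤ C) {ε : ℝ} (hε : 0 < ε) :
    Integrable fun w => r w * (Real.exp (-ε * ‖w‖ ^ 2) : ℂ) :=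
  ((integrable_exp_neg_mul_sq_norm hε).ofReal (𝕜 := ℂ)).bdd_mul (c := C) hc.aestronglyMeasurable
    (ae_of_all _ hb)

lemma nonneg_of_mul_ofReal_nonneg {a : ℂ} {K : ℝ} (hK : 0 < K) (h : 0 ≤ a * K) : 0 ≤ a := by
  have hK' : (0 : ℂ) ≤ ((K⁻¹ : ℝ) : ℂ) := by exact_mod_cast (inv_pos.2 hK).le
  have h1 := mul_nonneg h hK'
  rwa [mul_assoc, ← Complex.ofReal_mul, mul_inv_cancel₀ hK.ne', Complex.ofReal_one, mul_one] at h1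

lemma norm_mul_star_expo (a : ℂ) (ξ w : E d) : ‖a * star (expo ξ w)‖ = ‖a‖ := by
  rw [norm_mul, norm_star, norm_expo, mul_one]

/-- Test positivity on a modulated Gaussian. After u = v + w, the identity 2ε(‖v+w‖² + ‖v‖²) = ε‖w‖²
+ 4ε‖v + w/2‖² makes the v-integral a positive constant K, and the w-integral is `smoothFourier`. -/
lemma zero_le_smoothFourier {C : ℝ} (hc : Continuous r) (hb : ∀ v, ‖r v‖ ≤ C)
    (hpos : ∀ ψ : E d → ℂ, Integrable ψ →
      0 ≤ ∫ z : E d × E d, ψ z.1 * star (ψ z.2) * r (z.1 - z.2))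
    {ε : ℝ} (hε : 0 < ε) (ξ : E d) : 0 ≤ smoothFourier r ε ξ := by
  set ψ : E d → ℂ := fun u => (Real.exp (-(2 * ε) * ‖u‖ ^ 2) : ℂ) * star (expo ξ u) with hψdef
  have hψ : Integrable ψ := by
    refine ((integrable_exp_neg_mul_sq_norm (d := d) (b := 2 * ε) (by positivity)).ofReal
      (𝕜 := ℂ)).mul_bdd (c := 1) (Continuous.aestronglyMeasurable (by fun_prop)) (ae_of_all _ fun u => ?_)
    rw [norm_star, norm_expo]
  set K : ℝ := ∫ v : E d, Real.exp (-(4 * ε) * ‖v‖ ^ 2) with hK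
  have hKpos : 0 < K := by
    rw [hK, GaussianFourier.integral_rexp_neg_mul_sq_norm (by positivity)]
    exact Real.rpow_pos_of_pos (div_pos Real.pi_pos (by positivity)) _
  have hF : Integrable (fun z : E d × E d => ψ z.2 * star (ψ z.1) * r (z.2 - z.1)) := by
    have h1 : Integrable (fun z : E d × E d => star (ψ z.1) * ψ z.2) :=
      (Integrable.mul_prod (f := fun x => star (ψ x)) ((LinearIsometryEquiv.integrable_comp_iff Complex.conjLIE).2 hψ) hψ)
    have h2 : Integrable (fun z : E d × E d => star (ψ z.1) * ψ z.2 * r (z.2 - z.1)) :=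
      h1.mul_bdd (c := C) (Continuous.aestronglyMeasurable (by fun_prop)) (ae_of_all _ fun z => hb _)
    refine h2.congr (ae_of_all _ fun z => ?_)
    simp only; ring
  have hmp := measurePreserving_prod_add (volume : Measure (E d)) (volume : Measure (E d))
  have hemb : MeasurableEmbedding (fun z : E d × E d => (z.1, z.1 + z.2)) :=
    (MeasurableEquiv.shearAddRight (E d)).measurableEmbedding
  have e1 : ∫ z : E d × E d, ψ z.1 * star (ψ z.2) * r (z.1 - z.2) =
      ∫ z : E d × E d, ψ (z.1 + z.2) * star (ψ z.1) * r (z.1 + z.2 - z.1) := by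
    rw [Measure.volume_eq_prod, ← integral_prod_swap]
    exact (hmp.integral_comp hemb (fun z : E d × E d => ψ z.2 * star (ψ z.1) * r (z.2 - z.1))).symm
  have hF' : Integrable (fun z : E d × E d => ψ (z.1 + z.2) * star (ψ z.1) * r (z.1 + z.2 - z.1)) :=
    (hmp.integrable_comp_emb hemb).2 hF
  have e2 : ∀ v w : E d, ψ (v + w) * star (ψ v) * r (v + w - v) =
      (r w * Real.exp (-ε * ‖w‖ ^ 2) * star (expo ξ w)) *
        (Real.exp (-(4 * ε) * ‖v - (-(1 / 2 : ℝ) • w)‖ ^ 2) : ℂ) := by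
    intro v w
    have h1 : Real.exp (-(2 * ε) * ‖v + w‖ ^ 2) * Real.exp (-(2 * ε) * ‖v‖ ^ 2) =
        Real.exp (-ε * ‖w‖ ^ 2) * Real.exp (-(4 * ε) * ‖v - (-(1 / 2 : ℝ) • w)‖ ^ 2) := by
      rw [← Real.exp_add, ← Real.exp_add]
      congr 1
      rw [norm_add_sq_real, norm_sub_sq_real, inner_smul_right, norm_smul, mul_pow]
      norm_num
      ring
    have h1' : (Real.exp (-(2 * ε) * ‖v + w‖ ^ 2) : ℂ) * Real.exp (-(2 * ε) * ‖v‖ ^ 2) =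
        Real.exp (-ε * ‖w‖ ^ 2) * Real.exp (-(4 * ε) * ‖v - (-(1 / 2 : ℝ) • w)‖ ^ 2) := by
      exact_mod_cast h1
    have h3 : star (expo ξ v) * expo ξ v = 1 := by
      rw [Complex.star_def, mul_comm, Complex.mul_conj, Complex.normSq_eq_norm_sq, norm_expo]; simp
    simp only [hψdef, add_sub_cancel_left, expo_add_right, star_mul', star_star]
    rw [Complex.star_def, Complex.conj_ofReal, ← Complex.star_def]
    linear_combination (star (expo ξ w) * r w) * h1' + (Real.exp (-(2 * ε) * ‖v + w‖ ^ 2) : ℂ) *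
      Real.exp (-(2 * ε) * ‖v‖ ^ 2) * (star (expo ξ w) * r w) * h3
  have e3 : ∫ z : E d × E d, ψ z.1 * star (ψ z.2) * r (z.1 - z.2) =
      smoothFourier r ε ξ * K := by
    rw [e1, Measure.volume_eq_prod, integral_prod_symm _ hF']
    simp_rw [e2, integral_const_mul]
    have : ∀ w : E d, ∫ v : E d, (Real.exp (-(4 * ε) * ‖v - (-(1 / 2 : ℝ) • w)‖ ^ 2) : ℂ) = K := by
      intro w
      rw [integral_sub_right_eq_self (fun v : E d => (Real.exp (-(4 * ε) * ‖v‖ ^ 2) : ℂ)),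
        integral_complex_ofReal]
    simp_rw [this, integral_mul_const]
    rfl
  have h := hpos ψ hψ
  rw [e3] at h
  exact nonneg_of_mul_ofReal_nonneg hKpos h

/-- The Gaussian is its own Fourier transform, so mollifying r exp(-ε‖·‖²) at scale δ multiplies its
Fourier transform by a Gaussian. The resulting density is integrable even though `smoothFourier` is
only known to be bounded, so Fourier inversion is avoided. -/
lemma integral_mul_gauss_eq {C : ℝ} (hc : Continuous r) (hb : ∀ v, ‖r v‖ ≤ C)
    {ε δ : ℝ} (hε : 0 < ε) (hδ : 0 < δ) (v : E d) :
    ∫ y, r (v - δ • y) * Real.exp (-ε * ‖v - δ • y‖ ^ 2) * gauss y =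
      ∫ ξ, expo (δ⁻¹ • ξ) v * ((δ ^ d)⁻¹ * gauss ξ * smoothFourier r ε (δ⁻¹ • ξ)) := by
  set rε : E d → ℂ := fun w => r w * Real.exp (-ε * ‖w‖ ^ 2) with hrε
  have hri : Integrable rε := integrable_mul_exp hc hb hε
  have hri' : Integrable fun y => rε (v - δ • y) :=
    (hri.comp_sub_left v).comp_smul hδ.ne'
  have hint : Integrable (fun z : E d × E d => rε (v - δ • z.1) * (gauss z.2 * expo z.2 z.1)) := by
    have h1 : Integrable (fun z : E d × E d => rε (v - δ • z.1) * ((gauss z.2 : ℝ) : ℂ)) :=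
      hri'.mul_prod ((integrable_gauss (d := d)).ofReal (𝕜 := ℂ))
    have h2 : Integrable (fun z : E d × E d =>
        rε (v - δ • z.1) * ((gauss z.2 : ℝ) : ℂ) * expo z.2 z.1) := h1.mul_bdd (c := 1)
      (Continuous.aestronglyMeasurable (by fun_prop)) (ae_of_all _ fun z => (norm_expo _ _).le)
    exact h2.congr (ae_of_all _ fun z => by simp only; ring)
  calc ∫ y, rε (v - δ • y) * gauss y
      = ∫ y, ∫ ξ, rε (v - δ • y) * (gauss ξ * expo ξ y) := by
        congr with y
        rw [integral_const_mul, integral_gauss_mul_expo]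
    _ = ∫ ξ, ∫ y, rε (v - δ • y) * (gauss ξ * expo ξ y) := integral_integral_swap hint
    _ = _ := by
        congr with ξ
        have e1 : ∀ y : E d, rε (v - δ • y) * (gauss ξ * expo ξ y) =
            gauss ξ * (fun t => rε (v - t) * expo (δ⁻¹ • ξ) t) (δ • y) := by
          intro y
          have : expo (δ⁻¹ • ξ) (δ • y) = expo ξ y := by
            unfold expo
            rw [inner_smul_left, inner_smul_right]
            simp [hδ.ne']
          simp only [this]; ring
        simp_rw [e1]
        rw [integral_const_mul,
          Measure.integral_comp_smul volume (fun t => rε (v - t) * expo (δ⁻¹ • ξ) t) δ]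
        have e2 : ∫ t, rε (v - t) * expo (δ⁻¹ • ξ) t =
            expo (δ⁻¹ • ξ) v * smoothFourier r ε (δ⁻¹ • ξ) := by
          rw [← integral_sub_left_eq_self _ _ v, smoothFourier, ← integral_const_mul]
          congr with t
          rw [expo_sub_right, sub_sub_cancel]
          simp only [hrε]; ring
        rw [e2, finrank_euclideanSpace, Fintype.card_fin, abs_of_pos (by positivity)]
        rw [Complex.real_smul]
        push_cast
        ring

lemma exists_measure_approx {C : ℝ} (hc : Continuous r) (hb : ∀ v, ‖r v‖ ≤ C)
    (hpos : ∀ ψ : E d → ℂ, Integrable ψ →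
      0 ≤ ∫ z : E d × E d, ψ z.1 * star (ψ z.2) * r (z.1 - z.2))
    {ε δ : ℝ} (hε : 0 < ε) (hδ : 0 < δ) :
    ∃ ρ : Measure (E d), IsFiniteMeasure ρ ∧ ∀ v, ∫ ξ, expo ξ v ∂ρ =
      ∫ y, r (v - δ • y) * Real.exp (-ε * ‖v - δ • y‖ ^ 2) * gauss y := by
  set D : E d → ℂ := fun ξ => (δ ^ d)⁻¹ * gauss ξ * smoothFourier r ε (δ⁻¹ • ξ) with hD
  have hri : Integrable fun w => r w * (Real.exp (-ε * ‖w‖ ^ 2) : ℂ) := integrable_mul_exp hc hb hε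
  have hsc : Continuous (smoothFourier r ε) := by
    unfold smoothFourier
    refine continuous_of_dominated (bound := fun w => ‖r w * (Real.exp (-ε * ‖w‖ ^ 2) : ℂ)‖)
      (fun ξ => ?_) (fun ξ => ae_of_all _ fun w => (norm_mul_star_expo _ _ _).le) hri.norm
      (ae_of_all _ fun w => by fun_prop)
    exact Continuous.aestronglyMeasurable (by fun_prop)
  have hsb : ∀ ξ, ‖smoothFourier r ε ξ‖ ≤ ∫ w, ‖r w * (Real.exp (-ε * ‖w‖ ^ 2) : ℂ)‖ := fun ξ => by
    refine (norm_integral_le_integral_norm _).trans_eq ?_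
    simp_rw [norm_mul_star_expo]
  have hDpos : ∀ ξ, 0 ≤ D ξ := fun ξ => by
    refine mul_nonneg (mul_nonneg ?_ ?_) (zero_le_smoothFourier hc hb hpos hε _)
    · exact_mod_cast (by positivity : (0:ℝ) ≤ (δ ^ d)⁻¹)
    · exact_mod_cast (Real.exp_pos _).le
  have hDi : Integrable D := by
    refine Integrable.mul_bdd (c := ∫ w, ‖r w * (Real.exp (-ε * ‖w‖ ^ 2) : ℂ)‖)
      ((integrable_gauss (d := d)).ofReal (𝕜 := ℂ) |>.const_mul _) ?_ (ae_of_all _ fun ξ => hsb _)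
    exact Continuous.aestronglyMeasurable (by fun_prop)
  have hDre : ∀ ξ, ((D ξ).re : ℂ) = D ξ := fun ξ => by
    have := Complex.nonneg_iff.1 (hDpos ξ)
    exact Complex.ext rfl this.2
  have hm : Measurable fun ξ : E d => δ⁻¹ • ξ := by fun_prop
  set κ := volume.withDensity fun ξ => ENNReal.ofReal (D ξ).re
  have hκ : IsFiniteMeasure κ := isFiniteMeasure_withDensity_ofReal hDi.re.2
  have hmD : AEMeasurable fun ξ => ENNReal.ofReal (D ξ).re :=
    hDi.re.aestronglyMeasurable.aemeasurable.ennreal_ofReal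
  refine ⟨κ.map fun ξ => δ⁻¹ • ξ, inferInstance, fun v => ?_⟩
  rw [integral_mul_gauss_eq hc hb hε hδ, integral_map hm.aemeasurable
    (Continuous.aestronglyMeasurable (by fun_prop)),
    integral_withDensity_eq_integral_toReal_smul₀ hmD (by simp)]
  congr with ξ
  rw [ENNReal.toReal_ofReal (Complex.nonneg_iff.1 (hDpos ξ)).1, Complex.real_smul, hDre, mul_comm]

lemma charFun_eq_integral_expo (ρ : Measure (E d)) (t : E d) :
    charFun ρ t = ∫ ξ, expo ξ ((2 * Real.pi)⁻¹ • t) ∂ρ := by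
  rw [charFun_apply]
  congr with ξ
  rw [expo_eq, inner_smul_right]
  congr 3
  field_simp

/-- **Bochner's theorem** on `ℝ^d`. -/
theorem exists_measure_of_posDef {C : ℝ} (hc : Continuous r) (hb : ∀ v, ‖r v‖ ≤ C)
    (hpos : ∀ ψ : E d → ℂ, Integrable ψ →
      0 ≤ ∫ z : E d × E d, ψ z.1 * star (ψ z.2) * r (z.1 - z.2)) :
    ∃ ρ : Measure (E d), IsFiniteMeasure ρ ∧ ∀ v, r v = ∫ ξ, expo ξ v ∂ρ := by
  have hseq : ∀ N : ℕ, (0 : ℝ) < 1 / ((N : ℝ) + 1) := fun N => by positivity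
  -- Both regularizations, ε and δ, are set to 1/(N+1). The transforms then converge to r(v) times
  -- the total Gaussian mass K.
  choose ρ hρf hρ using fun N : ℕ => exists_measure_approx hc hb hpos (hseq N) (hseq N)
  set K : ℝ := ∫ y : E d, gauss y with hK
  have hKpos : 0 < K := integral_gauss_pos
  have hlim : ∀ v, Tendsto (fun N => ∫ ξ, expo ξ v ∂(ρ N)) atTop (𝓝 (r v * K)) := by
    intro v
    simp_rw [hρ]
    have hN := tendsto_one_div_add_atTop_nhds_zero_nat (𝕜 := ℝ)
    rw [hK, ← integral_complex_ofReal, ← integral_const_mul]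
    refine tendsto_integral_of_dominated_convergence (fun y => C * gauss y) (fun N => ?_)
      (integrable_gauss.const_mul C) (fun N => ae_of_all _ fun y => ?_) (ae_of_all _ fun y => ?_)
    · have := continuous_gauss (d := d)
      exact Continuous.aestronglyMeasurable (by fun_prop)
    · rw [norm_mul, norm_mul, Complex.norm_real, Complex.norm_real, Real.norm_of_nonneg (Real.exp_pos _).le,
        Real.norm_of_nonneg (show (0 : ℝ) ≤ gauss y from (Real.exp_pos _).le)]
      have h1 : Real.exp (-(1 / ((N : ℝ) + 1)) * ‖v - (1 / ((N : ℝ) + 1)) • y‖ ^ 2) ≤ 1 := by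
        rw [Real.exp_le_one_iff]
        have := hseq N
        nlinarith [sq_nonneg ‖v - (1 / ((N : ℝ) + 1)) • y‖, this]
      have h2 := hb (v - (1 / ((N : ℝ) + 1)) • y)
      have h3 : 0 ≤ C := (norm_nonneg _).trans h2
      calc _ ≤ C * 1 * gauss y := by
            gcongr
            exact (Real.exp_pos _).le
        _ = _ := by rw [mul_one]
    · have hF : Continuous fun s : ℝ => r (v - s • y) * (Real.exp (-s * ‖v - s • y‖ ^ 2) : ℂ) * (gauss y : ℂ) := by
        fun_prop
      have := (hF.tendsto 0).comp hN
      simp only [zero_smul, sub_zero, neg_zero, zero_mul, Real.exp_zero, Complex.ofReal_one, mul_one] at this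
      exact this
  have hmass : ∀ N, ∫ ξ, expo ξ 0 ∂(ρ N) = ((ρ N).real Set.univ : ℂ) := fun N => by simp
  have hr0 : 0 ≤ (r 0).re ∧ (r 0).im = 0 := by
    have h0 : 0 ≤ r 0 * K := ge_of_tendsto (hlim 0) (Eventually.of_forall fun N => by
      rw [hmass]
      exact_mod_cast measureReal_nonneg)
    have := Complex.nonneg_iff.1 (nonneg_of_mul_ofReal_nonneg hKpos h0)
    exact ⟨this.1, this.2.symm⟩
  have hr0' : ((r 0).re : ℂ) = r 0 := Complex.ext rfl (by simp [hr0.2])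
  have hmlim : Tendsto (fun N => (ρ N).real Set.univ) atTop (𝓝 ((r 0).re * K)) := by
    have := (Complex.continuous_re.tendsto _).comp (hlim 0)
    simpa [Function.comp_def, hmass] using this
  -- If r(0) = 0 the masses tend to 0 and r vanishes identically; this case is set apart because the
  -- measures are normalized below.
  rcases hr0.1.eq_or_lt with h0 | h0
  · refine ⟨0, inferInstance, fun v => ?_⟩
    have h1 : r v * K = 0 := by
      refine tendsto_nhds_unique (hlim v) ?_
      refine squeeze_zero_norm (fun N => ?_) (by simpa [← h0] using hmlim)
      refine (norm_integral_le_integral_norm _).trans_eq ?_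
      simp [norm_expo]
    simpa [hKpos.ne'] using h1
  have hpos' : ∀ᶠ N in atTop, 0 < (ρ N).real Set.univ :=
    hmlim.eventually (lt_mem_nhds (by positivity))
  obtain ⟨N₀, hN₀⟩ := eventually_atTop.1 hpos'
  have hne : ∀ N, 0 < (ρ (N + N₀)).real Set.univ := fun N => hN₀ _ (by omega)
  have hNZ : ∀ N, NeZero (ρ (N + N₀)) := fun N => ⟨fun h => by
    have := hne N; rw [h] at this; simp at this⟩
  let μ : ℕ → ProbabilityMeasure (E d) := fun N =>
    ⟨((ρ (N + N₀)) Set.univ)⁻¹ • ρ (N + N₀), isProbabilityMeasureSMul⟩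
  have hμ : ∀ N t, charFun (μ N : Measure (E d)) t =
      ((ρ (N + N₀)).real Set.univ : ℂ)⁻¹ * ∫ ξ, expo ξ ((2 * Real.pi)⁻¹ • t) ∂(ρ (N + N₀)) := by
    intro N t
    rw [charFun_eq_integral_expo]
    simp only [μ, ProbabilityMeasure.coe_mk]
    rw [integral_smul_measure, ENNReal.toReal_inv, Complex.real_smul]
    simp [measureReal_def]
  have hch : ∀ t, Tendsto (fun N => charFun (μ N : Measure (E d)) t) atTop
      (𝓝 ((r 0)⁻¹ * r ((2 * Real.pi)⁻¹ • t))) := by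
    intro t
    simp_rw [hμ]
    have h1 : Tendsto (fun N => ((ρ N).real Set.univ : ℂ)⁻¹) atTop (𝓝 (((r 0).re * K : ℝ) : ℂ)⁻¹) :=
      ((Complex.continuous_ofReal.tendsto _).comp hmlim).inv₀ (by
        exact_mod_cast (by positivity : (r 0).re * K ≠ 0))
    have h2 := ((h1.mul (hlim ((2 * Real.pi)⁻¹ • t))).comp (tendsto_add_atTop_nat N₀))
    have e : (((r 0).re * K : ℝ) : ℂ)⁻¹ * (r ((2 * Real.pi)⁻¹ • t) * K) =
        (r 0)⁻¹ * r ((2 * Real.pi)⁻¹ • t) := by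
      rw [Complex.ofReal_mul, hr0']
      have : (K : ℂ) ≠ 0 := by exact_mod_cast hKpos.ne'
      field_simp
    rw [e] at h2
    exact h2
  -- Characteristic functions with a limit continuous at 0 give tightness. Prokhorov's theorem then
  -- provides a limit along an ultrafilter, and its characteristic function is the normalized r.
  have htight : IsTightMeasureSet (Set.range fun N => (μ N : Measure (E d))) :=
    isTightMeasureSet_of_tendsto_charFun (f := fun t => (r 0)⁻¹ * r ((2 * Real.pi)⁻¹ • t))
      (Continuous.continuousAt (by fun_prop)) hch
  have hcomp : IsCompact (closure (Set.range μ)) := by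
    apply isCompact_closure_of_isTightMeasureSet
    convert htight using 1
    ext m; simp
  let U : Ultrafilter ℕ := Filter.hyperfilter ℕ
  have hU : (U : Filter ℕ) ≤ atTop := by
    rw [← Nat.cofinite_eq_atTop]; exact Filter.hyperfilter_le_cofinite
  obtain ⟨m, -, hm⟩ := hcomp.ultrafilter_le_nhds (U.map μ) (by
    rw [Filter.le_principal_iff]
    exact Filter.Eventually.of_forall (f := (U : Filter ℕ)) fun N => subset_closure ⟨N, rfl⟩)
  have hm' : Tendsto μ U (𝓝 m) := hm
  have hmc : ∀ t, charFun (m : Measure (E d)) t = (r 0)⁻¹ * r ((2 * Real.pi)⁻¹ • t) := by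
    intro t
    refine tendsto_nhds_unique ?_ ((hch t).mono_left hU)
    simp_rw [charFun_eq_integral_innerProbChar]
    exact (ProbabilityMeasure.tendsto_iff_forall_integral_rclike_tendsto ℂ).1 hm' _
  have hr0ne : r 0 ≠ 0 := fun h => by rw [h] at h0; simp at h0
  refine ⟨ENNReal.ofReal (r 0).re • (m : Measure (E d)),
    ⟨by rw [Measure.smul_apply, measure_univ]; simp⟩, fun v => ?_⟩
  have h1 := hmc ((2 * Real.pi) • v)
  rw [charFun_eq_integral_expo, smul_smul, inv_mul_cancel₀ (by positivity), one_smul] at h1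
  rw [integral_smul_measure, ENNReal.toReal_ofReal h0.le, h1, Complex.real_smul, hr0',
    mul_inv_cancel_left₀ hr0ne]

end Bochner

/-! ### Matrix-valued spectral measures from scalar ones -/

section SpectralMeasure

variable {d : ℕ}

/-- Bochner's theorem applies: the covariance is positive definite, and it is bounded by r(0)
through |ab| ≤ (|a|² + |b|²)/2. -/
lemma IsSecondOrder.exists_measure {Ω : Type*} [MeasurableSpace Ω] {P : Measure Ω}
    [IsProbabilityMeasure P] {Y : E d → Ω → ℂ} {r : E d → ℂ} (hY : IsSecondOrder P Y r)
    (hr : Continuous r) :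
    ∃ ρ : Measure (E d), IsFiniteMeasure ρ ∧ ∀ v, r v = ∫ ξ, expo ξ v ∂ρ := by
  refine exists_measure_of_posDef (C := (r 0).re) hr (fun v => ?_)
    fun ψ hψ => hY.zero_le_integral hψ
  have h1 : r v = ∫ ω, Y v ω * star (Y 0 ω) ∂P := by rw [hY.cov, sub_zero]
  have i0 : ∀ u, Integrable (fun ω => ‖Y u ω‖ ^ 2) P := fun u => (hY.memLp u).integrable_norm_pow (by norm_num)
  calc ‖r v‖ ≤ ∫ ω, ‖Y v ω * star (Y 0 ω)‖ ∂P := h1 ▸ norm_integral_le_integral_norm _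
    _ ≤ ∫ ω, ((1 / 2) * ‖Y v ω‖ ^ 2 + (1 / 2) * ‖Y 0 ω‖ ^ 2) ∂P := by
        refine integral_mono_of_nonneg (ae_of_all _ fun ω => norm_nonneg _)
          (((i0 v).const_mul _).add ((i0 0).const_mul _)) (ae_of_all _ fun ω => ?_)
        simp only [norm_mul, norm_star]
        nlinarith [sq_nonneg (‖Y v ω‖ - ‖Y 0 ω‖)]
    _ = (r 0).re := by
        rw [integral_add ((i0 v).const_mul _) ((i0 0).const_mul _), integral_const_mul,
          integral_const_mul, hY.integral_norm_sq, hY.integral_norm_sq]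
        ring

/-- A finite measure, as a complex measure. -/
def toComplex (ρ : Measure (E d)) : ComplexMeasure (E d) := ρ.withDensityᵥ fun _ => (1 : ℂ)

lemma ft_toComplex (ρ : Measure (E d)) [IsFiniteMeasure ρ] (v : E d) :
    ft (toComplex ρ) v = ∫ ξ, expo ξ v ∂ρ := by
  rw [toComplex, ft_withDensity ρ (integrable_const _)]
  simp

lemma toComplex_apply (ρ : Measure (E d)) [IsFiniteMeasure ρ] {B : Set (E d)}
    (hB : MeasurableSet B) : toComplex ρ B = (ρ.real B : ℂ) := by
  rw [toComplex, withDensityᵥ_apply (integrable_const _) hB]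
  simp

/-- Over ℂ, a quadratic form with nonnegative (in particular real) values comes from a Hermitian
matrix, so symmetry need not be assumed. -/
lemma _root_.Matrix.posSemidef_of_forall_zero_le {κ : Type*} [Fintype κ] {A : Matrix κ κ ℂ}
    (h : ∀ w : κ → ℂ, 0 ≤ ∑ i, ∑ j, star (w i) * w j * A i j) : A.PosSemidef := by
  classical
  have key : ∀ w : κ → ℂ, star w ⬝ᵥ A.mulVec w = ∑ i, ∑ j, star (w i) * w j * A i j := fun w => by
    simp only [dotProduct, Matrix.mulVec, Pi.star_apply, Finset.mul_sum]
    exact Finset.sum_congr rfl fun i _ => Finset.sum_congr rfl fun j _ => by ring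
  rw [← Matrix.isPositive_toEuclideanLin_iff, LinearMap.isPositive_iff_complex]
  intro x
  have h1 : inner ℂ (Matrix.toEuclideanLin A x) x =
      star (∑ i, ∑ j, star (x i) * x j * A i j) := by
    rw [← key, EuclideanSpace.inner_eq_star_dotProduct]
    rw [Matrix.star_dotProduct, star_star, dotProduct_comm]
    rfl
  have h2 : 0 ≤ inner ℂ (Matrix.toEuclideanLin A x) x := by
    rw [h1]; exact star_nonneg_iff.2 (h _)
  obtain ⟨h3, h4⟩ := Complex.nonneg_iff.1 h2
  exact ⟨Complex.ext rfl h4, h3⟩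

/-- By injectivity of the Fourier transform, each scalar measure obtained by contracting M with w is
the positive measure ρ. -/
lemma isPositive_of_forall_ft {κ : Type} [Fintype κ] {M : MatrixMeasure d κ}
    (h : ∀ w : κ → ℂ, ∃ ρ : Measure (E d), IsFiniteMeasure ρ ∧
      ∀ v, ∑ i, ∑ j, star (w i) * w j * ft (M i j) v = ∫ ξ, expo ξ v ∂ρ) : IsPositive M := by
  intro B hB
  refine Matrix.posSemidef_of_forall_zero_le fun w => ?_
  obtain ⟨ρ, _, hρ⟩ := h w
  have h1 : ∑ i, ∑ j, (star (w i) * w j) • M i j = toComplex ρ := by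
    refine ft_injective fun v => ?_
    simp_rw [ft_sum, ft_smul, ft_toComplex, hρ]
  have h2 := congrArg (fun c : ComplexMeasure (E d) => c B) h1
  simp only [FunLike.coe_sum, Finset.sum_apply, _root_.smul_apply,
    toComplex_apply ρ hB, smul_eq_mul] at h2
  simp only [Matrix.of_apply, h2]
  exact_mod_cast measureReal_nonneg

lemma exists_matrixMeasure {κ : Type} [Fintype κ] [DecidableEq κ] {G : E d → κ → κ → ℂ}
    (h : ∀ w : κ → ℂ, ∃ ρ : Measure (E d), IsFiniteMeasure ρ ∧
      ∀ v, ∑ i, ∑ j, star (w i) * w j * G v i j = ∫ ξ, expo ξ v ∂ρ) :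
    ∃ M : MatrixMeasure d κ, ∀ v i j, ft (M i j) v = G v i j := by
  choose ρ hρf hρ using h
  -- Polarization: the (i, j) entry is recovered from the four measures attached to e_i + ζ e_j with
  -- ζ = 1, -1, i, -i.
  let e : ℂ → κ → κ → κ → ℂ := fun ζ i j => Pi.single i 1 + ζ • Pi.single j 1
  refine ⟨fun i j => (4 : ℂ)⁻¹ • (toComplex (ρ (e 1 i j)) + (-1 : ℂ) • toComplex (ρ (e (-1) i j)) +
    (-Complex.I) • toComplex (ρ (e Complex.I i j)) + Complex.I • toComplex (ρ (e (-Complex.I) i j))),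
    fun v i j => ?_⟩
  have key : ∀ ζ, ∫ ξ, expo ξ v ∂(ρ (e ζ i j)) = G v i i + ζ * G v i j + star ζ * G v j i +
      star ζ * ζ * G v j j := by
    intro ζ
    rw [← hρ]
    simp only [e, Pi.add_apply, Pi.smul_apply, smul_eq_mul, star_add, star_mul', add_mul, mul_add,
      Finset.sum_add_distrib, Pi.single_apply]
    simp [mul_comm, apply_ite]
    ring
  rw [ft_smul, ft_add, ft_add, ft_add, ft_smul, ft_smul, ft_smul]
  simp only [ft_toComplex, key, star_neg, Complex.star_def, map_one, Complex.conj_I]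
  linear_combination ((1/2 : ℂ) * G v j i - (1/2 : ℂ) * G v i j) * Complex.I_sq

end SpectralMeasure

/-! ### Existence of the spectral measure and positivity of its convolution powers -/

section ConvPow

variable {d n : ℕ} {Ω : Type*} [MeasurableSpace Ω] {P : Measure Ω} [IsProbabilityMeasure P]
  {X : E d → Ω → E n}

lemma IsSpectralMeasure.ft_eq {K : E d → Matrix (Fin n) (Fin n) ℝ} {μ : MatrixMeasure d (Fin n)}
    (hμ : IsSpectralMeasure K μ) (i j : Fin n) (v : E d) : ft (μ i j) v = (K v i j : ℂ) :=
  (hμ.fourier v i j).symm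

lemma IsSpectralMeasure.ft_convPow {K : E d → Matrix (Fin n) (Fin n) ℝ}
    {μ : MatrixMeasure d (Fin n)} (hμ : IsSpectralMeasure K μ) {q : ℕ} (I J : Fin q → Fin n)
    (v : E d) : ft (convPow μ q I J) v =
      (q.factorial : ℂ)⁻¹ * ∑ σ : Equiv.Perm (Fin q), ∏ k, (K v (I (σ k)) (J k) : ℂ) := by
  rw [convPow, ft_smul, ft_sum]
  simp_rw [ft_multiConv, hμ.ft_eq]

lemma IsStationaryGaussianField.isSecondOrder_wickSum (hX : IsStationaryGaussianField P X) {p : ℕ}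
    {g : (Fin p → Fin n) → ℂ} (hg : ∀ (σ : Equiv.Perm (Fin p)) I, g (I ∘ σ) = g I) :
    IsSecondOrder P (fun v ω => wickSum (P.map (X 0)) p g (X v ω))
      (fun v => p.factorial * tensorCov (covFun P X) g v) := by
  obtain ⟨h1, h2, h3, -⟩ := hX.wickSum_spec g hg
  exact ⟨h1.measurable.comp hX.measurable, h2, h3⟩

lemma continuous_tensorCov {p : ℕ} {K : E d → Matrix (Fin n) (Fin n) ℝ} (hK : Continuous K)
    (g : (Fin p → Fin n) → ℂ) : Continuous (tensorCov K g) := by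
  unfold tensorCov
  have : ∀ i j, Continuous fun v => K v i j := fun i j => hK.matrix_elem i j
  fun_prop

/-- Up to the factor p!, this function is the covariance of the stationary process `wickSum` along
X, so Bochner's theorem applies. -/
lemma IsStationaryGaussianField.exists_measure_tensorCov (hX : IsStationaryGaussianField P X)
    {p : ℕ} {g : (Fin p → Fin n) → ℂ} (hg : ∀ (σ : Equiv.Perm (Fin p)) I, g (I ∘ σ) = g I) :
    ∃ ρ : Measure (E d), IsFiniteMeasure ρ ∧
      ∀ v, tensorCov (covFun P X) g v = ∫ ξ, expo ξ v ∂ρ := by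
  obtain ⟨ρ, _, hρ⟩ := (hX.isSecondOrder_wickSum hg).exists_measure
    (continuous_const.mul (continuous_tensorCov hX.continuous_cov g))
  refine ⟨ENNReal.ofReal (p.factorial : ℝ)⁻¹ • ρ, ⟨?_⟩, fun v => ?_⟩
  · rw [Measure.smul_apply, smul_eq_mul]
    exact ENNReal.mul_lt_top (by simp) (measure_lt_top _ _)
  · rw [integral_smul_measure, ← hρ, ENNReal.toReal_ofReal (by positivity), Complex.real_smul]
    have : (p.factorial : ℂ) ≠ 0 := by exact_mod_cast p.factorial_ne_zero
    push_cast
    field_simp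

theorem IsStationaryGaussianField.exists_isSpectralMeasure (hX : IsStationaryGaussianField P X) :
    ∃ μ, IsSpectralMeasure (covFun P X) μ := by
  have h : ∀ w : Fin n → ℂ, ∃ ρ : Measure (E d), IsFiniteMeasure ρ ∧
      ∀ v, ∑ i, ∑ j, star (w i) * w j * (covFun P X v i j : ℂ) = ∫ ξ, expo ξ v ∂ρ := by
    intro w
    -- First-order tensors are vectors. The conjugate of w is taken because `tensorCov` conjugates
    -- its second factor.
    obtain ⟨ρ, hρf, hρ⟩ := hX.exists_measure_tensorCov (p := 1) (g := fun I => star (w (I 0)))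
      (fun σ I => by rw [Function.comp_apply, Subsingleton.elim (σ 0) 0])
    refine ⟨ρ, hρf, fun v => ?_⟩
    rw [← hρ, tensorCov, ← (Equiv.funUnique (Fin 1) (Fin n)).symm.sum_comp]
    refine Finset.sum_congr rfl fun i _ => ?_
    rw [← (Equiv.funUnique (Fin 1) (Fin n)).symm.sum_comp]
    simp [Equiv.funUnique]
  obtain ⟨μ, hμ⟩ := exists_matrixMeasure h
  refine ⟨μ, isPositive_of_forall_ft fun w => ?_, fun v i j => (hμ v i j).symm⟩
  simp_rw [hμ]
  exact h w

/-- The form T is invariant when both tensors are permuted together, so symmetrizing both arguments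
amounts to symmetrizing one, which is what `convPow` does on its left index. -/
lemma tensorCov_symmetrize {q : ℕ} (K : E d → Matrix (Fin n) (Fin n) ℝ)
    (w : (Fin q → Fin n) → ℂ) (v : E d) :
    tensorCov K (fun I => (q.factorial : ℂ)⁻¹ * ∑ τ : Equiv.Perm (Fin q), star (w (I ∘ τ))) v =
      ∑ I, ∑ J, star (w I) * w J *
        ((q.factorial : ℂ)⁻¹ * ∑ σ : Equiv.Perm (Fin q), ∏ k, (K v (I (σ k)) (J k) : ℂ)) := by
  have hq : (q.factorial : ℂ) ≠ 0 := by exact_mod_cast q.factorial_ne_zero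
  set T : ((Fin q → Fin n) → ℂ) → ((Fin q → Fin n) → ℂ) → ℂ := fun a b =>
    ∑ I, ∑ J, a I * star (b J) * ∏ k, (K v (I k) (J k) : ℂ) with hT
  have hinv : ∀ (τ : Equiv.Perm (Fin q)) a b,
      T (fun I => a (I ∘ τ)) (fun I => b (I ∘ τ)) = T a b := by
    intro τ a b
    simp only [hT]
    refine Fintype.sum_equiv (Equiv.arrowCongr τ.symm (Equiv.refl _)) _ _ fun I => ?_
    refine Fintype.sum_equiv (Equiv.arrowCongr τ.symm (Equiv.refl _)) _ _ fun J => ?_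
    rw [← Equiv.prod_comp τ fun k => (K v (I k) (J k) : ℂ)]
    rfl
  set b : (Fin q → Fin n) → ℂ := fun I => star (w I) with hb
  set g : (Fin q → Fin n) → ℂ := fun I =>
    (q.factorial : ℂ)⁻¹ * ∑ τ : Equiv.Perm (Fin q), b (I ∘ τ) with hg
  have hgs : ∀ (τ : Equiv.Perm (Fin q)), (fun I => g (I ∘ τ)) = g := by
    intro τ
    ext I
    simp only [hg]
    congr 1
    exact Fintype.sum_equiv (Equiv.mulLeft τ) _ _ fun σ => rfl
  have hl : ∀ a, T a g = (q.factorial : ℂ)⁻¹ * ∑ τ : Equiv.Perm (Fin q), T a (fun I => b (I ∘ τ)) := by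
    intro a
    simp only [hT, Finset.mul_sum]
    conv_rhs => rw [Finset.sum_comm]
    refine Finset.sum_congr rfl fun I _ => ?_
    conv_rhs => rw [Finset.sum_comm]
    refine Finset.sum_congr rfl fun J _ => ?_
    simp only [hg, star_mul', star_sum, star_inv₀, star_natCast, Finset.mul_sum, Finset.sum_mul]
    exact Finset.sum_congr rfl fun τ _ => by ring
  have hr : T g b = (q.factorial : ℂ)⁻¹ * ∑ τ : Equiv.Perm (Fin q), T (fun I => b (I ∘ τ)) b := by
    simp only [hT, Finset.mul_sum]
    conv_rhs => rw [Finset.sum_comm]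
    refine Finset.sum_congr rfl fun I _ => ?_
    conv_rhs => rw [Finset.sum_comm]
    refine Finset.sum_congr rfl fun J _ => ?_
    simp only [hg, Finset.mul_sum, Finset.sum_mul]
    exact Finset.sum_congr rfl fun τ _ => by ring
  have h1 : T g g = T g b := by
    rw [hl]
    have : ∀ τ : Equiv.Perm (Fin q), T g (fun I => b (I ∘ τ)) = T g b := fun τ => by
      conv_lhs => rw [← hgs τ]
      exact hinv τ g b
    simp_rw [this]
    rw [Finset.sum_const, Finset.card_univ, Fintype.card_perm, Fintype.card_fin, nsmul_eq_mul,
      inv_mul_cancel_left₀ hq]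
  calc _ = T g g := rfl
    _ = (q.factorial : ℂ)⁻¹ * ∑ τ : Equiv.Perm (Fin q), T (fun I => b (I ∘ τ)) b := by rw [h1, hr]
    _ = (q.factorial : ℂ)⁻¹ * ∑ τ : Equiv.Perm (Fin q),
        ∑ I, ∑ J, b I * w J * ∏ k, (K v (I (τ k)) (J k) : ℂ) := by
        congr 1
        refine Fintype.sum_equiv (Equiv.inv _) _ _ fun τ => ?_
        refine Fintype.sum_equiv (Equiv.arrowCongr τ.symm (Equiv.refl _)) _ _ fun I => ?_
        refine Finset.sum_congr rfl fun J _ => ?_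
        simp only [hb, star_star]
        congr 1
        refine Finset.prod_congr rfl fun k _ => ?_
        simp [Equiv.arrowCongr]
    _ = _ := by
        simp only [Finset.mul_sum]
        rw [Finset.sum_comm]
        refine Finset.sum_congr rfl fun I _ => ?_
        rw [Finset.sum_comm]
        refine Finset.sum_congr rfl fun J _ => ?_
        refine Finset.sum_congr rfl fun τ _ => ?_
        simp only [hb]
        ring

/-- Contracted with w, the Fourier transform of μ^{*q} is the covariance, up to q!, of a q-th Wick
power of X. Positivity is thus Bochner's theorem again, with no analysis of convolutions of positive
matrices. -/
theorem IsStationaryGaussianField.isPositive_convPow (hX : IsStationaryGaussianField P X)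
    {μ : MatrixMeasure d (Fin n)} (hμ : IsSpectralMeasure (covFun P X) μ) (q : ℕ) :
    IsPositive (convPow μ q) := by
  refine isPositive_of_forall_ft fun w => ?_
  obtain ⟨ρ, hρf, hρ⟩ := hX.exists_measure_tensorCov
    (g := fun I => (q.factorial : ℂ)⁻¹ * ∑ τ : Equiv.Perm (Fin q), star (w (I ∘ τ)))
    (fun σ I => by
      congr 1
      exact Fintype.sum_equiv (Equiv.mulLeft σ) _ _ fun τ => rfl)
  refine ⟨ρ, hρf, fun v => ?_⟩
  simp_rw [hμ.ft_convPow, ← hρ, tensorCov_symmetrize]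

end ConvPow

/-! ### The trace form tr(F A F B*) on positive matrices -/

section Pairing

variable {κ : Type*} [Fintype κ]

/-- The Hermitian form `(A, B) ↦ tr(F A F Bᴴ)` on matrices defined by a real symmetric matrix `F`. -/
def pairing (F : κ → κ → ℝ) (A B : Matrix κ κ ℂ) : ℂ :=
  ∑ I, ∑ I', ∑ J, ∑ J', (F I I' : ℂ) * F J J' * (A I J * star (B I' J'))

/-- The isotropic cone of the Hermitian form `z ↦ ∑ F(I, J) z_I z̄_J`. -/
def cone (F : κ → κ → ℝ) : Set (κ → ℂ) := {z | ∑ I, ∑ J, (F I J : ℂ) * z I * star (z J) = 0}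

lemma isClosed_cone (F : κ → κ → ℝ) : IsClosed (cone F) :=
  isClosed_eq (by fun_prop) continuous_const

variable {F : κ → κ → ℝ}

lemma pairing_eq_trace (hF : ∀ I J, F I J = F J I) (A B : Matrix κ κ ℂ) :
    pairing F A B = ((Matrix.of fun I J => (F I J : ℂ)) * A * (Matrix.of fun I J => (F I J : ℂ)) *
      B.conjTranspose).trace := by
  simp only [pairing, Matrix.trace, Matrix.diag, Matrix.mul_apply, Finset.sum_mul,
    Matrix.conjTranspose_apply, Matrix.of_apply]
  conv_lhs => rw [Finset.sum_comm]
  refine Finset.sum_congr rfl fun I' _ => ?_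
  conv_rhs =>
    enter [2, J']
    rw [Finset.sum_comm]
  conv_rhs => rw [Finset.sum_comm]
  refine Finset.sum_congr rfl fun I _ => ?_
  conv_lhs => rw [Finset.sum_comm]
  refine Finset.sum_congr rfl fun J' _ => Finset.sum_congr rfl fun J _ => ?_
  rw [hF I' I]
  ring

omit [Fintype κ] in
lemma isHermitian_of_symm (hF : ∀ I J, F I J = F J I) :
    (Matrix.of fun I J => (F I J : ℂ)).IsHermitian := by
  ext I J
  simp [hF I J]

lemma _root_.Matrix.PosSemidef.exists_conjTranspose_mul_self {A : Matrix κ κ ℂ}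
    (hA : A.PosSemidef) : ∃ C : Matrix κ κ ℂ, A = C.conjTranspose * C := by
  open scoped MatrixOrder in
  classical
  obtain ⟨X, hX, -, h⟩ := sub_zero A ▸ CFC.exists_sqrt_of_isSelfAdjoint_of_quasispectrumRestricts
    hA.isHermitian (QuasispectrumRestricts.nnreal_of_nonneg hA.nonneg)
  exact ⟨X, by rw [← Matrix.star_eq_conjTranspose, hX.star_eq]; exact (h.trans (sub_zero A)).symm⟩

/-- By cyclicity of the trace, the pairing is the squared Hilbert–Schmidt norm of C F D*. This gives
its sign and its zero set. -/
lemma pairing_eq_trace_mul_self (hF : ∀ I J, F I J = F J I) (C D : Matrix κ κ ℂ) :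
    pairing F (C.conjTranspose * C) (D.conjTranspose * D) =
      ((C * (Matrix.of fun I J => (F I J : ℂ)) * D.conjTranspose).conjTranspose *
        (C * (Matrix.of fun I J => (F I J : ℂ)) * D.conjTranspose)).trace := by
  rw [pairing_eq_trace hF]
  simp only [Matrix.conjTranspose_mul, Matrix.conjTranspose_conjTranspose,
    (isHermitian_of_symm hF).eq]
  rw [← Matrix.mul_assoc, Matrix.trace_mul_comm]
  simp only [Matrix.mul_assoc]

lemma pairing_nonneg (hF : ∀ I J, F I J = F J I) {A B : Matrix κ κ ℂ} (hA : A.PosSemidef)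
    (hB : B.PosSemidef) : 0 ≤ pairing F A B := by
  obtain ⟨C, rfl⟩ := hA.exists_conjTranspose_mul_self
  obtain ⟨D, rfl⟩ := hB.exists_conjTranspose_mul_self
  rw [pairing_eq_trace_mul_self hF]
  exact (Matrix.posSemidef_conjTranspose_mul_self _).trace_nonneg

/-- Both sides are equivalent to A F A = 0. With A = C*C, the pairing is ‖C F C*‖²; and the range of
A is isotropic iff the quadratic form of A F A vanishes, which over ℂ forces the matrix to vanish.
-/
lemma pairing_self_eq_zero_iff (hF : ∀ I J, F I J = F J I) {A : Matrix κ κ ℂ}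
    (hA : A.PosSemidef) : pairing F A A = 0 ↔ Set.range (fun w => A.mulVec w) ⊆ cone F := by
  set Φ : Matrix κ κ ℂ := Matrix.of fun I J => (F I J : ℂ) with hΦ
  have hcone : ∀ w, (∑ I, ∑ J, (F I J : ℂ) * (A.mulVec w) I * star ((A.mulVec w) J)) =
      star w ⬝ᵥ (A * Φ * A).mulVec w := by
    intro w
    have h1 : star w ⬝ᵥ (A * Φ * A).mulVec w = star (A.mulVec w) ⬝ᵥ Φ.mulVec (A.mulVec w) := by
      rw [Matrix.star_mulVec, hA.isHermitian.eq, ← Matrix.dotProduct_mulVec, Matrix.mulVec_mulVec,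
        Matrix.mulVec_mulVec]
    rw [h1, Finset.sum_comm]
    set z := A.mulVec w
    simp only [dotProduct, Matrix.mulVec, Pi.star_apply, hΦ, Matrix.of_apply, Finset.mul_sum]
    refine Finset.sum_congr rfl fun I _ => Finset.sum_congr rfl fun J _ => ?_
    rw [hF J I]
    ring
  have hcone' : Set.range (fun w => A.mulVec w) ⊆ cone F ↔
      ∀ w, star w ⬝ᵥ (A * Φ * A).mulVec w = 0 := by
    rw [Set.range_subset_iff]
    exact forall_congr' fun w => by rw [← hcone]; rfl
  rw [hcone']
  constructor
  · intro h w
    obtain ⟨C, hC⟩ := hA.exists_conjTranspose_mul_self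
    rw [hC, pairing_eq_trace_mul_self hF, Matrix.trace_conjTranspose_mul_self_eq_zero_iff] at h
    have : A * Φ * A = C.conjTranspose * (C * Φ * C.conjTranspose) * C := by
      rw [hC]; simp only [Matrix.mul_assoc]
    rw [this, h]
    simp
  · intro h
    -- A vanishing quadratic form is in particular nonnegative, so the kernel criterion for positive
    -- matrices applies to every w.
    have hpsd : (A * Φ * A).PosSemidef := Matrix.posSemidef_iff_dotProduct_mulVec.2
      ⟨by
        have := Matrix.isHermitian_mul_mul_conjTranspose A (isHermitian_of_symm hF)
        rwa [hA.isHermitian.eq] at this, fun w => (h w).ge⟩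
    have h0 : A * Φ * A = 0 := by
      refine Matrix.ext_iff_mulVec.2 fun w => ?_
      rw [(hpsd.dotProduct_mulVec_zero_iff w).1 (h w), Matrix.zero_mulVec]
    rw [pairing_eq_trace hF, hA.isHermitian.eq, Matrix.mul_assoc, Matrix.mul_assoc,
      ← Matrix.mul_assoc A, h0]
    simp

lemma norm_pairing_self_le (F : κ → κ → ℝ) (A : Matrix κ κ ℂ) :
    ‖pairing F A A‖ ≤ (∑ I, ∑ I', ∑ J, ∑ J', |F I I'| * |F J J'|) * ∑ I, ∑ J, ‖A I J‖ ^ 2 := by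
  have hle : ∀ I J, ‖A I J‖ ^ 2 ≤ ∑ I, ∑ J, ‖A I J‖ ^ 2 := fun I J =>
    (Finset.single_le_sum (f := fun J => ‖A I J‖ ^ 2) (fun _ _ => by positivity)
      (Finset.mem_univ J)).trans (Finset.single_le_sum (f := fun I => ∑ J, ‖A I J‖ ^ 2)
        (fun _ _ => by positivity) (Finset.mem_univ I))
  simp only [Finset.sum_mul (s := (Finset.univ : Finset κ)) (f := fun I => ∑ I', ∑ J, ∑ J', |F I I'| * |F J J'|)]
  refine norm_sum_le_of_le _ fun I _ => ?_
  rw [Finset.sum_mul]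
  refine norm_sum_le_of_le _ fun I' _ => ?_
  rw [Finset.sum_mul]
  refine norm_sum_le_of_le _ fun J _ => ?_
  rw [Finset.sum_mul]
  refine norm_sum_le_of_le _ fun J' _ => ?_
  rw [norm_mul, norm_mul, norm_mul, norm_star, Complex.norm_real, Complex.norm_real,
    Real.norm_eq_abs, Real.norm_eq_abs]
  gcongr
  nlinarith [hle I J, hle I' J', sq_nonneg (‖A I J‖ - ‖A I' J'‖)]

/-- On Hermitian matrices the pairing is symmetric. When A and B are isotropic, expanding it at A -
B leaves only the cross terms -2 pairing(A, B), so a pairing of positive matrices is controlled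
quadratically by their distance. -/
lemma norm_pairing_le_of_isotropic (hF : ∀ I J, F I J = F J I) {A B : Matrix κ κ ℂ}
    (hA : A.PosSemidef) (hB : B.PosSemidef) (hA0 : pairing F A A = 0) (hB0 : pairing F B B = 0) :
    ‖pairing F A B‖ ≤
      (∑ I, ∑ I', ∑ J, ∑ J', |F I I'| * |F J J'|) * ∑ I, ∑ J, ‖A I J - B I J‖ ^ 2 := by
  have hcomm : pairing F B A = pairing F A B := by
    rw [pairing_eq_trace hF, pairing_eq_trace hF, hA.isHermitian.eq, hB.isHermitian.eq,
      Matrix.mul_assoc, Matrix.trace_mul_comm]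
    simp only [Matrix.mul_assoc]
  have h1 : pairing F (A - B) (A - B) = -2 * pairing F A B := by
    have : pairing F (A - B) (A - B) = pairing F A A - pairing F A B - pairing F B A + pairing F B B := by
      simp only [pairing_eq_trace hF, Matrix.conjTranspose_sub, Matrix.mul_sub, Matrix.sub_mul,
        Matrix.trace_sub]
      ring
    rw [this, hA0, hB0, hcomm]
    ring
  have h2 := norm_pairing_self_le F (A - B)
  rw [h1, norm_mul, norm_neg] at h2
  simp only [Matrix.sub_apply, Complex.norm_ofNat] at h2
  linarith [norm_nonneg (pairing F A B)]

end Pairing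

/-! ### The image of a positive matrix measure -/

section Image

variable {d : ℕ} {κ : Type} [Fintype κ] {M : MatrixMeasure d κ} {ν : Measure (E d)}
  {S : E d → Matrix κ κ ℂ}

omit [Fintype κ] in
lemma HasDensity.setIntegral (h : HasDensity M ν S) {B : Set (E d)} (hB : MeasurableSet B) (i j : κ) :
    ∫ x in B, S x i j ∂ν = M i j B := by
  rw [(h i j).2, withDensityᵥ_apply (h i j).1 hB]

/-- For each w the contracted density is nonnegative off a null set that depends on w. A countable
dense set of w and the closedness of the condition remove this dependence. -/
lemma HasDensity.ae_posSemidef (h : HasDensity M ν S) (hM : IsPositive M) :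
    ∀ᵐ x ∂ν, (S x).PosSemidef := by
  obtain ⟨D, hDc, hD⟩ := TopologicalSpace.exists_countable_dense (κ → ℂ)
  have key : ∀ w : κ → ℂ, ∀ᵐ x ∂ν, 0 ≤ ∑ i, ∑ j, star (w i) * w j * S x i j := by
    intro w
    set g : E d → ℂ := fun x => ∑ i, ∑ j, star (w i) * w j * S x i j with hg
    have hgi : Integrable g ν := integrable_finsetSum _ fun i _ => integrable_finsetSum _ fun j _ =>
      (h i j).1.const_mul _
    have hpos : ∀ B, MeasurableSet B → 0 ≤ ∫ x in B, g x ∂ν := by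
      intro B hB
      have h1 : ∫ x in B, g x ∂ν = ∑ i, ∑ j, star (w i) * w j * M i j B := by
        rw [integral_finsetSum _ fun i _ => integrable_finsetSum _ fun j _ =>
          ((h i j).1.const_mul _).integrableOn]
        refine Finset.sum_congr rfl fun i _ => ?_
        rw [integral_finsetSum _ fun j _ => ((h i j).1.const_mul _).integrableOn]
        refine Finset.sum_congr rfl fun j _ => ?_
        rw [integral_const_mul, h.setIntegral hB]
      have h2 := (hM B hB).dotProduct_mulVec_nonneg w
      rw [h1]
      convert h2 using 1
      simp only [dotProduct, Matrix.mulVec, Pi.star_apply, Finset.mul_sum, Matrix.of_apply]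
      exact Finset.sum_congr rfl fun i _ => Finset.sum_congr rfl fun j _ => by ring
    have h1 : 0 ≤ᵐ[ν] fun x => (g x).re := by
      refine ae_nonneg_of_forall_setIntegral_nonneg hgi.re fun B hB _ => ?_
      have := (Complex.nonneg_iff.1 (hpos B hB)).1
      rwa [← Complex.reCLM_apply, ← Complex.reCLM.integral_comp_comm hgi.integrableOn] at this
    have h2 : (fun x => (g x).im) =ᵐ[ν] 0 := by
      refine Integrable.ae_eq_zero_of_forall_setIntegral_eq_zero hgi.im fun B hB _ => ?_
      have := (Complex.nonneg_iff.1 (hpos B hB)).2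
      rw [← Complex.imCLM_apply, ← Complex.imCLM.integral_comp_comm hgi.integrableOn] at this
      exact this.symm
    filter_upwards [h1, h2] with x hx1 hx2
    exact Complex.nonneg_iff.2 ⟨hx1, hx2.symm⟩
  have hall : ∀ᵐ x ∂ν, ∀ w ∈ D, 0 ≤ ∑ i, ∑ j, star (w i) * w j * S x i j :=
    (ae_ball_iff hDc).2 fun w _ => key w
  filter_upwards [hall] with x hx
  refine Matrix.posSemidef_of_forall_zero_le fun w => ?_
  have hcl : IsClosed {w : κ → ℂ | 0 ≤ ∑ i, ∑ j, star (w i) * w j * S x i j} :=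
    isClosed_le continuous_const (by fun_prop)
  exact (hcl.closure_subset_iff.2 hx) (hD w)

/-- The image is an uncountable intersection of closed sets. By Lindelöf its complement is a
countable union of theirs, so the intersection still contains almost every range. -/
lemma IsRepresentation.ae_range_subset (h : IsRepresentation M ν S) {C : Set (κ → ℂ)}
    (hC : image M ⊆ C) : ∀ᵐ x ∂ν, Set.range (fun w : κ → ℂ => (S x).mulVec w) ⊆ C := by
  set 𝒜 : Set (Set (κ → ℂ)) := {A | IsClosed A ∧ ∀ ν S, IsRepresentation M ν S →
    ∀ᵐ x ∂ν, Set.range (fun w : κ → ℂ => (S x).mulVec w) ⊆ A} with h𝒜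
  obtain ⟨T, hTc, hT, hTU⟩ := TopologicalSpace.isOpen_sUnion_countable (compl '' 𝒜) (by
    rintro _ ⟨A, hA, rfl⟩; exact hA.1.isOpen_compl)
  have h1 : ∀ᵐ x ∂ν, ∀ B ∈ T, Set.range (fun w : κ → ℂ => (S x).mulVec w) ⊆ Bᶜ := by
    refine (ae_ball_iff hTc).2 fun B hB => ?_
    obtain ⟨A, hA, rfl⟩ := hT hB
    rw [compl_compl]
    exact hA.2 ν S h
  filter_upwards [h1] with x hx
  rintro z hz
  refine hC ?_
  by_contra hcon
  have : z ∈ ⋃₀ (compl '' 𝒜) := by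
    rw [← Set.compl_sInter]; exact hcon
  rw [← hTU] at this
  obtain ⟨B, hB, hzB⟩ := this
  exact hx B hB hz hzB

lemma exists_isRepresentation_not_ae {C : Set (κ → ℂ)} (hC : IsClosed C) (h : ¬ image M ⊆ C) :
    ∃ ν S, IsRepresentation M ν S ∧
      ¬ ∀ᵐ x ∂ν, Set.range (fun w : κ → ℂ => (S x).mulVec w) ⊆ C := by
  by_contra! hcon
  exact h (Set.sInter_subset_of_mem ⟨hC, hcon⟩)

/-- Representations require a finite measure, whereas Lebesgue measure is needed here. Replacing ν
by g ν and S by S/g, with g > 0 of finite integral, leaves the ranges unchanged. -/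
lemma HasDensity.ae_range_subset [SigmaFinite ν] (h : HasDensity M ν S) (hM : IsPositive M)
    {F : κ → κ → ℝ} (hC : image M ⊆ cone F) :
    ∀ᵐ x ∂ν, Set.range (fun w : κ → ℂ => (S x).mulVec w) ⊆ cone F := by
  obtain ⟨g, hg0, hgm, hgi⟩ := exists_pos_lintegral_lt_of_sigmaFinite ν one_ne_zero
  set ν' := ν.withDensity fun x => (g x : ℝ≥0∞)
  have hf : IsFiniteMeasure ν' := isFiniteMeasure_withDensity (hgi.trans ENNReal.one_lt_top).ne
  have hcancel : ∀ i j, (fun x => g x • (((g x)⁻¹ : NNReal) • S x i j)) = fun x => S x i j := fun i j => by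
    ext x
    rw [smul_smul, mul_inv_cancel₀ (hg0 x).ne', one_smul]
  have hd : HasDensity M ν' fun x => Matrix.of fun i j => ((g x)⁻¹ : NNReal) • S x i j := by
    intro i j
    have hi : Integrable (fun x => ((g x)⁻¹ : NNReal) • S x i j) ν' := by
      rw [integrable_withDensity_iff_integrable_smul hgm, hcancel]
      exact (h i j).1
    refine ⟨hi, ?_⟩
    change M i j = ν'.withDensityᵥ fun x => ((g x)⁻¹ : NNReal) • S x i j
    ext B hB
    rw [withDensityᵥ_apply hi hB, (h i j).2, withDensityᵥ_apply (h i j).1 hB,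
      setIntegral_withDensity_eq_setIntegral_smul hgm _ hB, hcancel]
  have hrep : IsRepresentation M ν' _ := ⟨hf, hd, hd.ae_posSemidef hM⟩
  have h1 := hrep.ae_range_subset hC
  rw [ae_withDensity_iff (by fun_prop)] at h1
  filter_upwards [h1] with x hx
  have hx := hx (by exact_mod_cast (hg0 x).ne')
  rintro _ ⟨w, rfl⟩
  convert hx ⟨(g x : ℂ) • w, rfl⟩ using 1
  ext i
  have : (g x : ℂ) ≠ 0 := by exact_mod_cast (hg0 x).ne'
  simp only [Matrix.mulVec, dotProduct, Matrix.of_apply, Pi.smul_apply, NNReal.smul_def,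
    Complex.real_smul, smul_eq_mul]
  refine Finset.sum_congr rfl fun j _ => ?_
  push_cast
  field_simp

end Image

/-! ### The chaos covariance as a trace form -/

section ChaosCovariance

variable {d n : ℕ} {η : Measure (E n)} {f : E n → ℝ} {q : ℕ}

/-- The coordinates of `f_{2q}`, seen as a bilinear form on `q`-tensors. -/
def coeffForm (η : Measure (E n)) (f : E n → ℝ) (q : ℕ) (I J : Fin q → Fin n) : ℝ :=
  chaosCoeff η f (2 * q) (Fin.append I J ∘ Fin.cast (two_mul q))

lemma append_comp_cast (I J : Fin q → Fin n) :
    Fin.append I J ∘ Fin.cast (two_mul q) =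
      Sum.elim I J ∘ (finSumFinEquiv.trans (finCongr (two_mul q).symm)).symm := by
  rw [Equiv.eq_comp_symm]
  funext x
  rcases x with x | x
  · exact Fin.append_left I J x
  · exact Fin.append_right I J x

/-- The 2q-form f_{2q} is symmetric in all its arguments. Indexing them by two copies of `Fin q`
yields both the exchange of the two halves and the permutations inside one half. -/
lemma coeffForm_congr (ρ : Equiv.Perm (Fin q ⊕ Fin q)) {I J I' J' : Fin q → Fin n}
    (h : Sum.elim I' J' = Sum.elim I J ∘ ρ) : coeffForm η f q I' J' = coeffForm η f q I J := by
  unfold coeffForm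
  rw [append_comp_cast, append_comp_cast, h]
  set e := finSumFinEquiv.trans (finCongr (two_mul q).symm)
  rw [← chaosCoeff_comp_perm f (2 * q) (e.permCongr ρ) (Sum.elim I J ∘ e.symm)]
  congr 1
  ext x
  simp [Equiv.permCongr_apply]

lemma coeffForm_comm (I J : Fin q → Fin n) : coeffForm η f q I J = coeffForm η f q J I :=
  coeffForm_congr (Equiv.sumComm _ _) (by ext x; rcases x with x | x <;> rfl)

lemma coeffForm_comp_left (σ : Equiv.Perm (Fin q)) (I J : Fin q → Fin n) :
    coeffForm η f q (I ∘ σ) J = coeffForm η f q I J :=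
  coeffForm_congr (Equiv.sumCongr σ (Equiv.refl _)) (by ext x; rcases x with x | x <;> rfl)

/-- The symmetrized `q`-th tensor power of a matrix. -/
def symPow (A : Matrix (Fin n) (Fin n) ℝ) (q : ℕ) : Matrix (Fin q → Fin n) (Fin q → Fin n) ℂ :=
  Matrix.of fun I J =>
    (q.factorial : ℂ)⁻¹ * ∑ σ : Equiv.Perm (Fin q), ∏ k, (A (I (σ k)) (J k) : ℂ)

/-- Contraction with a symmetric form does not see the symmetrization, so plain tensor powers may be
replaced by the Fourier transform of μ^{*q}. -/
lemma sum_coeffForm_mul_symPow (A : Matrix (Fin n) (Fin n) ℝ) (I' J : Fin q → Fin n) :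
    ∑ I, (coeffForm η f q I I' : ℂ) * symPow A q I J =
      ∑ I, (coeffForm η f q I I' : ℂ) * ∏ k, (A (I k) (J k) : ℂ) := by
  have hq : (q.factorial : ℂ) ≠ 0 := by exact_mod_cast q.factorial_ne_zero
  have h : ∀ σ : Equiv.Perm (Fin q), ∑ I, (coeffForm η f q I I' : ℂ) * ∏ k, (A (I (σ k)) (J k) : ℂ) =
      ∑ I, (coeffForm η f q I I' : ℂ) * ∏ k, (A (I k) (J k) : ℂ) := by
    intro σ
    refine Fintype.sum_equiv (Equiv.arrowCongr σ.symm (Equiv.refl _)) _ _ fun I => ?_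
    rw [← coeffForm_comp_left σ]
    rfl
  calc _ = (q.factorial : ℂ)⁻¹ * ∑ σ : Equiv.Perm (Fin q),
        ∑ I, (coeffForm η f q I I' : ℂ) * ∏ k, (A (I (σ k)) (J k) : ℂ) := by
        simp only [symPow, Matrix.of_apply, Finset.mul_sum]
        rw [Finset.sum_comm]
        exact Finset.sum_congr rfl fun σ _ => Finset.sum_congr rfl fun I _ => by ring
    _ = _ := by
        simp_rw [h]
        rw [Finset.sum_const, Finset.card_univ, Fintype.card_perm, Fintype.card_fin, nsmul_eq_mul,
          inv_mul_cancel_left₀ hq]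

lemma star_symPow (A : Matrix (Fin n) (Fin n) ℝ) (I J : Fin q → Fin n) :
    star (symPow A q I J) = symPow A q I J := by
  simp only [symPow, Matrix.of_apply, star_mul', star_inv₀, star_natCast, star_sum, star_prod,
    Complex.star_def, Complex.conj_ofReal]

/-- Each multi-index of length 2q is cut into two halves, so the product of 2q covariances becomes a
product of two q-fold ones. They are real, so one may be conjugated freely, which later produces the
phase x - y. -/
lemma tensorCov_chaosCoeff (K : E d → Matrix (Fin n) (Fin n) ℝ) (v : E d) :
    tensorCov K (fun I => (chaosCoeff η f (2 * q) I : ℂ)) v =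
      pairing (coeffForm η f q) (symPow (K v) q) (symPow (K v) q) := by
  let e := finSumFinEquiv.trans (finCongr (two_mul q).symm)
  let ε : (Fin q → Fin n) × (Fin q → Fin n) ≃ (Fin (2 * q) → Fin n) :=
    (Equiv.sumArrowEquivProdArrow _ _ _).symm.trans (Equiv.arrowCongr e (Equiv.refl _))
  have hε : ∀ I I', ε (I, I') = Sum.elim I I' ∘ e.symm := fun I I' => rfl
  have hco : ∀ I I', chaosCoeff η f (2 * q) (ε (I, I')) = coeffForm η f q I I' := fun I I' => by
    rw [hε, coeffForm, append_comp_cast]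
  have hprod : ∀ I I' J J', ∏ k, (K v (ε (I, I') k) (ε (J, J') k) : ℂ) =
      (∏ k, (K v (I k) (J k) : ℂ)) * ∏ k, (K v (I' k) (J' k) : ℂ) := by
    intro I I' J J'
    rw [← e.prod_comp, Fintype.prod_sum_type]
    simp [hε]
  have h1 : tensorCov K (fun I => (chaosCoeff η f (2 * q) I : ℂ)) v =
      ∑ I, ∑ I', ∑ J, ∑ J', (coeffForm η f q I I' : ℂ) * coeffForm η f q J J' *
        ((∏ k, (K v (I k) (J k) : ℂ)) * ∏ k, (K v (I' k) (J' k) : ℂ)) := by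
    unfold tensorCov
    rw [← ε.sum_comp, Fintype.sum_prod_type]
    refine Finset.sum_congr rfl fun I _ => Finset.sum_congr rfl fun I' _ => ?_
    rw [← ε.sum_comp, Fintype.sum_prod_type]
    refine Finset.sum_congr rfl fun J _ => Finset.sum_congr rfl fun J' _ => ?_
    beta_reduce
    rw [hprod, hco, hco, Complex.star_def, Complex.conj_ofReal]
  rw [h1, pairing]
  simp_rw [star_symPow]
  have h2 : ∀ (A B : (Fin q → Fin n) → (Fin q → Fin n) → ℂ),
      ∑ I, ∑ I', ∑ J, ∑ J', (coeffForm η f q I I' : ℂ) * coeffForm η f q J J' * (A I J * B I' J') =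
      ∑ J, ∑ J', (coeffForm η f q J J' : ℂ) * ∑ I', (∑ I, (coeffForm η f q I I' : ℂ) * A I J) * B I' J' := by
    intro A B
    have : ∀ I, ∑ I', ∑ J, ∑ J', (coeffForm η f q I I' : ℂ) * coeffForm η f q J J' * (A I J * B I' J') =
      ∑ J, ∑ J', ∑ I', (coeffForm η f q I I' : ℂ) * coeffForm η f q J J' * (A I J * B I' J') := fun I => by
        rw [Finset.sum_comm]
        exact Finset.sum_congr rfl fun J _ => Finset.sum_comm
    simp_rw [this]
    rw [Finset.sum_comm]
    refine Finset.sum_congr rfl fun J _ => ?_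
    rw [Finset.sum_comm]
    refine Finset.sum_congr rfl fun J' _ => ?_
    rw [Finset.sum_comm, Finset.mul_sum]
    refine Finset.sum_congr rfl fun I' _ => ?_
    rw [Finset.sum_mul, Finset.mul_sum]
    exact Finset.sum_congr rfl fun I _ => by ring
  have h3 : ∀ (A B : (Fin q → Fin n) → (Fin q → Fin n) → ℂ) (J J' : Fin q → Fin n),
      ∑ I', (∑ I, (coeffForm η f q I I' : ℂ) * A I J) * B I' J' =
      ∑ I, (∑ I', (coeffForm η f q I' I : ℂ) * B I' J') * A I J := by
    intro A B J J'
    simp_rw [Finset.sum_mul]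
    rw [Finset.sum_comm]
    refine Finset.sum_congr rfl fun I _ => Finset.sum_congr rfl fun I' _ => ?_
    rw [coeffForm_comm]; ring
  rw [h2 (fun I J => ∏ k, (K v (I k) (J k) : ℂ)) (fun I J => ∏ k, (K v (I k) (J k) : ℂ)),
    h2 (symPow (K v) q) (symPow (K v) q)]
  refine Finset.sum_congr rfl fun J _ => Finset.sum_congr rfl fun J' _ => ?_
  simp_rw [sum_coeffForm_mul_symPow]
  rw [h3 (fun I J => ∏ k, (K v (I k) (J k) : ℂ)) (fun I J => ∏ k, (K v (I k) (J k) : ℂ)),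
    h3 (fun I J => ∏ k, (K v (I k) (J k) : ℂ)) (symPow (K v) q)]
  simp_rw [sum_coeffForm_mul_symPow]

end ChaosCovariance

/-! ### Rescaled test functions in the spectral domain -/

section Variance

variable {d : ℕ}

lemma IsSecondOrder.const_mul {Ω : Type*} [MeasurableSpace Ω] {P : Measure Ω}
    {Y : E d → Ω → ℂ} {r : E d → ℂ} (hY : IsSecondOrder P Y r) (c : ℂ) :
    IsSecondOrder P (fun v ω => c * Y v ω) (fun v => c * star c * r v) := by
  refine ⟨hY.measurable.const_mul c, fun v => (hY.memLp v).const_mul c, fun u v => ?_⟩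
  rw [← hY.cov, ← integral_const_mul]
  congr with ω
  simp only [star_mul']
  ring

/-- A character of u - v factors into a character of u and a conjugate character of v, so after
Fubini the double integral in ψ is a squared modulus. -/
lemma integral_mul_integral_expo {π : Measure (E d × E d)} [SFinite π] {H : E d × E d → ℂ}
    (hH : Integrable H π) {ψ : E d → ℂ} (hψ : Integrable ψ) :
    ∫ z : E d × E d, ψ z.1 * star (ψ z.2) * (∫ x, expo (x.1 - x.2) (z.1 - z.2) * H x ∂π) =
      ∫ x, ((‖∫ u, ψ u * expo (x.1 - x.2) u‖ ^ 2 : ℝ) : ℂ) * H x ∂π := by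
  have hψ' : Integrable fun u => star (ψ u) :=
    (LinearIsometryEquiv.integrable_comp_iff Complex.conjLIE).2 hψ
  have h0 : Integrable (fun w : (E d × E d) × (E d × E d) =>
      ψ w.1.1 * star (ψ w.1.2) * H w.2) ((volume.prod volume).prod π) :=
    (hψ.mul_prod hψ').mul_prod hH
  have h1 : Integrable (fun w : (E d × E d) × (E d × E d) =>
      ψ w.1.1 * star (ψ w.1.2) * H w.2 * expo (w.2.1 - w.2.2) (w.1.1 - w.1.2))
        ((volume.prod volume).prod π) :=
    h0.mul_bdd (c := 1) (Continuous.aestronglyMeasurable (by fun_prop))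
      (ae_of_all _ fun _ => (norm_expo _ _).le)
  have h2 : Integrable (Function.uncurry fun (z x : E d × E d) =>
      ψ z.1 * star (ψ z.2) * (expo (x.1 - x.2) (z.1 - z.2) * H x)) ((volume.prod volume).prod π) :=
    h1.congr (ae_of_all _ fun w => by simp only [Function.uncurry]; ring)
  simp_rw [← integral_const_mul]
  rw [Measure.volume_eq_prod, integral_integral_swap h2]
  congr with x
  set t := x.1 - x.2
  calc ∫ z : E d × E d, ψ z.1 * star (ψ z.2) * (expo t (z.1 - z.2) * H x) ∂volume.prod volume
      = ∫ z : E d × E d, (ψ z.1 * expo t z.1) * star (ψ z.2 * expo t z.2) * H x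
          ∂volume.prod volume := by
        congr with z
        rw [expo_sub_right, star_mul']
        ring
    _ = (∫ u, ψ u * expo t u) * (∫ u, star (ψ u * expo t u)) * H x := by
        rw [integral_mul_const, integral_prod_mul (fun u => ψ u * expo t u)
          (fun u => star (ψ u * expo t u))]
    _ = _ := by
        have : ∫ u, star (ψ u * expo t u) = star (∫ u, ψ u * expo t u) := integral_conj
        rw [this, Complex.star_def, Complex.mul_conj, Complex.normSq_eq_norm_sq]

lemma integral_mul_expo_eq_fourier (ψ : E d → ℂ) (t : E d) :
    ∫ u, ψ u * expo t u = FourierTransform.fourier ψ (-t) := by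
  rw [Real.fourier_eq']
  congr with u
  rw [expo_eq, smul_eq_mul, mul_comm, inner_neg_right, real_inner_comm]
  congr 4
  ring

/-- The change of variables gives λ^d and the normalization λ^{-d/2}; their product squared is λ^d.
-/
lemma norm_integral_rescale_sq (φ : E d → ℝ) {lam : ℝ} (hl : 0 < lam) (x y : E d) :
    ‖∫ u, ((lam ^ (-(d : ℝ) / 2) * φ (lam⁻¹ • u) : ℝ) : ℂ) * expo (x - y) u‖ ^ 2 =
      lam ^ d * gam φ (lam • (y - x)) := by
  have h1 : ∀ u, ((lam ^ (-(d : ℝ) / 2) * φ (lam⁻¹ • u) : ℝ) : ℂ) * expo (x - y) u =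
      ((lam ^ (-(d : ℝ) / 2) : ℝ) : ℂ) *
        (fun w => (φ w : ℂ) * expo (lam • (x - y)) w) (lam⁻¹ • u) := by
    intro u
    have : expo (lam • (x - y)) (lam⁻¹ • u) = expo (x - y) u := by
      unfold expo
      rw [inner_smul_left, inner_smul_right]
      simp [hl.ne']
    simp only [this]
    push_cast
    ring
  simp_rw [h1]
  rw [integral_const_mul, Measure.integral_comp_inv_smul volume
    (fun w => (φ w : ℂ) * expo (lam • (x - y)) w) lam, integral_mul_expo_eq_fourier,
    finrank_euclideanSpace, Fintype.card_fin, abs_of_pos (by positivity), norm_mul, norm_smul,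
    Complex.norm_real, Real.norm_of_nonneg (by positivity), Real.norm_of_nonneg (by positivity),
    mul_pow, mul_pow, gam, ← smul_neg, neg_sub, ← mul_assoc]
  congr 1
  rw [← Real.rpow_natCast, ← Real.rpow_natCast, ← Real.rpow_natCast, ← Real.rpow_mul hl.le,
    ← Real.rpow_mul hl.le, ← Real.rpow_add hl]
  congr 1
  push_cast
  ring

end Variance

/-! ### The spectral formula for the variance -/

section ChaosVariance

variable {d n : ℕ} {Ω : Type*} [MeasurableSpace Ω] {P : Measure Ω} [IsProbabilityMeasure P]
  {X : E d → Ω → E n} {f : E n → ℝ} {φ : E d → ℝ}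

lemma IsStationaryGaussianField.isSecondOrder_chaosProj (hX : IsStationaryGaussianField P X)
    (f : E n → ℝ) (p : ℕ) :
    IsSecondOrder P (fun v ω => (chaosProj (P.map (X 0)) f p (X v ω) : ℂ))
      (fun v => (p.factorial : ℂ)⁻¹ *
        tensorCov (covFun P X) (fun I => (chaosCoeff (P.map (X 0)) f p I : ℂ)) v) := by
  have h := (hX.isSecondOrder_wickSum (g := fun I => (chaosCoeff (P.map (X 0)) f p I : ℂ))
    fun σ I => by rw [chaosCoeff_comp_perm]).const_mul (p.factorial : ℂ)⁻¹
  have hp : (p.factorial : ℂ) ≠ 0 := by exact_mod_cast p.factorial_ne_zero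
  convert h using 2
  · ext ω
    rw [chaosProj_eq_wickSum]
  · rw [star_inv₀, star_natCast]
    field_simp

lemma IsStationaryGaussianField.integral_chaosProj (hX : IsStationaryGaussianField P X)
    (f : E n → ℝ) {p : ℕ} (hp : p ≠ 0) (v : E d) :
    ∫ ω, (chaosProj (P.map (X 0)) f p (X v ω) : ℂ) ∂P = 0 := by
  simp_rw [chaosProj_eq_wickSum]
  rw [integral_const_mul, (hX.wickSum_spec _ fun σ I => by rw [chaosCoeff_comp_perm]).2.2.2 hp,
    mul_zero]

/-- The rescaled test function `λ^{-d/2} φ(v / λ)`. -/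
def rescale (φ : E d → ℝ) (lam : ℝ) (v : E d) : ℂ :=
  ((lam ^ (-(d : ℝ) / 2) * φ (lam⁻¹ • v) : ℝ) : ℂ)

lemma integrable_rescale (hφ : Integrable φ) {lam : ℝ} (hl : 0 < lam) :
    Integrable (rescale φ lam) :=
  ((hφ.comp_smul (inv_pos.2 hl).ne').const_mul _).ofReal

omit [IsProbabilityMeasure P] in
lemma chaosZ_eq (f : E n → ℝ) (φ : E d → ℝ) (p : ℕ) (lam : ℝ) (ω : Ω) :
    (chaosZ P X f φ p lam ω : ℂ) =
      ∫ v, rescale φ lam v * (chaosProj (P.map (X 0)) f p (X v ω) : ℂ) := by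
  rw [chaosZ, ← integral_const_mul, ← integral_complex_ofReal]
  congr with v
  simp only [rescale]
  push_cast
  ring

theorem IsStationaryGaussianField.ae_integrable_chaosProj (hX : IsStationaryGaussianField P X)
    (f : E n → ℝ) (p : ℕ) (hφ : Integrable φ) {lam : ℝ} (hl : 0 < lam) :
    ∀ᵐ ω ∂P, Integrable (fun v => φ (lam⁻¹ • v) * chaosProj (P.map (X 0)) f p (X v ω)) volume := by
  have hψ : Integrable fun v => (φ (lam⁻¹ • v) : ℂ) := (hφ.comp_smul (inv_pos.2 hl).ne').ofReal
  filter_upwards [((hX.isSecondOrder_chaosProj f p).integral_spec hψ).1] with ω h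
  refine h.re.congr (ae_of_all _ fun v => ?_)
  simp only [← Complex.ofReal_mul]
  exact Complex.ofReal_re _

theorem IsStationaryGaussianField.memLp_chaosZ (hX : IsStationaryGaussianField P X)
    (f : E n → ℝ) (p : ℕ) (hφ : Integrable φ) {lam : ℝ} (hl : 0 < lam) :
    MemLp (chaosZ P X f φ p lam) 2 P := by
  have h := ((hX.isSecondOrder_chaosProj f p).integral_spec (integrable_rescale hφ hl)).2.1.re
  simp_rw [← chaosZ_eq] at h
  exact h

theorem IsStationaryGaussianField.evariance_chaosZ (hX : IsStationaryGaussianField P X)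
    (f : E n → ℝ) {p : ℕ} (hp : p ≠ 0) (hφ : Integrable φ) {lam : ℝ} (hl : 0 < lam) :
    evariance (chaosZ P X f φ p lam) P = ENNReal.ofReal
      (∫ z : E d × E d, rescale φ lam z.1 * star (rescale φ lam z.2) * ((p.factorial : ℂ)⁻¹ *
        tensorCov (covFun P X) (fun I => (chaosCoeff (P.map (X 0)) f p I : ℂ)) (z.1 - z.2))).re := by
  have hY := hX.isSecondOrder_chaosProj f p
  have hψ := integrable_rescale hφ hl
  have hmem := hX.memLp_chaosZ f p hφ hl
  have h0 : ∫ ω, chaosZ P X f φ p lam ω ∂P = 0 := by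
    have := hY.integral_integral_eq_zero (hX.integral_chaosProj f hp) hψ
    simp_rw [← chaosZ_eq] at this
    rw [integral_complex_ofReal] at this
    exact_mod_cast this
  rw [← ofReal_variance hmem, variance_of_integral_eq_zero hmem.1.aemeasurable h0,
    ← (hY.integral_spec hψ).2.2]
  congr 1
  simp_rw [← chaosZ_eq, Complex.star_def, Complex.conj_ofReal, ← Complex.ofReal_mul]
  rw [integral_complex_ofReal, Complex.ofReal_re]
  simp_rw [sq]

lemma integrable_pairing {κ : Type} [Fintype κ] {M : MatrixMeasure d κ} {ν : Measure (E d)}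
    [SFinite ν] {S : E d → Matrix κ κ ℂ} (hM : HasDensity M ν S) (F : κ → κ → ℝ) :
    Integrable (fun x : E d × E d => pairing F (S x.1) (S x.2)) (ν.prod ν) := by
  unfold pairing
  refine integrable_finsetSum _ fun I _ => integrable_finsetSum _ fun I' _ =>
    integrable_finsetSum _ fun J _ => integrable_finsetSum _ fun J' _ => Integrable.const_mul ?_ _
  exact (hM I J).1.mul_prod (g := fun x => star (S x I' J'))
    ((LinearIsometryEquiv.integrable_comp_iff Complex.conjLIE).2 (hM I' J').1)

/-- The pairing is sesquilinear, so the second Fourier transform enters conjugated and the two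
phases combine at x - y. -/
lemma pairing_ft {κ : Type} [Fintype κ] {M : MatrixMeasure d κ} {ν : Measure (E d)}
    [SFinite ν] {S : E d → Matrix κ κ ℂ} (hM : HasDensity M ν S) (F : κ → κ → ℝ) (v : E d) :
    pairing F (Matrix.of fun I J => ft (M I J) v) (Matrix.of fun I J => ft (M I J) v) =
      ∫ x : E d × E d, expo (x.1 - x.2) v * pairing F (S x.1) (S x.2) ∂(ν.prod ν) := by
  have hi : ∀ I J, Integrable (fun x => expo x v * S x I J) ν := fun I J =>
    integrable_expo_mul (hM I J).1 v
  have hi2 : ∀ I J I' J', Integrable (fun x : E d × E d => (expo x.1 v * S x.1 I J) *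
      star (expo x.2 v * S x.2 I' J')) (ν.prod ν) := fun I J I' J' =>
    (hi I J).mul_prod (g := fun x => star (expo x v * S x I' J'))
      ((LinearIsometryEquiv.integrable_comp_iff Complex.conjLIE).2 (hi I' J'))
  have h1 : ∀ x : E d × E d, expo (x.1 - x.2) v * pairing F (S x.1) (S x.2) =
      ∑ I, ∑ I', ∑ J, ∑ J', (F I I' : ℂ) * F J J' * ((expo x.1 v * S x.1 I J) *
        star (expo x.2 v * S x.2 I' J')) := by
    intro x
    simp only [pairing, Finset.mul_sum, expo_sub_left, star_mul']
    refine Finset.sum_congr rfl fun I _ => Finset.sum_congr rfl fun I' _ =>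
      Finset.sum_congr rfl fun J _ => Finset.sum_congr rfl fun J' _ => by ring
  simp_rw [h1]
  rw [integral_finsetSum _ fun I _ => integrable_finsetSum _ fun I' _ =>
    integrable_finsetSum _ fun J _ => integrable_finsetSum _ fun J' _ => (hi2 I J I' J').const_mul _,
    pairing]
  refine Finset.sum_congr rfl fun I _ => ?_
  rw [integral_finsetSum _ fun I' _ =>
    integrable_finsetSum _ fun J _ => integrable_finsetSum _ fun J' _ => (hi2 I J I' J').const_mul _]
  refine Finset.sum_congr rfl fun I' _ => ?_
  rw [integral_finsetSum _ fun J _ => integrable_finsetSum _ fun J' _ => (hi2 I J I' J').const_mul _]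
  refine Finset.sum_congr rfl fun J _ => ?_
  rw [integral_finsetSum _ fun J' _ => (hi2 I J I' J').const_mul _]
  refine Finset.sum_congr rfl fun J' _ => ?_
  rw [integral_const_mul, integral_prod_mul (fun x => expo x v * S x I J)
    (fun x => star (expo x v * S x I' J'))]
  have : ∫ x, star (expo x v * S x I' J') ∂ν = star (∫ x, expo x v * S x I' J' ∂ν) := integral_conj
  simp only [Matrix.of_apply]
  rw [this, (hM I J).2, (hM I' J').2, ft_withDensity ν (hM I J).1, ft_withDensity ν (hM I' J').1]

lemma continuous_gam (hφ : Integrable φ) : Continuous (gam φ) := by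
  have := VectorFourier.fourierIntegral_continuous (L := innerₗ (E d)) Real.continuous_fourierChar
    (continuous_inner : Continuous fun p : E d × E d => (innerₗ (E d)) p.1 p.2) (hφ.ofReal (𝕜 := ℂ))
  unfold gam
  exact (this.norm).pow 2

lemma gam_nonneg (φ : E d → ℝ) (x : E d) : 0 ≤ gam φ x := by unfold gam; positivity

lemma gam_le (φ : E d → ℝ) (x : E d) : gam φ x ≤ (∫ v, |φ v|) ^ 2 := by
  unfold gam
  gcongr
  refine (VectorFourier.norm_fourierIntegral_le_integral_norm Real.fourierChar volume (innerₗ (E d)) _ x).trans_eq ?_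
  simp

/-- The spectral expression of the variance of a chaos of even order. -/
theorem IsStationaryGaussianField.evariance_chaosZ_eq (hX : IsStationaryGaussianField P X)
    (f : E n → ℝ) {q : ℕ} (hq : 1 ≤ q) (hφ : Integrable φ) {lam : ℝ} (hl : 0 < lam)
    {μ : MatrixMeasure d (Fin n)} (hμ : IsSpectralMeasure (covFun P X) μ) {ν : Measure (E d)}
    [SFinite ν] {S : E d → Matrix (Fin q → Fin n) (Fin q → Fin n) ℂ}
    (hM : HasDensity (convPow μ q) ν S) :
    evariance (chaosZ P X f φ (2 * q) lam) P = ENNReal.ofReal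
      (((2 * q).factorial : ℝ)⁻¹ * ∫ x : E d × E d, lam ^ d * gam φ (lam • (x.2 - x.1)) *
        (pairing (coeffForm (P.map (X 0)) f q) (S x.1) (S x.2)).re ∂(ν.prod ν)) := by
  set F := coeffForm (P.map (X 0)) f q
  have hH := integrable_pairing hM F
  rw [hX.evariance_chaosZ f (by omega) hφ hl]
  congr 1
  have h1 : ∀ v, tensorCov (covFun P X) (fun I => (chaosCoeff (P.map (X 0)) f (2 * q) I : ℂ)) v =
      ∫ x : E d × E d, expo (x.1 - x.2) v * pairing F (S x.1) (S x.2) ∂(ν.prod ν) := by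
    intro v
    rw [tensorCov_chaosCoeff, ← pairing_ft hM]
    have : symPow (covFun P X v) q = Matrix.of fun I J => ft (convPow μ q I J) v := by
      ext I J
      simp only [symPow, Matrix.of_apply, hμ.ft_convPow]
    rw [this]
  have h2 : ∀ z : E d × E d, rescale φ lam z.1 * star (rescale φ lam z.2) *
      (((2 * q).factorial : ℂ)⁻¹ * ∫ x : E d × E d, expo (x.1 - x.2) (z.1 - z.2) *
        pairing F (S x.1) (S x.2) ∂(ν.prod ν)) = ((2 * q).factorial : ℂ)⁻¹ *
      (rescale φ lam z.1 * star (rescale φ lam z.2) * ∫ x : E d × E d,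
        expo (x.1 - x.2) (z.1 - z.2) * pairing F (S x.1) (S x.2) ∂(ν.prod ν)) := fun z => by ring
  simp_rw [h1, h2]
  rw [integral_const_mul, integral_mul_integral_expo hH (integrable_rescale hφ hl)]
  simp only [rescale, norm_integral_rescale_sq φ hl]
  have h3 : ((2 * q).factorial : ℂ)⁻¹ = ((((2 * q).factorial : ℝ)⁻¹ : ℝ) : ℂ) := by push_cast; rfl
  rw [h3, Complex.re_ofReal_mul]
  congr 1
  have hi : Integrable (fun x : E d × E d => ((lam ^ d * gam φ (lam • (x.2 - x.1)) : ℝ) : ℂ) *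
      pairing F (S x.1) (S x.2)) (ν.prod ν) := by
    refine hH.bdd_mul (c := lam ^ d * (∫ v, |φ v|) ^ 2) ?_ (ae_of_all _ fun x => ?_)
    · have := continuous_gam hφ
      exact Continuous.aestronglyMeasurable (by fun_prop)
    · rw [Complex.norm_real, Real.norm_of_nonneg (mul_nonneg (by positivity) (gam_nonneg _ _))]
      gcongr
      exact gam_le _ _
  rw [← Complex.reCLM_apply, ← Complex.reCLM.integral_comp_comm hi]
  simp only [Complex.reCLM_apply, Complex.re_ofReal_mul]

end ChaosVariance

/-! ### Mass of a product measure near the diagonal -/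

section NearDiagonal

variable {d : ℕ}

lemma sq_lintegral_le {α : Type*} [MeasurableSpace α] (μ : Measure α) {f : α → ℝ≥0∞}
    (hf : Measurable f) {B : Set α} (hB : MeasurableSet B) (h0 : ∀ x ∉ B, f x = 0) :
    (∫⁻ x, f x ∂μ) ^ 2 ≤ μ B * ∫⁻ x, f x ^ 2 ∂μ := by
  have h1 := ENNReal.lintegral_mul_le_Lp_mul_Lq μ Real.HolderConjugate.two_two
    (f := B.indicator (1 : α → ℝ≥0∞)) (g := f)
    (by fun_prop (disch := assumption)) hf.aemeasurable
  have e1 : ∫⁻ x, (B.indicator (1 : α → ℝ≥0∞) * f) x ∂μ = ∫⁻ x, f x ∂μ := by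
    refine lintegral_congr fun x => ?_
    by_cases hx : x ∈ B <;> simp [hx, h0]
  have e2 : ∫⁻ x, (B.indicator 1 x : ℝ≥0∞) ^ (2 : ℝ) ∂μ = μ B := by
    rw [← lintegral_indicator_one hB]
    refine lintegral_congr fun x => ?_
    by_cases hx : x ∈ B <;> simp [hx]
  rw [e1, e2] at h1
  calc (∫⁻ x, f x ∂μ) ^ 2 ≤ (μ B ^ (1 / 2 : ℝ) * (∫⁻ x, f x ^ (2 : ℝ) ∂μ) ^ (1 / 2 : ℝ)) ^ 2 := by
        gcongr
    _ = _ := by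
        rw [mul_pow, ← ENNReal.rpow_natCast, ← ENNReal.rpow_natCast, ← ENNReal.rpow_mul,
          ← ENNReal.rpow_mul]
        norm_num

/-- A finite measure carried by a bounded set charges the neighborhoods of the diagonal at least
as much as the Lebesgue measure. -/
lemma measure_prod_dist_lt (κ : Measure (E d)) [IsFiniteMeasure κ] {R δ : ℝ} (hδ : 0 < δ)
    (hR : κ (Metric.ball 0 R)ᶜ = 0) :
    volume (Metric.ball (0 : E d) (δ / 2)) * κ Set.univ ^ 2 ≤
      volume (Metric.ball (0 : E d) (R + δ)) * (κ.prod κ) {p | dist p.1 p.2 < δ} := by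
  set V := volume (Metric.ball (0 : E d) (δ / 2)) with hV
  have hV0 : V ≠ 0 := (Metric.measure_ball_pos _ _ (by positivity)).ne'
  have hVt : V ≠ ⊤ := measure_ball_lt_top.ne
  have hball : ∀ x : E d, volume (Metric.ball x (δ / 2)) = V := fun x =>
    Measure.addHaar_ball_center _ x _
  have hA : MeasurableSet {p : E d × E d | dist p.2 p.1 < δ / 2} :=
    measurableSet_lt (by fun_prop) measurable_const
  have hA2 : MeasurableSet {p : E d × E d × E d | dist p.2.1 p.1 < δ / 2 ∧ dist p.2.2 p.1 < δ / 2} :=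
    MeasurableSet.inter (s₁ := {p : E d × E d × E d | dist p.2.1 p.1 < δ / 2})
      (s₂ := {p : E d × E d × E d | dist p.2.2 p.1 < δ / 2})
      (measurableSet_lt (by fun_prop) measurable_const)
      (measurableSet_lt (by fun_prop) measurable_const)
  have hgm : Measurable fun z => κ (Metric.ball z (δ / 2)) := measurable_measure_prodMk_left hA
  -- Fubini. The second moment below counts pairs of points in a common ball of radius δ/2, hence at
  -- distance less than δ, and Cauchy–Schwarz compares the two moments.
  have e1 : ∫⁻ z, κ (Metric.ball z (δ / 2)) = V * κ Set.univ := by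
    have h1 := Measure.prod_apply (μ := (volume : Measure (E d))) (ν := κ) hA
    have h2 := Measure.prod_apply_symm (μ := (volume : Measure (E d))) (ν := κ) hA
    have h3 : ∀ x : E d, volume ((fun z => (z, x)) ⁻¹' {p : E d × E d | dist p.2 p.1 < δ / 2}) = V := by
      intro x
      rw [← hball x]
      congr 1
      ext z
      simp [dist_comm]
    simp_rw [h3] at h2
    rw [lintegral_const] at h2
    rw [← h2, h1]
    rfl
  have e2 : ∫⁻ z, κ (Metric.ball z (δ / 2)) ^ 2 ≤ V * (κ.prod κ) {p | dist p.1 p.2 < δ} := by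
    have h1 := Measure.prod_apply (μ := (volume : Measure (E d))) (ν := κ.prod κ) hA2
    have h2 := Measure.prod_apply_symm (μ := (volume : Measure (E d))) (ν := κ.prod κ) hA2
    have h3 : ∀ z : E d, (κ.prod κ) (Prod.mk z ⁻¹'
        {p : E d × E d × E d | dist p.2.1 p.1 < δ / 2 ∧ dist p.2.2 p.1 < δ / 2}) =
          κ (Metric.ball z (δ / 2)) ^ 2 := by
      intro z
      rw [sq, ← Measure.prod_prod]
      rfl
    simp_rw [h3] at h1
    rw [← h1, h2]
    have hD : MeasurableSet {p : E d × E d | dist p.1 p.2 < δ} :=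
      measurableSet_lt (by fun_prop) measurable_const
    rw [← lintegral_indicator_one hD, ← lintegral_const_mul _ (by fun_prop (disch := assumption))]
    refine lintegral_mono fun p => ?_
    by_cases hp : dist p.1 p.2 < δ
    · rw [Set.indicator_of_mem (by exact hp), Pi.one_apply, mul_one, ← hball p.1]
      refine measure_mono fun z hz => ?_
      rw [Metric.mem_ball, dist_comm]
      exact hz.1
    · have : (fun z => (z, p)) ⁻¹'
          {p : E d × E d × E d | dist p.2.1 p.1 < δ / 2 ∧ dist p.2.2 p.1 < δ / 2} = ∅ := by
        ext z
        simp only [Set.mem_preimage, Set.mem_ofPred_eq, Set.mem_empty_iff_false, iff_false]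
        rintro ⟨h1, h2⟩
        refine hp ((dist_triangle_right p.1 p.2 z).trans_lt (by linarith))
      rw [this]
      simp
  have h0 : ∀ z ∉ Metric.ball (0 : E d) (R + δ), κ (Metric.ball z (δ / 2)) = 0 := by
    intro z hz
    refine measure_mono_null (fun x hx => ?_) hR
    rw [Set.mem_compl_iff, Metric.mem_ball, not_lt]
    rw [Metric.mem_ball, not_lt] at hz
    rw [Metric.mem_ball] at hx
    linarith [dist_triangle_left z 0 x]
  have h1 := sq_lintegral_le volume hgm Metric.isOpen_ball.measurableSet h0
  rw [e1] at h1
  have h2 : V * (V * κ Set.univ ^ 2) ≤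
      V * (volume (Metric.ball (0 : E d) (R + δ)) * (κ.prod κ) {p | dist p.1 p.2 < δ}) :=
    calc _ = (V * κ Set.univ) ^ 2 := by ring
      _ ≤ _ := h1
      _ ≤ volume (Metric.ball (0 : E d) (R + δ)) *
          (V * (κ.prod κ) {p | dist p.1 p.2 < δ}) := by gcongr
      _ = _ := by ring
  exact (ENNReal.mul_le_mul_iff_right hV0 hVt).1 h2

end NearDiagonal

/-! ### Lower bound for a non-isotropic image -/

section LowerBound

variable {d : ℕ} {κ : Type} [Fintype κ] {F : κ → κ → ℝ}

lemma continuous_pairing (F : κ → κ → ℝ) :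
    Continuous fun p : Matrix κ κ ℂ × Matrix κ κ ℂ => pairing F p.1 p.2 := by
  unfold pairing
  fun_prop

/-- A density whose range is not isotropic pairs positively with itself on a set of positive
measure. -/
lemma exists_pairing_pos (hF : ∀ I J, F I J = F J I) {M : MatrixMeasure d κ} {ν : Measure (E d)}
    {S : E d → Matrix κ κ ℂ} (h : IsRepresentation M ν S)
    (hne : ¬ ∀ᵐ x ∂ν, Set.range (fun w : κ → ℂ => (S x).mulVec w) ⊆ cone F) :
    ∃ K : Set (E d), MeasurableSet K ∧ ν K ≠ 0 ∧ (∃ R, K ⊆ Metric.ball 0 R) ∧ ∃ c > 0,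
      ∃ S' : E d → Matrix κ κ ℂ, S' =ᵐ[ν] S ∧
        ∀ x ∈ K, ∀ y ∈ K, c ≤ (pairing F (S' x) (S' y)).re := by
  classical
  -- By continuity, every matrix with positive self-pairing has a neighborhood U on which all pairs
  -- have pairing at least c. Lindelöf extracts countably many such U, and one of them must be
  -- visited with positive measure.
  set 𝒰 : Set (Set (κ → κ → ℂ)) :=
    {U | IsOpen U ∧ ∃ c > 0, ∀ A ∈ U, ∀ B ∈ U, c ≤ (pairing F A B).re} with h𝒰
  have hcover : ∀ A : κ → κ → ℂ, 0 < (pairing F A A).re → A ∈ ⋃₀ 𝒰 := by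
    intro A hA
    have hc : Continuous fun p : (κ → κ → ℂ) × (κ → κ → ℂ) => (pairing F p.1 p.2).re :=
      Complex.continuous_re.comp (continuous_pairing F)
    have hev := (hc.tendsto (A, A)).eventually (lt_mem_nhds (half_lt_self hA))
    rw [nhds_prod_eq] at hev
    obtain ⟨U, hU, hUU⟩ := (Filter.eventually_prod_self_iff
      (r := fun B C => (pairing F A A).re / 2 < (pairing F B C).re)).1 hev
    obtain ⟨W, hWU, hWo, hAW⟩ := mem_nhds_iff.1 hU
    exact ⟨W, ⟨hWo, _, half_pos hA, fun B hB C hC => (hUU _ (hWU hB) _ (hWU hC)).le⟩, hAW⟩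
  obtain ⟨T, hTc, hT, hTU⟩ := TopologicalSpace.isOpen_sUnion_countable 𝒰 fun U hU => hU.1
  let T₀ : E d → κ → κ → ℂ := fun x => S x
  have hSm : AEMeasurable T₀ ν :=
    aemeasurable_pi_iff.2 fun i => aemeasurable_pi_iff.2 fun j => (h.density i j).1.1.aemeasurable
  -- S is only almost everywhere measurable; the measurable version makes the set K measurable.
  set S' : E d → κ → κ → ℂ := hSm.mk _ with hS'
  have hS'm : Measurable S' := hSm.measurable_mk
  have hSS : S' =ᵐ[ν] T₀ := hSm.ae_eq_mk.symm
  obtain ⟨U, hU, hνU⟩ : ∃ U ∈ T, ν (S' ⁻¹' U) ≠ 0 := by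
    by_contra! hcon
    apply hne
    have h1 : ∀ᵐ x ∂ν, ∀ U ∈ T, S' x ∉ U := (ae_ball_iff hTc).2 fun U hU => by
      rw [ae_iff]; simp only [not_not]; exact hcon U hU
    filter_upwards [h1, hSS, h.posSemidef] with x hx hx' hpsd
    rw [← pairing_self_eq_zero_iff hF hpsd]
    have h2 := pairing_nonneg hF hpsd hpsd
    obtain ⟨h3, h4⟩ := Complex.nonneg_iff.1 h2
    refine Complex.ext (le_antisymm (not_lt.1 fun h5 => ?_) h3) h4.symm
    have h6 := hcover (S x) h5
    rw [← hTU] at h6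
    obtain ⟨U, hU, hxU⟩ := h6
    exact hx U hU (by rw [hx']; exact hxU)
  obtain ⟨hUo, c, hc, hcU⟩ := hT hU
  obtain ⟨N, hN⟩ : ∃ N : ℕ, ν (S' ⁻¹' U ∩ Metric.ball 0 N) ≠ 0 := by
    by_contra! hcon
    apply hνU
    have : S' ⁻¹' U = ⋃ N : ℕ, S' ⁻¹' U ∩ Metric.ball 0 N := by
      rw [← Set.inter_iUnion, Metric.iUnion_ball_nat, Set.inter_univ]
    rw [this]
    exact measure_iUnion_null hcon
  exact ⟨_, (hS'm hUo.measurableSet).inter Metric.isOpen_ball.measurableSet, hN,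
    ⟨N, Set.inter_subset_right⟩, c, hc, S', hSS, fun x hx y hy => hcU _ hx.1 _ hy.1⟩

lemma integrable_gam_mul_pairing {φ : E d → ℝ} (hφ : Integrable φ) {M : MatrixMeasure d κ}
    {ν : Measure (E d)} [SFinite ν] {S : E d → Matrix κ κ ℂ} (hM : HasDensity M ν S)
    (F : κ → κ → ℝ) (lam : ℝ) :
    Integrable (fun x : E d × E d => lam ^ d * gam φ (lam • (x.2 - x.1)) *
      (pairing F (S x.1) (S x.2)).re) (ν.prod ν) := by
  refine (integrable_pairing hM F).re.bdd_mul (c := |lam| ^ d * (∫ v, |φ v|) ^ 2) ?_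
    (ae_of_all _ fun x => ?_)
  · have := continuous_gam hφ
    exact Continuous.aestronglyMeasurable (by fun_prop)
  · rw [norm_mul, norm_pow, Real.norm_eq_abs, Real.norm_of_nonneg (gam_nonneg _ _)]
    gcongr
    exact gam_le _ _

lemma exists_pos_le_gam {φ : E d → ℝ} (hφ : Integrable φ) (h0 : ∫ v, φ v ≠ 0) :
    ∃ c > 0, ∃ ε > 0, ∀ x, ‖x‖ < ε → c ≤ gam φ x := by
  have h1 : 0 < gam φ 0 := by
    have : FourierTransform.fourier (fun v => (φ v : ℂ)) (0 : E d) = ((∫ v, φ v : ℝ) : ℂ) := by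
      rw [Real.fourier_eq', ← integral_complex_ofReal]
      simp
    rw [gam, this, Complex.norm_real]
    positivity
  have h2 := ((continuous_gam hφ).tendsto 0).eventually (lt_mem_nhds (half_lt_self h1))
  obtain ⟨ε, hε, h⟩ := Metric.eventually_nhds_iff.1 h2
  exact ⟨_, half_pos h1, ε, hε, fun x hx => (h (by simpa using hx)).le⟩

/-- The integrand is nonnegative, so only the pairs in K × K at distance less than ε/λ are kept.
There γ is at least c₀ and the pairing at least c, while λ^d times their mass is bounded below. -/
theorem exists_pos_le_integral (hF : ∀ I J, F I J = F J I) {M : MatrixMeasure d κ}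
    {ν : Measure (E d)} {S : E d → Matrix κ κ ℂ} (h : IsRepresentation M ν S)
    (hne : ¬ ∀ᵐ x ∂ν, Set.range (fun w : κ → ℂ => (S x).mulVec w) ⊆ cone F)
    {φ : E d → ℝ} (hφ : Integrable φ) (h0 : ∫ v, φ v ≠ 0) :
    ∃ c > 0, ∀ᶠ lam : ℝ in atTop, c ≤ ∫ x : E d × E d, lam ^ d * gam φ (lam • (x.2 - x.1)) *
        (pairing F (S x.1) (S x.2)).re ∂(ν.prod ν) := by
  have := h.finite
  obtain ⟨K, hK, hνK, ⟨R, hKR⟩, c, hc, S', hSS, hcK⟩ := exists_pairing_pos hF h hne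
  obtain ⟨c₀, hc₀, ε, hε, hγ⟩ := exists_pos_le_gam hφ h0
  set V := volume (Metric.ball (0 : E d) 1) with hV
  have hV0 : 0 < V.toReal := ENNReal.toReal_pos (Metric.measure_ball_pos _ _ one_pos).ne'
    measure_ball_lt_top.ne
  -- For λ ≥ ε the enlarged radius |R| + ε/λ is at most |R| + 1, so W is uniform in λ.
  set W := (volume (Metric.ball (0 : E d) (|R| + 1))).toReal with hW
  have hW0 : 0 < W := ENNReal.toReal_pos (Metric.measure_ball_pos _ _ (by positivity)).ne'
    measure_ball_lt_top.ne
  have hk : 0 < ν.real K := ENNReal.toReal_pos hνK (measure_ne_top _ _)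
  refine ⟨c₀ * c * ((ε / 2) ^ d * V.toReal * ν.real K ^ 2 / W), by positivity, ?_⟩
  filter_upwards [eventually_ge_atTop ε, eventually_gt_atTop 0] with lam hl1 hl
  have hδ : 0 < ε / lam := by positivity
  have hδ1 : ε / lam ≤ 1 := (div_le_one hl).2 hl1
  set A : Set (E d × E d) := {p | dist p.1 p.2 < ε / lam} with hA
  have hAm : MeasurableSet A := measurableSet_lt (by fun_prop) measurable_const
  have hmeas : (ε / 2) ^ d * V.toReal * ν.real K ^ 2 / W ≤
      lam ^ d * (ν.prod ν).real (A ∩ K ×ˢ K) := by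
    have h1 := measure_prod_dist_lt (ν.restrict K) (R := |R|) hδ (by
      rw [Measure.restrict_apply Metric.isOpen_ball.measurableSet.compl]
      convert measure_empty (μ := ν)
      ext x
      simp only [Set.mem_inter_iff, Set.mem_compl_iff, Set.mem_empty_iff_false, iff_false, not_and]
      intro hx hxK
      exact hx (Metric.ball_subset_ball (le_abs_self R) (hKR hxK)))
    rw [Measure.restrict_apply_univ, Measure.prod_restrict, Measure.restrict_apply hAm,
      Measure.addHaar_ball_of_pos _ _ (by positivity), finrank_euclideanSpace, Fintype.card_fin] at h1
    have h2 := ENNReal.toReal_mono (ENNReal.mul_ne_top (measure_ball_lt_top.ne) (measure_ne_top _ _)) h1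
    rw [ENNReal.toReal_mul, ENNReal.toReal_mul, ENNReal.toReal_mul, ENNReal.toReal_ofReal (by positivity),
      ENNReal.toReal_pow] at h2
    have h3 : (volume (Metric.ball (0 : E d) (|R| + ε / lam))).toReal ≤ W :=
      ENNReal.toReal_mono measure_ball_lt_top.ne (measure_mono (Metric.ball_subset_ball (by linarith)))
    rw [div_le_iff₀ hW0]
    have h4 : (ε / lam / 2) ^ d * lam ^ d = (ε / 2) ^ d := by
      rw [← mul_pow]; congr 1; field_simp
    calc (ε / 2) ^ d * V.toReal * ν.real K ^ 2
        = lam ^ d * ((ε / lam / 2) ^ d * V.toReal * (ν K).toReal ^ 2) := by rw [← h4, measureReal_def]; ring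
      _ ≤ lam ^ d * ((volume (Metric.ball (0 : E d) (|R| + ε / lam))).toReal *
          (ν.prod ν).real (A ∩ K ×ˢ K)) := mul_le_mul_of_nonneg_left h2 (by positivity)
      _ ≤ lam ^ d * (W * (ν.prod ν).real (A ∩ K ×ˢ K)) := by gcongr
      _ = _ := by ring
  have hSS1 : ∀ᵐ x ∂(ν.prod ν), S' x.1 = S x.1 := Measure.quasiMeasurePreserving_fst.ae hSS
  have hSS2 : ∀ᵐ x ∂(ν.prod ν), S' x.2 = S x.2 := Measure.quasiMeasurePreserving_snd.ae hSS
  have hp1 : ∀ᵐ x ∂(ν.prod ν), (S x.1).PosSemidef := Measure.quasiMeasurePreserving_fst.ae h.posSemidef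
  have hp2 : ∀ᵐ x ∂(ν.prod ν), (S x.2).PosSemidef := Measure.quasiMeasurePreserving_snd.ae h.posSemidef
  have hmA : MeasurableSet (A ∩ K ×ˢ K) := hAm.inter (hK.prod hK)
  calc c₀ * c * ((ε / 2) ^ d * V.toReal * ν.real K ^ 2 / W)
      ≤ c₀ * c * (lam ^ d * (ν.prod ν).real (A ∩ K ×ˢ K)) := by gcongr
    _ = ∫ x, (A ∩ K ×ˢ K).indicator (fun _ => lam ^ d * c₀ * c) x ∂(ν.prod ν) := by
        rw [integral_indicator_const _ hmA, smul_eq_mul]; ring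
    _ ≤ _ := by
        refine integral_mono_ae ((integrable_const _).indicator hmA)
          (integrable_gam_mul_pairing hφ h.density F lam) ?_
        filter_upwards [hSS1, hSS2, hp1, hp2] with x h1 h2 h3 h4
        have hpos : 0 ≤ (pairing F (S x.1) (S x.2)).re := (Complex.nonneg_iff.1 (pairing_nonneg hF h3 h4)).1
        by_cases hx : x ∈ A ∩ K ×ˢ K
        · rw [Set.indicator_of_mem hx]
          have hg : c₀ ≤ gam φ (lam • (x.2 - x.1)) := by
            refine hγ _ ?_
            rw [norm_smul, Real.norm_of_nonneg hl.le, ← dist_eq_norm, dist_comm, mul_comm]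
            exact (lt_div_iff₀ hl).1 hx.1
          have hh : c ≤ (pairing F (S x.1) (S x.2)).re := by
            rw [← h1, ← h2]; exact hcK _ hx.2.1 _ hx.2.2
          have := gam_nonneg φ (lam • (x.2 - x.1))
          gcongr
        · rw [Set.indicator_of_notMem hx]
          exact mul_nonneg (mul_nonneg (by positivity) (gam_nonneg _ _)) hpos

end LowerBound

/-! ### Square integrable densities and continuity of translations -/

section SquareIntegrable

variable {d : ℕ}

open FourierTransform in
-- Equality, as tempered distributions, of s dκ with the L² Fourier transform of its own transform
-- G: write ψ as the inverse transform of 𝓕 ψ and apply Fubini.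
lemma integral_schwartz_mul_withDensity {κ : Measure (E d)} [IsFiniteMeasure κ] {s : E d → ℂ}
    (hs : Integrable s κ) (G : Lp (α := E d) ℂ 2)
    (hG : (fun v => ∫ ξ, expo ξ v * s ξ ∂κ) =ᵐ[volume] G) (ψ : SchwartzMap (E d) ℂ) :
    ∫ ξ, ψ ξ * s ξ ∂κ = ∫ x, ψ x * (𝓕 G : Lp (α := E d) ℂ 2) x := by
  have h1 := congrArg (fun T => T ψ) (Lp.fourier_toTemperedDistribution_eq G)
  simp only [TemperedDistribution.fourier_apply, Lp.toTemperedDistribution_apply, smul_eq_mul] at h1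
  rw [← h1]
  have hinv : ∀ ξ, ∫ v, (𝓕 ψ) v * expo ξ v = ψ ξ := by
    intro ξ
    have h2 : (𝓕⁻ (𝓕 ψ)) ξ = ψ ξ := by rw [fourierInv_fourier_eq]
    rw [SchwartzMap.fourierInv_coe, Real.fourierInv_eq'] at h2
    rw [← h2]
    congr with v
    rw [expo_eq, smul_eq_mul, mul_comm, real_inner_comm]
  have hint : Integrable (Function.uncurry fun v ξ => (𝓕 ψ) v * (expo ξ v * s ξ))
      ((volume : Measure (E d)).prod κ) := by
    have h3 : Integrable (fun z : E d × E d => (𝓕 ψ) z.1 * s z.2 * expo z.2 z.1)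
        ((volume : Measure (E d)).prod κ) :=
      ((𝓕 ψ).integrable.mul_prod hs).mul_bdd (c := 1)
        (Continuous.aestronglyMeasurable (by fun_prop)) (ae_of_all _ fun _ => (norm_expo _ _).le)
    exact h3.congr (ae_of_all _ fun z => by simp only [Function.uncurry]; ring)
  have key : ∫ ξ, ψ ξ * s ξ ∂κ = ∫ v, (𝓕 ψ) v * G v := calc
    ∫ ξ, ψ ξ * s ξ ∂κ = ∫ ξ, (∫ v, (𝓕 ψ) v * (expo ξ v * s ξ)) ∂κ := by
        congr with ξ
        rw [← hinv, ← integral_mul_const]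
        congr with v
        ring
    _ = ∫ v, (∫ ξ, (𝓕 ψ) v * (expo ξ v * s ξ) ∂κ) := (integral_integral_swap hint).symm
    _ = ∫ v, (𝓕 ψ) v * G v := by
        refine integral_congr_ae ?_
        filter_upwards [hG] with v hv
        rw [integral_const_mul, ← hv]
  exact key

/-- A complex measure with square integrable Fourier transform has a density in `L¹ ∩ L²`. -/
theorem exists_density_of_memLp_ft (c : ComplexMeasure (E d)) (hc : MemLp (ft c) 2 volume) :
    ∃ s : E d → ℂ, Integrable s ∧ MemLp s 2 ∧ c = (volume : Measure (E d)).withDensityᵥ s := by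
  obtain ⟨κ, s₀, hκ, hs₀⟩ := exists_common_density fun _ : Unit => c
  obtain ⟨-, hs₀i, hs₀c⟩ := hs₀ ()
  set s := s₀ ()
  set G : Lp (α := E d) ℂ 2 := hc.toLp with hGdef
  have hG : (fun v => ∫ ξ, expo ξ v * s ξ ∂κ) =ᵐ[volume] G := by
    filter_upwards [hc.coeFn_toLp] with v hv
    rw [hGdef, hv, hs₀c, ft_withDensity κ hs₀i]
  set g : Lp (α := E d) ℂ 2 := FourierTransform.fourier G
  have hg2 : MemLp (g : E d → ℂ) 2 volume := Lp.memLp g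
  -- s dκ and g dx live over unrelated measures. Their densities over the sum κ' are locally
  -- integrable and agree against test functions, hence almost everywhere.
  set κ' : Measure (E d) := κ + volume with hκ'
  have hac1 : κ ≪ κ' := Measure.absolutelyContinuous_of_le (Measure.le_add_right le_rfl)
  have hac2 : (volume : Measure (E d)) ≪ κ' :=
    Measure.absolutelyContinuous_of_le (Measure.le_add_left le_rfl)
  have hlf : IsLocallyFiniteMeasure κ' := ⟨fun x => ⟨Metric.ball x 1, Metric.ball_mem_nhds _ one_pos, by
    rw [hκ', Measure.add_apply]
    exact ENNReal.add_lt_top.2 ⟨measure_lt_top _ _, measure_ball_lt_top⟩⟩⟩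
  have hsf : SigmaFinite κ' := inferInstanceAs (SigmaFinite (κ + volume))
  set u : E d → ℂ := fun x => (κ.rnDeriv κ' x).toReal • s x with hu
  set w : E d → ℂ := fun x => ((volume : Measure (E d)).rnDeriv κ' x).toReal • g x with hw
  have hui : Integrable u κ' := (integrable_rnDeriv_smul_iff hac1).2 hs₀i
  have hwl : LocallyIntegrable w κ' := by
    rw [locallyIntegrable_iff]
    intro K hK
    have h1 : Integrable (K.indicator g) volume := by
      rw [integrable_indicator_iff hK.measurableSet]
      have : IsFiniteMeasure ((volume : Measure (E d)).restrict K) :=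
        ⟨by rw [Measure.restrict_apply_univ]; exact hK.measure_lt_top⟩
      exact (hg2.restrict K).integrable one_le_two
    have h2 := (integrable_rnDeriv_smul_iff hac2).2 h1
    rw [← integrable_indicator_iff hK.measurableSet]
    refine h2.congr (ae_of_all _ fun x => ?_)
    by_cases hx : x ∈ K <;> simp [hx, hw]
  have hae : ∀ᵐ x ∂κ', u x = w x := by
    refine ae_eq_of_integral_contDiff_smul_eq hui.locallyIntegrable hwl fun θ hθ hθc => ?_
    have hθc' : HasCompactSupport fun x => (θ x : ℂ) := hθc.comp_left (g := Complex.ofReal) rfl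
    have hθ' : ContDiff ℝ ((⊤ : ℕ∞) : WithTop ℕ∞) fun x => (θ x : ℂ) := Complex.ofRealCLM.contDiff.comp hθ
    have h := integral_schwartz_mul_withDensity hs₀i G hG (hθc'.toSchwartzMap hθ')
    have e1 : ∫ x, θ x • u x ∂κ' = ∫ x, (θ x : ℂ) * s x ∂κ := by
      rw [← integral_rnDeriv_smul hac1]
      congr with x
      rw [hu, smul_comm, Complex.real_smul (x := θ x)]
    have e2 : ∫ x, θ x • w x ∂κ' = ∫ x, (θ x : ℂ) * g x := by
      rw [← integral_rnDeriv_smul hac2]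
      congr with x
      rw [hw, smul_comm, Complex.real_smul (x := θ x)]
    rw [e1, e2]
    exact h
  -- A priori g is only in L²; its integrability is inherited from s dκ through the equality over
  -- κ'.
  have hgi : Integrable g volume := (integrable_rnDeriv_smul_iff hac2).1 (hui.congr hae)
  refine ⟨g, hgi, hg2, ?_⟩
  ext B hB
  rw [hs₀c, withDensityᵥ_apply hs₀i hB, withDensityᵥ_apply hgi hB, ← setIntegral_rnDeriv_smul hac1 hB,
    ← setIntegral_rnDeriv_smul hac2 hB]
  exact setIntegral_congr_ae hB (hae.mono fun x hx _ => hx)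

lemma continuous_lintegral_sub_translate {s : E d → ℂ} (hs : MemLp s 2 volume) :
    Continuous fun w : E d => ∫⁻ x, ‖s x - s (x + w)‖ₑ ^ 2 := by
  let g : C(E d, C(E d, E d)) := (ContinuousMap.mk (fun p : E d × E d => p.2 + p.1) (by fun_prop)).curry
  have hmp : ∀ w : E d, MeasurePreserving (g w) volume volume :=
    fun w => measurePreserving_add_right volume w
  have h1 : Continuous fun w => Lp.compMeasurePreserving (g w) (hmp w) (hs.toLp s) :=
    continuous_const.compMeasurePreservingLp g.continuous hmp (by simp)
  have h2 : ∀ w, edist (hs.toLp s) (Lp.compMeasurePreserving (g w) (hmp w) (hs.toLp s)) ^ 2 =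
      ∫⁻ x, ‖s x - s (x + w)‖ₑ ^ 2 := by
    intro w
    rw [Lp.toLp_compMeasurePreserving, Lp.edist_toLp_toLp,
      eLpNorm_eq_lintegral_rpow_enorm_toReal (by simp) (by simp), ← ENNReal.rpow_natCast,
      ← ENNReal.rpow_mul]
    norm_num
    rfl
  simp_rw [← h2]
  exact (ENNReal.continuous_pow 2).comp (continuous_const.edist h1)

lemma enorm_sub_sq_le (a b : ℂ) : ‖a - b‖ₑ ^ 2 ≤ 2 * ‖a‖ₑ ^ 2 + 2 * ‖b‖ₑ ^ 2 := by
  simp only [← ofReal_norm, ← ENNReal.ofReal_pow (norm_nonneg _)]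
  rw [show (2 : ℝ≥0∞) = ENNReal.ofReal 2 by simp, ← ENNReal.ofReal_mul (by norm_num),
    ← ENNReal.ofReal_mul (by norm_num), ← ENNReal.ofReal_add (by positivity) (by positivity)]
  refine ENNReal.ofReal_le_ofReal ?_
  have := norm_sub_le a b
  nlinarith [sq_nonneg (‖a‖ - ‖b‖), norm_nonneg (a - b), norm_nonneg a, norm_nonneg b]

lemma lintegral_sub_translate_le {s : E d → ℂ} (hs : MemLp s 2 volume) (w : E d) :
    ∫⁻ x, ‖s x - s (x + w)‖ₑ ^ 2 ≤ 4 * ∫⁻ x, ‖s x‖ₑ ^ 2 := by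
  have h1 : ∫⁻ x, ‖s (x + w)‖ₑ ^ 2 = ∫⁻ x, ‖s x‖ₑ ^ 2 :=
    lintegral_add_right_eq_self (fun x => ‖s x‖ₑ ^ 2) w
  have hm : AEMeasurable (fun x => ‖s x‖ₑ ^ 2) volume := hs.1.enorm.pow_const 2
  calc ∫⁻ x, ‖s x - s (x + w)‖ₑ ^ 2 ≤ ∫⁻ x, (2 * ‖s x‖ₑ ^ 2 + 2 * ‖s (x + w)‖ₑ ^ 2) := by
        refine lintegral_mono fun x => ?_
        exact enorm_sub_sq_le _ _
    _ = 4 * ∫⁻ x, ‖s x‖ₑ ^ 2 := by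
        rw [lintegral_add_left' (hm.const_mul 2), lintegral_const_mul' _ _ (by simp),
          lintegral_const_mul' _ _ (by simp), h1, ← add_mul]
        norm_num

lemma lintegral_smul_eq (k : E d → ℝ≥0∞) {lam : ℝ} (hl : 0 < lam) (D : E d → ℝ≥0∞)
    (hk : Measurable k) (hD : Measurable D) :
    ∫⁻ w, ENNReal.ofReal (lam ^ d) * k (lam • w) * D w = ∫⁻ u, k u * D (lam⁻¹ • u) := by
  have h := Measure.map_addHaar_smul (volume : Measure (E d)) hl.ne'
  have h1 : ∫⁻ u, k u * D (lam⁻¹ • u) ∂(Measure.map (fun x : E d => lam • x) volume) =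
      ∫⁻ w, k (lam • w) * D w := by
    rw [lintegral_map (by fun_prop) (by fun_prop)]
    simp_rw [smul_smul, inv_mul_cancel₀ hl.ne', one_smul]
  rw [h, lintegral_smul_measure, finrank_euclideanSpace, Fintype.card_fin,
    abs_of_pos (by positivity)] at h1
  simp_rw [mul_assoc]
  rw [lintegral_const_mul _ (by fun_prop), ← h1, smul_eq_mul, ← mul_assoc,
    ← ENNReal.ofReal_mul (by positivity), mul_inv_cancel₀ (by positivity), ENNReal.ofReal_one,
    one_mul]

lemma lintegral_prod_sub_eq {s : E d → ℂ} (hs : MemLp s 2 volume) {k : E d → ℝ≥0∞}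
    (hk : Measurable k) :
    ∫⁻ x : E d × E d, k (x.2 - x.1) * ‖s x.1 - s x.2‖ₑ ^ 2 ∂((volume : Measure (E d)).prod volume) =
      ∫⁻ w, k w * ∫⁻ x, ‖s x - s (x + w)‖ₑ ^ 2 := by
  have hmp := measurePreserving_prod_add (volume : Measure (E d)) (volume : Measure (E d))
  have hemb : MeasurableEmbedding (fun z : E d × E d => (z.1, z.1 + z.2)) :=
    (MeasurableEquiv.shearAddRight (E d)).measurableEmbedding
  have hm : AEMeasurable (fun x : E d × E d => k (x.2 - x.1) * ‖s x.1 - s x.2‖ₑ ^ 2)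
      ((volume : Measure (E d)).prod volume) :=
    (by fun_prop : Measurable fun x : E d × E d => k (x.2 - x.1)).aemeasurable.mul
      (((hs.1.comp_fst).sub (hs.1.comp_snd)).enorm.pow_const 2)
  rw [← hmp.lintegral_comp_emb hemb]
  refine (lintegral_prod_symm _
    (hm.comp_quasiMeasurePreserving hmp.quasiMeasurePreserving)).trans ?_
  refine lintegral_congr fun w => ?_
  simp only [Function.comp_apply, add_sub_cancel_left]
  have hm2 : AEMeasurable (fun x => ‖s x - s (x + w)‖ₑ ^ 2) volume :=
    (hs.1.sub (hs.comp_measurePreserving (measurePreserving_add_right volume w)).1).enorm.pow_const 2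
  exact lintegral_const_mul'' _ hm2

/-- An approximate identity does not see the increments of a square integrable function. -/
theorem tendsto_lintegral_prod_sub {s : E d → ℂ} (hs : MemLp s 2 volume) {γ : E d → ℝ}
    (hγ : Measurable γ) (hγi : Integrable γ) :
    Tendsto (fun lam : ℝ => ∫⁻ x : E d × E d, ENNReal.ofReal (lam ^ d) *
      ENNReal.ofReal (γ (lam • (x.2 - x.1))) * ‖s x.1 - s x.2‖ₑ ^ 2
        ∂((volume : Measure (E d)).prod volume)) atTop (𝓝 0) := by
  set D : E d → ℝ≥0∞ := fun w => ∫⁻ x, ‖s x - s (x + w)‖ₑ ^ 2 with hD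
  have hDc : Continuous D := continuous_lintegral_sub_translate hs
  have hD0 : D 0 = 0 := by simp [hD]
  have hs2 : ∫⁻ x, ‖s x‖ₑ ^ 2 ≠ ⊤ := by
    have := lintegral_rpow_enorm_lt_top_of_eLpNorm_lt_top (by simp) (by simp) hs.2
    simpa using this.ne
  have h1 : ∀ᶠ lam : ℝ in atTop, ∫⁻ u, ENNReal.ofReal (γ u) * D (lam⁻¹ • u) =
      ∫⁻ x : E d × E d, ENNReal.ofReal (lam ^ d) *
      ENNReal.ofReal (γ (lam • (x.2 - x.1))) * ‖s x.1 - s x.2‖ₑ ^ 2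
        ∂((volume : Measure (E d)).prod volume) := by
    filter_upwards [eventually_gt_atTop 0] with lam hl
    rw [lintegral_prod_sub_eq hs
      (k := fun w => ENNReal.ofReal (lam ^ d) * ENNReal.ofReal (γ (lam • w))) (by fun_prop),
      ← lintegral_smul_eq (fun u => ENNReal.ofReal (γ u)) hl D (by fun_prop) hDc.measurable]
  refine Tendsto.congr' h1 ?_
  -- After the substitution u = λ w the integral is ∫ γ(u) D(u/λ) du, where D is continuous, D(0) =
  -- 0 and D ≤ 4‖s‖₂².
  have h2 := tendsto_lintegral_filter_of_dominated_convergence (μ := (volume : Measure (E d)))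
    (l := atTop) (F := fun (lam : ℝ) u => ENNReal.ofReal (γ u) * D (lam⁻¹ • u)) (f := fun _ => 0)
    (fun u => ENNReal.ofReal (γ u) * (4 * ∫⁻ x, ‖s x‖ₑ ^ 2))
    (Eventually.of_forall fun lam => by have := hDc.measurable; fun_prop)
    (Eventually.of_forall fun lam => ae_of_all _ fun u => by
      gcongr; exact lintegral_sub_translate_le hs _)
    (by
      rw [lintegral_mul_const' _ _ (ENNReal.mul_ne_top (by simp) hs2)]
      exact ENNReal.mul_ne_top hγi.lintegral_lt_top.ne (ENNReal.mul_ne_top (by simp) hs2))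
    (ae_of_all _ fun u => by
      have h3 : Tendsto (fun lam : ℝ => D (lam⁻¹ • u)) atTop (𝓝 0) := by
        rw [← hD0]
        refine (hDc.tendsto 0).comp ?_
        simpa using (tendsto_inv_atTop_zero (𝕜 := ℝ)).smul_const u
      simpa using ENNReal.Tendsto.const_mul h3 (Or.inr ENNReal.ofReal_ne_top))
  simpa using h2

end SquareIntegrable

/-! ### Upper bound for an isotropic image -/

section UpperBound

variable {d : ℕ} {κ : Type} [Fintype κ] {F : κ → κ → ℝ} {M : MatrixMeasure d κ}
  {ν : Measure (E d)} {S : E d → Matrix κ κ ℂ} {φ : E d → ℝ}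

lemma ae_enorm_le_of_isotropic (hF : ∀ I J, F I J = F J I) (hM : IsPositive M) [SigmaFinite ν]
    (h : HasDensity M ν S) (hC : image M ⊆ cone F) (φ : E d → ℝ) {lam : ℝ} (hl : 0 < lam) :
    ∀ᵐ x ∂(ν.prod ν), ‖lam ^ d * gam φ (lam • (x.2 - x.1)) * (pairing F (S x.1) (S x.2)).re‖ₑ ≤
      ENNReal.ofReal (∑ I, ∑ I', ∑ J, ∑ J', |F I I'| * |F J J'|) * ∑ I, ∑ J,
        ENNReal.ofReal (lam ^ d) * ENNReal.ofReal (gam φ (lam • (x.2 - x.1))) *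
          ‖S x.1 I J - S x.2 I J‖ₑ ^ 2 := by
  have h1 := (h.ae_posSemidef hM).and (h.ae_range_subset hM hC)
  have h2 : ∀ᵐ x ∂ν, (S x).PosSemidef ∧ pairing F (S x) (S x) = 0 := by
    filter_upwards [h1] with x hx
    exact ⟨hx.1, (pairing_self_eq_zero_iff hF hx.1).2 hx.2⟩
  have h3 : ∀ᵐ x ∂(ν.prod ν), (S x.1).PosSemidef ∧ pairing F (S x.1) (S x.1) = 0 :=
    Measure.quasiMeasurePreserving_fst.ae h2
  have h4 : ∀ᵐ x ∂(ν.prod ν), (S x.2).PosSemidef ∧ pairing F (S x.2) (S x.2) = 0 :=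
    Measure.quasiMeasurePreserving_snd.ae h2
  filter_upwards [h3, h4] with x hx hy
  have hb := norm_pairing_le_of_isotropic hF hx.1 hy.1 hx.2 hy.2
  have hb' := (Complex.abs_re_le_norm _).trans hb
  set C := ∑ I, ∑ I', ∑ J, ∑ J', |F I I'| * |F J J'|
  have hC0 : 0 ≤ C := by positivity
  have hg := gam_nonneg φ (lam • (x.2 - x.1))
  have e : ENNReal.ofReal C * ∑ I, ∑ J, ENNReal.ofReal (lam ^ d) *
      ENNReal.ofReal (gam φ (lam • (x.2 - x.1))) * ‖S x.1 I J - S x.2 I J‖ₑ ^ 2 =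
      ENNReal.ofReal (lam ^ d * gam φ (lam • (x.2 - x.1)) *
        (C * ∑ I, ∑ J, ‖S x.1 I J - S x.2 I J‖ ^ 2)) := by
    have e' : ENNReal.ofReal (∑ I, ∑ J, ‖S x.1 I J - S x.2 I J‖ ^ 2) =
        ∑ I, ∑ J, ‖S x.1 I J - S x.2 I J‖ₑ ^ 2 := by
      rw [ENNReal.ofReal_sum_of_nonneg fun I _ => by positivity]
      refine Finset.sum_congr rfl fun I _ => ?_
      rw [ENNReal.ofReal_sum_of_nonneg fun J _ => by positivity]
      refine Finset.sum_congr rfl fun J _ => ?_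
      rw [ENNReal.ofReal_pow (norm_nonneg _), ofReal_norm]
    rw [ENNReal.ofReal_mul (by positivity), ENNReal.ofReal_mul hC0, ENNReal.ofReal_mul (by positivity),
      e', Finset.mul_sum, Finset.mul_sum, Finset.mul_sum]
    refine Finset.sum_congr rfl fun I _ => ?_
    rw [← Finset.mul_sum]
    ring
  rw [e, ← ofReal_norm]
  refine ENNReal.ofReal_le_ofReal ?_
  rw [norm_mul, Real.norm_of_nonneg (by positivity)]
  gcongr
  exact hb'

/-- Isotropy enters only here: it bounds the pairing by squared increments of S, so each case of the
second claim only has to control these increments near the diagonal. -/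
lemma tendsto_lintegral_of_isotropic (hF : ∀ I J, F I J = F J I) (hM : IsPositive M) [SigmaFinite ν]
    (h : HasDensity M ν S) (hC : image M ⊆ cone F) (hφ : Integrable φ)
    (hlim : ∀ I J, Tendsto (fun lam : ℝ => ∫⁻ x : E d × E d, ENNReal.ofReal (lam ^ d) *
      ENNReal.ofReal (gam φ (lam • (x.2 - x.1))) * ‖S x.1 I J - S x.2 I J‖ₑ ^ 2 ∂(ν.prod ν))
        atTop (𝓝 0)) :
    Tendsto (fun lam : ℝ => ∫⁻ x : E d × E d,
      ‖lam ^ d * gam φ (lam • (x.2 - x.1)) * (pairing F (S x.1) (S x.2)).re‖ₑ ∂(ν.prod ν))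
        atTop (𝓝 0) := by
  set C := ∑ I, ∑ I', ∑ J, ∑ J', |F I I'| * |F J J'|
  have h1 : Tendsto (fun lam : ℝ => ENNReal.ofReal C * ∑ I, ∑ J,
      ∫⁻ x : E d × E d, ENNReal.ofReal (lam ^ d) *
      ENNReal.ofReal (gam φ (lam • (x.2 - x.1))) * ‖S x.1 I J - S x.2 I J‖ₑ ^ 2 ∂(ν.prod ν))
        atTop (𝓝 0) := by
    have := ENNReal.Tendsto.const_mul (a := ENNReal.ofReal C)
      (tendsto_finsetSum Finset.univ fun I _ => tendsto_finsetSum Finset.univ fun J _ => hlim I J)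
      (Or.inr ENNReal.ofReal_ne_top)
    simpa using this
  refine tendsto_of_tendsto_of_tendsto_of_le_of_le' tendsto_const_nhds h1
    (Eventually.of_forall fun _ => zero_le) ?_
  filter_upwards [eventually_gt_atTop 0] with lam hl
  have hm : ∀ I J, AEMeasurable (fun x : E d × E d => ENNReal.ofReal (lam ^ d) *
      ENNReal.ofReal (gam φ (lam • (x.2 - x.1))) * ‖S x.1 I J - S x.2 I J‖ₑ ^ 2) (ν.prod ν) := by
    intro I J
    have := (continuous_gam hφ).measurable
    exact (by fun_prop : Measurable fun x : E d × E d => ENNReal.ofReal (lam ^ d) *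
      ENNReal.ofReal (gam φ (lam • (x.2 - x.1)))).aemeasurable.mul
      ((((h I J).1.1.comp_fst).sub ((h I J).1.1.comp_snd)).enorm.pow_const 2)
  refine (lintegral_mono_ae (ae_enorm_le_of_isotropic hF hM h hC φ hl)).trans_eq ?_
  rw [lintegral_const_mul' _ _ ENNReal.ofReal_ne_top,
    lintegral_finsetSum' _ fun I _ => Finset.aemeasurable_fun_sum _ fun J _ => hm I J]
  congr 1
  refine Finset.sum_congr rfl fun I _ => ?_
  rw [lintegral_finsetSum' _ fun J _ => hm I J]

lemma bddAbove_gam (_hφ : Integrable φ) (x : E d) :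
    BddAbove (Set.range fun y : {y : E d // ‖x‖ ≤ ‖y‖} => gam φ y) :=
  ⟨(∫ v, |φ v|) ^ 2, by rintro _ ⟨y, rfl⟩; exact gam_le φ y⟩

lemma gam_le_gamPlus (hφ : Integrable φ) {x y : E d} (h : ‖x‖ ≤ ‖y‖) :
    gam φ y ≤ gamPlus φ x :=
  le_ciSup (bddAbove_gam hφ x) ⟨y, h⟩

lemma IsTestFunction.integrable (hφ : IsTestFunction φ) : Integrable φ :=
  memLp_one_iff_integrable.1 hφ.memLp_one

lemma IsTestFunction.integrable_gam (hφ : IsTestFunction φ) : Integrable (gam φ) := by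
  refine hφ.integrable_gamPlus.mono' (continuous_gam hφ.integrable).aestronglyMeasurable
    (ae_of_all _ fun x => ?_)
  rw [Real.norm_of_nonneg (gam_nonneg _ _)]
  exact gam_le_gamPlus hφ.integrable le_rfl

theorem exists_hasDensity_volume_tendsto (hF : ∀ I J, F I J = F J I) (hM : IsPositive M)
    (hft : ∀ I J, MemLp (ft (M I J)) 2 volume) (hC : image M ⊆ cone F) (hφ : IsTestFunction φ) :
    ∃ S : E d → Matrix κ κ ℂ, HasDensity M volume S ∧
      Tendsto (fun lam : ℝ => ∫⁻ x : E d × E d,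
        ‖lam ^ d * gam φ (lam • (x.2 - x.1)) * (pairing F (S x.1) (S x.2)).re‖ₑ
          ∂((volume : Measure (E d)).prod volume)) atTop (𝓝 0) := by
  have hex : ∀ I J, ∃ s : E d → ℂ, Integrable s ∧ MemLp s 2 ∧
      M I J = (volume : Measure (E d)).withDensityᵥ s :=
    fun I J => exists_density_of_memLp_ft (M I J) (hft I J)
  choose s hs1 hs2 hs using hex
  obtain ⟨S, hS⟩ : ∃ S : E d → Matrix κ κ ℂ, ∀ I J, (fun x => S x I J) = s I J :=
    ⟨fun x => Matrix.of fun I J => s I J x, fun I J => rfl⟩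
  have hd : HasDensity M volume S := fun I J => by rw [hS]; exact ⟨hs1 I J, hs I J⟩
  refine ⟨S, hd, ?_⟩
  refine tendsto_lintegral_of_isotropic hF hM hd hC hφ.integrable fun I J => ?_
  have h2 : MemLp (fun x => S x I J) 2 volume := by rw [hS]; exact hs2 I J
  have h3 := tendsto_lintegral_prod_sub h2 (continuous_gam hφ.integrable).measurable
    hφ.integrable_gam
  exact h3

lemma IsSpectralMeasure.memLp_ft_convPow {n : ℕ} {K : E d → Matrix (Fin n) (Fin n) ℝ}
    {μ : MatrixMeasure d (Fin n)} (hμ : IsSpectralMeasure K μ) {q : ℕ} (hq : 1 ≤ q)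
    (hK : ∀ i j, MemLp (fun v => K v i j) (2 * q : ℕ) volume) (I J : Fin q → Fin n) :
    MemLp (ft (convPow μ q I J)) 2 volume := by
  have h1 : ft (convPow μ q I J) = fun v => (q.factorial : ℂ)⁻¹ *
      ∑ σ : Equiv.Perm (Fin q), ∏ k, (K v (I (σ k)) (J k) : ℂ) := by
    ext v; exact hμ.ft_convPow I J v
  rw [h1]
  have h4 : ∀ σ : Equiv.Perm (Fin q), MemLp (fun v => ∏ k, (K v (I (σ k)) (J k) : ℂ)) 2 volume := ?_
  · exact (memLp_finsetSum _ fun σ _ => h4 σ).const_mul _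
  intro σ
  have h2 := MemLp.prod' (s := (Finset.univ : Finset (Fin q)))
    (p := fun _ => ((2 * q : ℕ) : ℝ≥0∞)) (f := fun k v => (K v (I (σ k)) (J k) : ℂ))
    fun k _ => (hK (I (σ k)) (J k)).ofReal (K := ℂ)
  -- Hölder exponents: a product of q functions in L^{2q} lies in L².
  have h3 : (∑ _i : Fin q, (((2 * q : ℕ) : ℝ≥0∞))⁻¹)⁻¹ = 2 := by
    rw [Finset.sum_const, Finset.card_univ, Fintype.card_fin, nsmul_eq_mul]
    have hq0 : (q : ℝ≥0∞) ≠ 0 := by exact_mod_cast (by omega : q ≠ 0)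
    push_cast
    rw [ENNReal.mul_inv (Or.inl hq0) (Or.inl (by simp)), inv_inv, mul_left_comm,
      ENNReal.inv_mul_cancel hq0 (by simp), mul_one]
  rwa [h3] at h2

end UpperBound

/-! ### Surface measure of small balls -/

section Hypersurface

/-- Let π drop a coordinate i with ℓ(e_i) ≠ 0. Then (ℓ, π) is injective, so ‖v‖ ≤ C max(|ℓ v|, ‖π
v‖). On the zero set of g, strict differentiability makes |ℓ(y-z)| at most ‖y-z‖/(2C), which is
absorbed. No implicit function theorem is needed. -/
lemma exists_antilipschitz_of_strictDeriv {m : ℕ} {g : E (m + 1) → ℝ} {ℓ : E (m + 1) →L[ℝ] ℝ}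
    {x : E (m + 1)} (hg : HasStrictFDerivAt g ℓ x) (hℓ : ℓ ≠ 0) :
    ∃ π : E (m + 1) →L[ℝ] (Fin m → ℝ), (∀ v, ‖π v‖ ≤ ‖v‖) ∧ ∃ K : NNReal, ∃ U ∈ 𝓝 x,
      ∀ y ∈ U, ∀ z ∈ U, g y = 0 → g z = 0 → ‖y - z‖ ≤ K * ‖π y - π z‖ := by
  obtain ⟨i, hi⟩ : ∃ i, ℓ (EuclideanSpace.single i 1) ≠ 0 := by
    by_contra! hcon
    apply hℓ
    ext v
    have hv : v = ∑ i, v i • EuclideanSpace.single i (1 : ℝ) := by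
      ext j
      simp [Finset.sum_apply, Pi.single_apply]
    rw [hv, map_sum]
    simp [hcon]
  let π : E (m + 1) →L[ℝ] (Fin m → ℝ) :=
    ContinuousLinearMap.pi fun j => EuclideanSpace.proj (i.succAbove j)
  have hπ : ∀ v j, π v j = v (i.succAbove j) := fun v j => rfl
  have hinj : (ℓ.prod π).toLinearMap.ker = ⊥ := by
    rw [LinearMap.ker_eq_bot']
    intro v hv
    have h1 : ℓ v = 0 := congrArg Prod.fst hv
    have h2 : π v = 0 := congrArg Prod.snd hv
    have h3 : v = v i • EuclideanSpace.single i (1 : ℝ) := by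
      ext j
      revert j
      rw [Fin.forall_iff_succAbove i]
      refine ⟨by simp, fun j => ?_⟩
      rw [← hπ, h2]
      simp [Fin.succAbove_ne]
    rw [h3, map_smul, smul_eq_mul] at h1
    have h4 : v i = 0 := by simpa [hi] using h1
    rw [h3, h4, zero_smul]
  obtain ⟨C, hC0, hC⟩ := LinearMap.exists_antilipschitzWith _ hinj
  have hC' : ∀ v, ‖v‖ ≤ C * max |ℓ v| ‖π v‖ := by
    intro v
    have := hC.le_mul_dist v 0
    simpa [dist_eq_norm, Prod.norm_def] using this
  refine ⟨π, fun v => ?_, 2 * C, ?_⟩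
  · refine (pi_norm_le_iff_of_nonneg (norm_nonneg _)).2 fun j => ?_
    rw [hπ]
    exact PiLp.norm_apply_le v _
  have hC0' : (0 : ℝ) < C := hC0
  have hev := hg.isLittleO.def (c := (2 * (C : ℝ))⁻¹) (by positivity)
  rw [nhds_prod_eq] at hev
  obtain ⟨U, hU, hUU⟩ := (Filter.eventually_prod_self_iff (r := fun y z =>
    ‖g y - g z - ℓ (y - z)‖ ≤ (2 * (C : ℝ))⁻¹ * ‖y - z‖)).1 hev
  refine ⟨U, hU, fun y hy z hz hgy hgz => ?_⟩
  have h1 := hUU y hy z hz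
  rw [hgy, hgz, sub_zero, zero_sub, norm_neg, Real.norm_eq_abs] at h1
  have h2 := hC' (y - z)
  rw [map_sub π] at h2
  have h3 : (C : ℝ) * |ℓ (y - z)| ≤ ‖y - z‖ / 2 := by
    calc (C : ℝ) * |ℓ (y - z)| ≤ C * ((2 * (C : ℝ))⁻¹ * ‖y - z‖) := by gcongr
      _ = _ := by field_simp
  have h4 : (C : ℝ) * max |ℓ (y - z)| ‖π y - π z‖ ≤ ‖y - z‖ / 2 + C * ‖π y - π z‖ := by
    rcases max_cases |ℓ (y - z)| ‖π y - π z‖ with h | h <;> rw [h.1]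
    · have : 0 ≤ (C : ℝ) * ‖π y - π z‖ := by positivity
      linarith
    · linarith [norm_nonneg (y - z)]
  push_cast
  linarith

variable {m : ℕ} {S : Set (E (m + 1))}

/-- The inverse of π is K-Lipschitz on π(A), and π maps the ball into a cube of side 2r. The sup
norm on `Fin m → ℝ` is chosen because m-dimensional Hausdorff measure is Lebesgue measure there. -/
lemma hausdorffMeasure_inter_ball_le {π : E (m + 1) →L[ℝ] (Fin m → ℝ)} (hπ : ∀ v, ‖π v‖ ≤ ‖v‖)
    {A : Set (E (m + 1))} {K : NNReal} (hA : ∀ y ∈ A, ∀ z ∈ A, ‖y - z‖ ≤ K * ‖π y - π z‖)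
    (x : E (m + 1)) {r : ℝ} (hr : 0 < r) :
    (Measure.hausdorffMeasure (m : ℝ) : Measure (E (m + 1))) (A ∩ Metric.ball x r) ≤
      (K : ℝ≥0∞) ^ m * ENNReal.ofReal ((2 * r) ^ m) := by
  have hinj : Set.InjOn π A := fun y hy z hz h => by
    have := hA y hy z hz
    rw [h, sub_self, norm_zero, mul_zero] at this
    exact sub_eq_zero.1 (norm_le_zero_iff.1 this)
  set B := A ∩ Metric.ball x r with hB
  have hBA : B ⊆ A := Set.inter_subset_left
  have hl : LipschitzOnWith K (Function.invFunOn π A) (π '' B) := by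
    refine LipschitzOnWith.of_dist_le_mul ?_
    rintro _ ⟨y, hy, rfl⟩ _ ⟨z, hz, rfl⟩
    rw [hinj.leftInvOn_invFunOn (hBA hy), hinj.leftInvOn_invFunOn (hBA hz), dist_eq_norm,
      dist_eq_norm]
    exact hA y (hBA hy) z (hBA hz)
  have h1 := hl.hausdorffMeasure_image_le (d := (m : ℝ)) (by positivity)
  have h2 : Function.invFunOn π A '' (π '' B) = B := by
    rw [Set.image_image]
    exact (Set.image_congr fun y hy => hinj.leftInvOn_invFunOn (hBA hy)).trans (Set.image_id' B)
  rw [h2, ENNReal.rpow_natCast] at h1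
  refine h1.trans ?_
  gcongr
  have h3 : (Measure.hausdorffMeasure (m : ℝ) : Measure (Fin m → ℝ)) = volume := by
    have := hausdorffMeasure_pi_real (ι := Fin m)
    rwa [Fintype.card_fin] at this
  rw [h3]
  have h4 := Real.volume_pi_ball (π x) hr
  rw [Fintype.card_fin] at h4
  rw [← h4]
  refine measure_mono ?_
  rintro _ ⟨y, hy, rfl⟩
  rw [Metric.mem_ball, dist_eq_norm, ← map_sub]
  exact (hπ _).trans_lt (by rw [← dist_eq_norm]; exact hy.2)

/-- The local bound near each point of S holds for balls of all centers and radii, so it passes to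
finite unions and, by compactness, to S. -/
lemma IsSmoothCompactHypersurface.exists_measure_ball_le (hS : IsSmoothCompactHypersurface S) :
    ∃ C : NNReal, ∀ x r, 0 < r →
      surfaceMeasure S (Metric.ball x r) ≤ C * ENNReal.ofReal (r ^ m) := by
  have key : ∃ C : NNReal, ∀ x : E (m + 1), ∀ r : ℝ, 0 < r →
      (Measure.hausdorffMeasure (m : ℝ) : Measure (E (m + 1))) (S ∩ S ∩ Metric.ball x r) ≤
        C * ENNReal.ofReal (r ^ m) := by
    refine hS.1.induction_on (p := fun s => ∃ C : NNReal, ∀ x : E (m + 1), ∀ r : ℝ, 0 < r →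
      (Measure.hausdorffMeasure (m : ℝ) : Measure (E (m + 1))) (S ∩ s ∩ Metric.ball x r) ≤
        C * ENNReal.ofReal (r ^ m)) ⟨0, by simp⟩ ?_ ?_ ?_
    · rintro s t hst ⟨C, hC⟩
      exact ⟨C, fun x r hr => (measure_mono (by gcongr)).trans (hC x r hr)⟩
    · rintro s t ⟨C, hC⟩ ⟨C', hC'⟩
      refine ⟨C + C', fun x r hr => ?_⟩
      rw [Set.inter_union_distrib_left, Set.union_inter_distrib_right, ENNReal.coe_add, add_mul]
      exact (measure_union_le _ _).trans (add_le_add (hC x r hr) (hC' x r hr))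
    · intro x hx
      obtain ⟨g, hg, hg0, hgS⟩ := hS.2 x hx
      obtain ⟨π, hπ, K, U, hU, h⟩ :=
        exists_antilipschitz_of_strictDeriv (hg.hasStrictFDerivAt (by simp)) hg0
      refine ⟨U ∩ {y | y ∈ S ↔ g y = 0}, mem_nhdsWithin_of_mem_nhds (inter_mem hU hgS),
        K ^ m * 2 ^ m, fun y r hr => ?_⟩
      refine (hausdorffMeasure_inter_ball_le hπ (K := K) (fun y hy z hz =>
        h y hy.2.1 z hz.2.1 (hy.2.2.1 hy.1) (hz.2.2.1 hz.1)) y hr).trans_eq ?_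
      rw [mul_pow, ENNReal.ofReal_mul (by positivity), ENNReal.ofReal_pow (by norm_num)]
      push_cast
      rw [mul_assoc]
      norm_num
  obtain ⟨C, hC⟩ := key
  refine ⟨C, fun x r hr => ?_⟩
  refine le_trans (le_of_eq ?_) (hC x r hr)
  rw [surfaceMeasure, Measure.restrict_apply Metric.isOpen_ball.measurableSet, Set.inter_self,
    Set.inter_comm]
  congr 2
  push_cast
  ring

lemma IsSmoothCompactHypersurface.isFiniteMeasure (hS : IsSmoothCompactHypersurface S) :
    IsFiniteMeasure (surfaceMeasure S) := by
  obtain ⟨C, hC⟩ := hS.exists_measure_ball_le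
  obtain ⟨R, hR0, hR⟩ := hS.1.isBounded.subset_ball_lt 0 0
  refine ⟨?_⟩
  have h1 : surfaceMeasure S Set.univ ≤ surfaceMeasure S (Metric.ball 0 R) := by
    rw [surfaceMeasure, Measure.restrict_apply_univ,
      Measure.restrict_apply Metric.isOpen_ball.measurableSet]
    exact measure_mono fun x hx => ⟨hR hx, hx⟩
  exact h1.trans_lt ((hC 0 R hR0).trans_lt (ENNReal.mul_lt_top (by simp) (by simp)))

lemma IsC1On.exists_lipschitzOnWith {d : ℕ} {S : Set (E d)} (hS : IsCompact S) {g : E d → ℂ}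
    (hg : IsC1On S g) : ∃ L, LipschitzOnWith L g S := by
  refine LocallyLipschitzOn.exists_lipschitzOnWith_of_compact hS fun x hx => ?_
  obtain ⟨h, hh, hhg⟩ := hg x hx
  obtain ⟨K, t, ht, hK⟩ := hh.exists_lipschitzOnWith
  refine ⟨K, t ∩ {y | h y = g y}, inter_mem (mem_nhdsWithin_of_mem_nhds ht) hhg, ?_⟩
  intro y hy z hz
  rw [← hy.2, ← hz.2]
  exact hK hy.1 hz.1

/-- A linear form on a zero-dimensional space cannot be nonzero. This covers the dimension left out
by writing d = m + 1. -/
lemma IsSmoothCompactHypersurface.eq_empty {S : Set (E 0)} (hS : IsSmoothCompactHypersurface S) :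
    S = ∅ := by
  rw [Set.eq_empty_iff_forall_notMem]
  intro x hx
  obtain ⟨g, -, h, -⟩ := hS.2 x hx
  exact h (Subsingleton.elim _ _)

end Hypersurface

/-! ### Decay of the radial majorant -/

section RadialMajorant

variable {d : ℕ} {φ : E d → ℝ}

lemma gamPlus_anti (hφ : Integrable φ) {x y : E d} (h : ‖x‖ ≤ ‖y‖) : gamPlus φ y ≤ gamPlus φ x := by
  have : Nonempty {z : E d // ‖y‖ ≤ ‖z‖} := ⟨⟨y, le_rfl⟩⟩
  exact ciSup_le fun z => gam_le_gamPlus hφ (h.trans z.2)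

lemma gamPlus_nonneg (hφ : Integrable φ) (x : E d) : 0 ≤ gamPlus φ x :=
  (gam_nonneg φ x).trans (gam_le_gamPlus hφ le_rfl)

/-- On the shell ‖x‖/2 ≤ ‖y‖ < ‖x‖ monotonicity gives γ⁺(y) ≥ γ⁺(x), and its volume is a multiple of
‖x‖^d, positive because d ≠ 0. As the right side is a tail of a convergent integral, ‖x‖^d γ⁺(x) is
bounded and tends to 0 at infinity. -/
lemma IsTestFunction.pow_mul_gamPlus_le (hφ : IsTestFunction φ) (hd : d ≠ 0) :
    ∃ c : ℝ, 0 ≤ c ∧ ∀ x : E d, x ≠ 0 →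
      ‖x‖ ^ d * gamPlus φ x ≤ c * ∫ y in {y | ‖x‖ / 2 ≤ ‖y‖}, gamPlus φ y := by
  set V := (volume (Metric.ball (0 : E d) 1)).toReal
  have hV : 0 < V := ENNReal.toReal_pos (Metric.measure_ball_pos _ _ one_pos).ne' measure_ball_lt_top.ne
  have h2 : (0 : ℝ) < 1 - (1 / 2) ^ d := by
    have : (1 / 2 : ℝ) ^ d < 1 := pow_lt_one₀ (by norm_num) (by norm_num) hd
    linarith
  refine ⟨((1 - (1 / 2) ^ d) * V)⁻¹, by positivity, fun x hx => ?_⟩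
  have hx0 : 0 < ‖x‖ := norm_pos_iff.2 hx
  set A := Metric.ball (0 : E d) ‖x‖ \ Metric.ball 0 (‖x‖ / 2) with hA
  have hAm : MeasurableSet A := Metric.isOpen_ball.measurableSet.diff Metric.isOpen_ball.measurableSet
  have hball : ∀ r : ℝ, 0 < r → volume.real (Metric.ball (0 : E d) r) = r ^ d * V := fun r hr => by
    rw [measureReal_def, Measure.addHaar_ball_of_pos _ _ hr, finrank_euclideanSpace, Fintype.card_fin,
      ENNReal.toReal_mul, ENNReal.toReal_ofReal (by positivity)]
  have hvol : volume.real A = ‖x‖ ^ d * ((1 - (1 / 2) ^ d) * V) := by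
    rw [hA, measureReal_sdiff (Metric.ball_subset_ball (by linarith)) Metric.isOpen_ball.measurableSet
      measure_ball_lt_top.ne, hball _ hx0, hball _ (by positivity), div_pow, one_div, inv_pow]
    ring
  have hAS : A ⊆ {y | ‖x‖ / 2 ≤ ‖y‖} := fun y hy => by
    have := hy.2
    simpa using this
  have h3 : gamPlus φ x * volume.real A ≤ ∫ y in {y | ‖x‖ / 2 ≤ ‖y‖}, gamPlus φ y := by
    calc gamPlus φ x * volume.real A = ∫ y in A, gamPlus φ x := by
          rw [setIntegral_const, smul_eq_mul, mul_comm]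
      _ ≤ ∫ y in A, gamPlus φ y := by
          refine setIntegral_mono_on (integrableOn_const (ne_top_of_le_ne_top measure_ball_lt_top.ne
            (measure_mono Set.sdiff_subset))) hφ.integrable_gamPlus.integrableOn hAm fun y hy => ?_
          refine gamPlus_anti hφ.integrable ?_
          have h4 : y ∈ Metric.ball 0 ‖x‖ := hy.1
          rw [mem_ball_zero_iff] at h4
          exact h4.le
      _ ≤ _ := setIntegral_mono_set hφ.integrable_gamPlus.integrableOn
          (ae_of_all _ fun y => gamPlus_nonneg hφ.integrable y) (Eventually.of_forall hAS)
  rw [inv_mul_eq_div, le_div_iff₀ (by positivity)]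
  calc _ = gamPlus φ x * volume.real A := by rw [hvol]; ring
    _ ≤ _ := h3

lemma IsTestFunction.tendsto_pow_mul_gamPlus (hφ : IsTestFunction φ) (hd : d ≠ 0) {x : E d}
    (hx : x ≠ 0) : Tendsto (fun lam : ℝ => ‖lam • x‖ ^ d * gamPlus φ (lam • x)) atTop (𝓝 0) := by
  obtain ⟨c, hc, h⟩ := hφ.pow_mul_gamPlus_le hd
  have hx0 : 0 < ‖x‖ := norm_pos_iff.2 hx
  have h1 : Tendsto (fun lam : ℝ => ∫ y in {y | ‖lam • x‖ / 2 ≤ ‖y‖}, gamPlus φ y) atTop (𝓝 0) := by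
    have hm : ∀ lam : ℝ, MeasurableSet {y : E d | ‖lam • x‖ / 2 ≤ ‖y‖} := fun lam =>
      measurableSet_le measurable_const (by fun_prop)
    have h2 := tendsto_integral_filter_of_dominated_convergence (μ := (volume : Measure (E d)))
      (l := atTop) (F := fun (lam : ℝ) => {y : E d | ‖lam • x‖ / 2 ≤ ‖y‖}.indicator (gamPlus φ))
      (f := fun _ => 0) (fun y => ‖gamPlus φ y‖)
      (Eventually.of_forall fun lam => hφ.integrable_gamPlus.1.indicator (hm lam))
      (Eventually.of_forall fun lam => ae_of_all _ fun y => norm_indicator_le_norm_self _ _)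
      hφ.integrable_gamPlus.norm (ae_of_all _ fun y => by
        refine tendsto_const_nhds.congr' ?_
        have h3 : Tendsto (fun lam : ℝ => ‖lam • x‖ / 2) atTop atTop := by
          simp_rw [norm_smul]
          exact (tendsto_norm_atTop_atTop.atTop_mul_const hx0).atTop_div_const two_pos
        filter_upwards [h3.eventually_gt_atTop ‖y‖] with lam hl
        rw [Set.indicator_of_notMem]
        exact not_le.2 hl)
    simp only [integral_zero] at h2
    refine h2.congr fun lam => ?_
    rw [integral_indicator (hm lam)]
  refine squeeze_zero' (Eventually.of_forall fun lam =>
    mul_nonneg (by positivity) (gamPlus_nonneg hφ.integrable _)) ?_ (by simpa using h1.const_mul c)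
  filter_upwards [eventually_gt_atTop 0] with lam hl
  exact h _ (smul_ne_zero hl.ne' hx)

lemma IsTestFunction.exists_pow_mul_gamPlus_le (hφ : IsTestFunction φ) (hd : d ≠ 0) :
    ∃ C : ℝ, 0 ≤ C ∧ ∀ x : E d, ‖x‖ ^ d * gamPlus φ x ≤ C := by
  obtain ⟨c, hc, h⟩ := hφ.pow_mul_gamPlus_le hd
  have hi : 0 ≤ ∫ y, gamPlus φ y := integral_nonneg fun y => gamPlus_nonneg hφ.integrable y
  refine ⟨c * ∫ y, gamPlus φ y, by positivity, fun x => ?_⟩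
  rcases eq_or_ne x 0 with rfl | hx
  · rw [norm_zero, zero_pow hd, zero_mul]; positivity
  refine (h x hx).trans ?_
  exact mul_le_mul_of_nonneg_left (setIntegral_le_integral hφ.integrable_gamPlus
    (ae_of_all _ fun y => gamPlus_nonneg hφ.integrable y)) hc

end RadialMajorant

/-! ### Dyadic shells on a hypersurface -/

section HypersurfaceLimit

variable {m : ℕ} {φ : E (m + 1) → ℝ}

/-- With r_k = R 2^{-k-1} and d = m + 1, the integrand on the shell r_k < ‖y-x‖ ≤ 2 r_k is at most
λ^d γ⁺(λ r_k) (2 r_k)², and the shell has mass at most C (4 r_k)^{d-1}. The unit vector e only turns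
radii into arguments of γ⁺. -/
lemma lintegral_gam_le_tsum (hφ : IsTestFunction φ) {ν : Measure (E (m + 1))} {C : NNReal}
    (hC : ∀ x r, 0 < r → ν (Metric.ball x r) ≤ C * ENNReal.ofReal (r ^ m)) {e : E (m + 1)}
    (he : ‖e‖ = 1) {R : ℝ} (hR : 0 < R) {x : E (m + 1)} (hx : ∀ᵐ y ∂ν, ‖y - x‖ ≤ R) {lam : ℝ}
    (hl : 0 < lam) :
    ∫⁻ y, ENNReal.ofReal (lam ^ (m + 1)) * ENNReal.ofReal (gam φ (lam • (y - x))) *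
      ENNReal.ofReal (‖y - x‖ ^ 2) ∂ν ≤
    C * ∑' k : ℕ, ENNReal.ofReal (4 ^ (m + 1) * (R * (1 / 2) ^ (k + 1)) *
      (‖lam • (R * (1 / 2) ^ (k + 1)) • e‖ ^ (m + 1) *
        gamPlus φ (lam • (R * (1 / 2) ^ (k + 1)) • e))) := by
  set r : ℕ → ℝ := fun k => R * (1 / 2) ^ (k + 1) with hr
  have hr0 : ∀ k, 0 < r k := fun k => by positivity
  set A : ℕ → Set (E (m + 1)) := fun k => {y | r k < ‖y - x‖ ∧ ‖y - x‖ ≤ 2 * r k} with hA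
  have hAm : ∀ k, MeasurableSet (A k) := fun k =>
    MeasurableSet.inter (s₁ := {y | r k < ‖y - x‖}) (s₂ := {y | ‖y - x‖ ≤ 2 * r k})
      (measurableSet_lt (by fun_prop) (by fun_prop)) (measurableSet_le (by fun_prop) (by fun_prop))
  set b : ℕ → ℝ := fun k => lam ^ (m + 1) * gamPlus φ (lam • r k • e) * (2 * r k) ^ 2 with hb
  have hg0 : ∀ z, 0 ≤ gamPlus φ z := gamPlus_nonneg hφ.integrable
  have h1 : ∀ᵐ y ∂ν, ENNReal.ofReal (lam ^ (m + 1)) * ENNReal.ofReal (gam φ (lam • (y - x))) *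
      ENNReal.ofReal (‖y - x‖ ^ 2) ≤ ∑' k, (A k).indicator (fun _ => ENNReal.ofReal (b k)) y := by
    filter_upwards [hx] with y hy
    -- The center belongs to no shell, but the factor ‖y-x‖² makes the integrand vanish there.
    rcases eq_or_ne y x with rfl | hyx
    · simp
    have hpos : 0 < ‖y - x‖ := norm_pos_iff.2 (sub_ne_zero.2 hyx)
    obtain ⟨k, hk1, hk2⟩ := exists_nat_pow_near_of_lt_one (x := ‖y - x‖ / R) (y := (1 / 2 : ℝ))
      (by positivity) ((div_le_one hR).2 hy) (by norm_num) (by norm_num)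
    rw [lt_div_iff₀' hR] at hk1
    rw [div_le_iff₀' hR] at hk2
    have hk2' : ‖y - x‖ ≤ 2 * r k := hk2.trans_eq (by simp only [hr]; ring)
    refine le_trans ?_ (ENNReal.le_tsum k)
    rw [Set.indicator_of_mem (show y ∈ A k from ⟨hk1, hk2'⟩), ← ENNReal.ofReal_mul (by positivity),
      ← ENNReal.ofReal_mul (mul_nonneg (by positivity) (gam_nonneg _ _))]
    refine ENNReal.ofReal_le_ofReal ?_
    have h2 : gam φ (lam • (y - x)) ≤ gamPlus φ (lam • r k • e) := by
      refine gam_le_gamPlus hφ.integrable ?_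
      rw [norm_smul, norm_smul, norm_smul, he, mul_one, Real.norm_of_nonneg (hr0 k).le]
      exact mul_le_mul_of_nonneg_left hk1.le (norm_nonneg _)
    have := hg0 (lam • r k • e)
    simp only [hb]
    gcongr
  refine (lintegral_mono_ae h1).trans ?_
  rw [lintegral_tsum fun k => (measurable_const.indicator (hAm k)).aemeasurable,
    ← ENNReal.tsum_mul_left]
  refine ENNReal.tsum_le_tsum fun k => ?_
  rw [lintegral_indicator_const (hAm k)]
  have h3 : ν (A k) ≤ C * ENNReal.ofReal ((4 * r k) ^ m) := by
    refine (measure_mono fun y hy => ?_).trans (hC x (4 * r k) (by linarith [hr0 k]))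
    rw [mem_ball_iff_norm]
    exact hy.2.trans_lt (by linarith [hr0 k])
  calc ENNReal.ofReal (b k) * ν (A k)
      ≤ ENNReal.ofReal (b k) * (C * ENNReal.ofReal ((4 * r k) ^ m)) := by gcongr
    _ = C * ENNReal.ofReal (b k * (4 * r k) ^ m) := by
        rw [ENNReal.ofReal_mul' (p := b k) (by have := hr0 k; positivity)]; ring
    _ = _ := by
        congr 2
        rw [norm_smul, norm_smul, he, mul_one, Real.norm_of_nonneg (hr0 k).le,
          Real.norm_of_nonneg hl.le]
        simp only [hb, mul_pow, hr]
        ring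

/-- Dominated convergence for series: each term tends to 0, and boundedness of ‖x‖^d γ⁺(x) leaves
the geometric majorant r_k. -/
lemma tendsto_tsum_gamPlus (hφ : IsTestFunction φ) {e : E (m + 1)} (he : ‖e‖ = 1) {R : ℝ}
    (hR : 0 < R) :
    Tendsto (fun lam : ℝ => ∑' k : ℕ, ENNReal.ofReal (4 ^ (m + 1) * (R * (1 / 2) ^ (k + 1)) *
      (‖lam • (R * (1 / 2) ^ (k + 1)) • e‖ ^ (m + 1) *
        gamPlus φ (lam • (R * (1 / 2) ^ (k + 1)) • e)))) atTop (𝓝 0) := by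
  obtain ⟨C, hC0, hC⟩ := hφ.exists_pow_mul_gamPlus_le (Nat.succ_ne_zero m)
  have hT0 : ∀ x : E (m + 1), 0 ≤ ‖x‖ ^ (m + 1) * gamPlus φ x := fun x =>
    mul_nonneg (by positivity) (gamPlus_nonneg hφ.integrable _)
  have hs : Summable fun k : ℕ => 4 ^ (m + 1) * (R * (1 / 2 : ℝ) ^ (k + 1)) * C :=
    ((((summable_nat_add_iff 1).2 summable_geometric_two).mul_left R).mul_left _).mul_right C
  have he0 : e ≠ 0 := fun h => by simp [h] at he
  have h := tendsto_tsum_of_dominated_convergence (𝓕 := atTop) (g := fun _ : ℕ => (0 : ℝ))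
    (f := fun (lam : ℝ) (k : ℕ) => 4 ^ (m + 1) * (R * (1 / 2) ^ (k + 1)) *
      (‖lam • (R * (1 / 2) ^ (k + 1)) • e‖ ^ (m + 1) *
        gamPlus φ (lam • (R * (1 / 2) ^ (k + 1)) • e))) hs
    (fun k => by
      simpa using (hφ.tendsto_pow_mul_gamPlus (Nat.succ_ne_zero m)
        (smul_ne_zero (by positivity : R * (1 / 2) ^ (k + 1) ≠ 0) he0)).const_mul
          (4 ^ (m + 1) * (R * (1 / 2) ^ (k + 1))))
    (Eventually.of_forall fun lam k => by
      rw [Real.norm_of_nonneg (mul_nonneg (by positivity) (hT0 _))]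
      exact mul_le_mul_of_nonneg_left (hC _) (by positivity))
  rw [tsum_zero] at h
  have h' := ENNReal.tendsto_ofReal h
  rw [ENNReal.ofReal_zero] at h'
  refine h'.congr fun lam => ?_
  refine ENNReal.ofReal_tsum_of_nonneg (fun k => mul_nonneg (by positivity) (hT0 _)) ?_
  exact Summable.of_nonneg_of_le (fun k => mul_nonneg (by positivity) (hT0 _))
    (fun k => mul_le_mul_of_nonneg_left (hC _) (by positivity)) hs

lemma IsSmoothCompactHypersurface.isFiniteMeasure_surfaceMeasure {d : ℕ} {S : Set (E d)}
    (hS : IsSmoothCompactHypersurface S) : IsFiniteMeasure (surfaceMeasure S) := by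
  rcases d with _ | m
  · rw [surfaceMeasure, hS.eq_empty, Measure.restrict_empty]; infer_instance
  · exact hS.isFiniteMeasure

/-- A C¹ function on a compact S is Lipschitz, so its squared increments are at most L²‖x-y‖². The
shell bound is uniform in x ∈ S and integrates against a finite measure. -/
lemma IsSmoothCompactHypersurface.tendsto_lintegral_gam {d : ℕ} {S : Set (E d)}
    (hS : IsSmoothCompactHypersurface S) {φ : E d → ℝ} (hφ : IsTestFunction φ) {g : E d → ℂ}
    (hg : IsC1On S g) :
    Tendsto (fun lam : ℝ => ∫⁻ x : E d × E d, ENNReal.ofReal (lam ^ d) *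
      ENNReal.ofReal (gam φ (lam • (x.2 - x.1))) * ‖g x.1 - g x.2‖ₑ ^ 2
        ∂((surfaceMeasure S).prod (surfaceMeasure S))) atTop (𝓝 0) := by
  rcases d with _ | m
  · simp [hS.eq_empty, surfaceMeasure]
  have hfin := hS.isFiniteMeasure
  obtain ⟨C, hC⟩ := hS.exists_measure_ball_le
  obtain ⟨L, hL⟩ := hg.exists_lipschitzOnWith hS.1
  obtain ⟨R, hR0, hR⟩ := hS.1.isBounded.subset_ball_lt 0 0
  set ν := surfaceMeasure S with hν
  have hSm : MeasurableSet S := hS.1.isClosed.measurableSet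
  have hmem : ∀ᵐ x ∂ν, x ∈ S := ae_restrict_mem hSm
  have hdist : ∀ x ∈ S, ∀ y ∈ S, ‖y - x‖ ≤ 2 * R := fun x hx y hy => by
    have h1 := mem_ball_zero_iff.1 (hR hx)
    have h2 := mem_ball_zero_iff.1 (hR hy)
    linarith [norm_sub_le y x]
  obtain ⟨e, he⟩ : ∃ e : E (m + 1), ‖e‖ = 1 := ⟨EuclideanSpace.single 0 1, by simp⟩
  have hlim := (ENNReal.Tendsto.const_mul (a := (L : ℝ≥0∞) ^ 2 * ν Set.univ * C)
    (tendsto_tsum_gamPlus hφ he (by positivity : 0 < 2 * R))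
      (Or.inr (by finiteness)))
  rw [mul_zero] at hlim
  refine tendsto_of_tendsto_of_tendsto_of_le_of_le' tendsto_const_nhds hlim
    (Eventually.of_forall fun _ => zero_le) ?_
  filter_upwards [eventually_gt_atTop 0] with lam hl
  set B : E (m + 1) × E (m + 1) → ℝ≥0∞ := fun x => ENNReal.ofReal (lam ^ (m + 1)) *
      ENNReal.ofReal (gam φ (lam • (x.2 - x.1))) * ENNReal.ofReal (‖x.2 - x.1‖ ^ 2) with hB
  have hBm : Measurable B := by
    have := (continuous_gam hφ.integrable).measurable
    fun_prop
  have hpt : ∀ᵐ x ∂ν.prod ν, ENNReal.ofReal (lam ^ (m + 1)) *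
      ENNReal.ofReal (gam φ (lam • (x.2 - x.1))) * ‖g x.1 - g x.2‖ₑ ^ 2 ≤
      (L : ℝ≥0∞) ^ 2 * B x := by
    have h1 : ∀ᵐ x ∂ν.prod ν, x.1 ∈ S := Measure.quasiMeasurePreserving_fst.ae hmem
    have h2 : ∀ᵐ x ∂ν.prod ν, x.2 ∈ S := Measure.quasiMeasurePreserving_snd.ae hmem
    filter_upwards [h1, h2] with x hx1 hx2
    have h3 : ‖g x.1 - g x.2‖ₑ ≤ L * ENNReal.ofReal ‖x.2 - x.1‖ := by
      rw [← edist_eq_enorm_sub, ofReal_norm, ← edist_eq_enorm_sub, edist_comm x.2]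
      exact hL hx1 hx2
    calc _ ≤ ENNReal.ofReal (lam ^ (m + 1)) * ENNReal.ofReal (gam φ (lam • (x.2 - x.1))) *
          (L * ENNReal.ofReal ‖x.2 - x.1‖) ^ 2 := by gcongr
      _ = _ := by
        simp only [hB]
        rw [ENNReal.ofReal_pow (norm_nonneg _)]
        ring
  calc _ ≤ ∫⁻ x, (L : ℝ≥0∞) ^ 2 * B x ∂ν.prod ν := lintegral_mono_ae hpt
    _ = (L : ℝ≥0∞) ^ 2 * ∫⁻ x, ∫⁻ y, B (x, y) ∂ν ∂ν := by
        rw [lintegral_const_mul _ hBm, lintegral_prod _ hBm.aemeasurable]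
    _ ≤ (L : ℝ≥0∞) ^ 2 * ∫⁻ _, C * ∑' k : ℕ, ENNReal.ofReal (4 ^ (m + 1) *
          (2 * R * (1 / 2) ^ (k + 1)) * (‖lam • (2 * R * (1 / 2) ^ (k + 1)) • e‖ ^ (m + 1) *
            gamPlus φ (lam • (2 * R * (1 / 2) ^ (k + 1)) • e))) ∂ν := by
        refine mul_le_mul_right (lintegral_mono_ae ?_) _
        filter_upwards [hmem] with x hx
        exact lintegral_gam_le_tsum hφ hC he (by positivity : 0 < 2 * R)
          (hmem.mono fun y hy => hdist x hx y hy) hl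
    _ = _ := by
        rw [lintegral_const]
        ring

end HypersurfaceLimit

/-! ### Assembly of the two claims -/

section Conclusion

variable {d n : ℕ} {Ω : Type*} [MeasurableSpace Ω] {P : Measure Ω} [IsProbabilityMeasure P]
  {X : E d → Ω → E n} {φ : E d → ℝ} {q : ℕ} {μ : MatrixMeasure d (Fin n)}

theorem IsStationaryGaussianField.tendsto_evariance_chaosZ (hX : IsStationaryGaussianField P X)
    (f : E n → ℝ) (hq : 1 ≤ q) (hφ : Integrable φ) (hμ : IsSpectralMeasure (covFun P X) μ)
    {ν : Measure (E d)} [SFinite ν] {S : E d → Matrix (Fin q → Fin n) (Fin q → Fin n) ℂ}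
    (hM : HasDensity (convPow μ q) ν S)
    (h : Tendsto (fun lam : ℝ => ∫⁻ x : E d × E d, ‖lam ^ d * gam φ (lam • (x.2 - x.1)) *
      (pairing (coeffForm (P.map (X 0)) f q) (S x.1) (S x.2)).re‖ₑ ∂(ν.prod ν)) atTop (𝓝 0)) :
    Tendsto (fun lam : ℝ => evariance (chaosZ P X f φ (2 * q) lam) P) atTop (𝓝 0) := by
  have h1 := ENNReal.Tendsto.const_mul (a := ENNReal.ofReal ((2 * q).factorial : ℝ)⁻¹) h
    (Or.inr ENNReal.ofReal_ne_top)
  rw [mul_zero] at h1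
  refine tendsto_of_tendsto_of_tendsto_of_le_of_le' tendsto_const_nhds h1
    (Eventually.of_forall fun _ => zero_le) ?_
  filter_upwards [eventually_gt_atTop 0] with lam hl
  rw [hX.evariance_chaosZ_eq f hq hφ hl hμ hM, ENNReal.ofReal_mul (by positivity)]
  refine mul_le_mul_right ?_ _
  refine (Real.ofReal_le_enorm _).trans (enorm_integral_le_lintegral_enorm _)

theorem IsStationaryGaussianField.liminf_evariance_chaosZ_pos (hX : IsStationaryGaussianField P X)
    (f : E n → ℝ) (hq : 1 ≤ q) (hφ : Integrable φ) (hμ : IsSpectralMeasure (covFun P X) μ)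
    (h0 : ∫ v, φ v ≠ 0)
    (hne : ¬ image (convPow μ q) ⊆ isotropicCone (P.map (X 0)) f q) :
    0 < liminf (fun lam : ℝ => evariance (chaosZ P X f φ (2 * q) lam) P) atTop := by
  -- The cone is closed, so if it fails to contain the image, some representation has ranges leaving
  -- it on a set that is not null.
  obtain ⟨ν, S, hS, hnS⟩ := exists_isRepresentation_not_ae (isClosed_cone _) hne
  have := hS.finite
  obtain ⟨c, hc, h⟩ := exists_pos_le_integral coeffForm_comm hS hnS hφ h0
  refine lt_of_lt_of_le (ENNReal.ofReal_pos.2 (by positivity :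
    0 < ((2 * q).factorial : ℝ)⁻¹ * c)) (le_liminf_of_le (by isBoundedDefault) ?_)
  filter_upwards [h, eventually_gt_atTop 0] with lam hlam hl
  rw [hX.evariance_chaosZ_eq f hq hφ hl hμ hS.density]
  exact ENNReal.ofReal_le_ofReal (mul_le_mul_of_nonneg_left hlam (by positivity))

theorem IsStationaryGaussianField.tendsto_evariance_of_memLp (hX : IsStationaryGaussianField P X)
    (f : E n → ℝ) (hq : 1 ≤ q) (hφ : IsTestFunction φ) (hμ : IsSpectralMeasure (covFun P X) μ)
    (hC : image (convPow μ q) ⊆ isotropicCone (P.map (X 0)) f q)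
    (hL : ∀ i j, MemLp (fun v => covFun P X v i j) (2 * q : ℕ) volume) :
    Tendsto (fun lam : ℝ => evariance (chaosZ P X f φ (2 * q) lam) P) atTop (𝓝 0) := by
  obtain ⟨S, hS, h⟩ := exists_hasDensity_volume_tendsto coeffForm_comm (hX.isPositive_convPow hμ q)
    (hμ.memLp_ft_convPow hq hL) hC hφ
  exact hX.tendsto_evariance_chaosZ f hq hφ.integrable hμ hS h

theorem IsStationaryGaussianField.tendsto_evariance_of_hasC1SurfaceDensity
    (hX : IsStationaryGaussianField P X)
    (f : E n → ℝ) (hq : 1 ≤ q) (hφ : IsTestFunction φ) (hμ : IsSpectralMeasure (covFun P X) μ)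
    (hC : image (convPow μ q) ⊆ isotropicCone (P.map (X 0)) f q)
    (hD : HasC1SurfaceDensity (convPow μ q)) :
    Tendsto (fun lam : ℝ => evariance (chaosZ P X f φ (2 * q) lam) P) atTop (𝓝 0) := by
  obtain ⟨S, D, hS, hC1, hd⟩ := hD
  have := hS.isFiniteMeasure_surfaceMeasure
  have hC' : image (convPow μ q) ⊆ cone (coeffForm (P.map (X 0)) f q) := hC
  have hlim := tendsto_lintegral_of_isotropic (F := coeffForm (P.map (X 0)) f q) (S := D)
    (fun I J => coeffForm_comm I J) (hX.isPositive_convPow hμ q) hd hC' hφ.integrable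
    fun I J => hS.tendsto_lintegral_gam hφ (g := fun x => D x I J) (hC1 I J)
  exact hX.tendsto_evariance_chaosZ f hq hφ.integrable hμ hd hlim

end Conclusion

end GaussianChaos

end

theorem theorem4 {d n : ℕ} {Ω : Type*} [MeasurableSpace Ω] (P : Measure Ω)
    [IsProbabilityMeasure P] (X : GaussianChaos.E d → Ω → GaussianChaos.E n)
    (hX : GaussianChaos.IsStationaryGaussianField P X)
    (f : GaussianChaos.E n → ℝ) (hf : MemLp f 2 (P.map (X 0)))
    (φ : GaussianChaos.E d → ℝ) (hφ : GaussianChaos.IsTestFunction φ)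
    (q : ℕ) (hq : 1 ≤ q) :
    -- the `2q`-th chaos is well defined and square-integrable
    (∀ lam : ℝ, 0 < lam →
      (∀ᵐ ω ∂P, Integrable (fun v => φ (lam⁻¹ • v) *
        GaussianChaos.chaosProj (P.map (X 0)) f (2 * q) (X v ω)) volume) ∧
      MemLp (GaussianChaos.chaosZ P X f φ (2 * q) lam) 2 P) ∧
    -- the spectral measure exists
    (∃ μ, GaussianChaos.IsSpectralMeasure (GaussianChaos.covFun P X) μ) ∧
    ∀ μ, GaussianChaos.IsSpectralMeasure (GaussianChaos.covFun P X) μ →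
      ((∫ v, φ v) ≠ 0 →
        ¬ GaussianChaos.image (GaussianChaos.convPow μ q) ⊆
            GaussianChaos.isotropicCone (P.map (X 0)) f q →
        0 < liminf (fun lam : ℝ => evariance (GaussianChaos.chaosZ P X f φ (2 * q) lam) P)
          atTop) ∧
      (GaussianChaos.image (GaussianChaos.convPow μ q) ⊆
            GaussianChaos.isotropicCone (P.map (X 0)) f q →
        ((∀ i j, MemLp (fun v => GaussianChaos.covFun P X v i j) (2 * q : ℕ) volume) ∨
          GaussianChaos.HasC1SurfaceDensity (GaussianChaos.convPow μ q)) →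
        Tendsto (fun lam : ℝ => evariance (GaussianChaos.chaosZ P X f φ (2 * q) lam) P)
          atTop (𝓝 0)) := by
  refine ⟨fun lam hl => ⟨hX.ae_integrable_chaosProj f (2 * q) hφ.integrable hl,
    hX.memLp_chaosZ f (2 * q) hφ.integrable hl⟩, hX.exists_isSpectralMeasure,
    fun μ hμ => ⟨fun h0 hne => hX.liminf_evariance_chaosZ_pos f hq hφ.integrable hμ h0 hne,
      fun hC h => ?_⟩⟩
  rcases h with h | h
  · exact hX.tendsto_evariance_of_memLp f hq hφ hμ hC h
  · exact hX.tendsto_evariance_of_hasC1SurfaceDensity f hq hφ hμ hC h
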